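/- **Theorem.** Let $p\equiv 1\pmod 4$ be a prime with $\left(\frac{-11}{p}\right)=1$. Suppose $p=c^2+d^2$ and $4p=x^2+11y^2$ with $c,d,x,y\in\mathbb Z$, $c\equiv 1\pmod 4$, $d=2^rd_0$ with $d_0$ odd, and $y=2^ty_0$ with $y_0\equiv 1\pmod 4$ (where $r,t\ge 0$ and $d_0,y_0$ are integers). Write $(m,n)$ for the greatest common divisor, and assume that $(c,x+2d)=1$ or $(d_0,x+2c)=1$. Here $[\cdot]$ is the greatest integer function, and fractions in congruences mod $p$ are read in $\mathbb Z/p\mathbb Z$. In each case below either all upper or all lower signs are taken; thus "$x\equiv\pm 4c,\pm 9c$" with upper signs means $x\equiv 4c$ or $x\equiv 9c$, and with lower signs $x\equiv -4c$ or $x\equiv -9c$. Then $p\nmid cx$; at least one of $x\equiv\pm4c,\pm9c\pmod{11}$ or $x\equiv\pm4d,\pm9d\pmod{11}$ holds; and $8\mid y$ if $p\equiv1\pmod 8$ and $2\mid x$. Moreover: (i) If $p\equiv 1\pmod 8$, then $$(-11)^{[p/8]}\equiv\begin{cases} \pm(-1)^{[x/4]}\pmod p&\text{if } 2\nmid x \text{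 and } x\equiv\pm4c,\pm9c\pmod{11},\\ \pm(-1)^{[x/4]}\frac dc\pmod p&\text{if } 2\nmid x \text{ and } x\equiv\pm4d,\pm9d\pmod{11},\\ \mp(-1)^{[x/8]+\frac y8}\pmod p&\text{if } 2\mid x \text{ and } x\equiv\pm4c,\pm9c\pmod{11},\\ \mp(-1)^{[x/8]+\frac y8}\frac dc\pmod p&\text{if } 2\mid x \text{ and } x\equiv\pm4d,\pm9d\pmod{11}. \end{cases}$$ (ii) If $p\equiv 5\pmod 8$, then $$(-11)^{[p/8]}\equiv\begin{cases} \mp(-1)^{\frac{x^2-1}8}\frac yx\pmod p&\text{if } 2\nmid x \text{ and } x\equiv\pm4c,\pm9c\pmod{11},\\ \mp(-1)^{\frac{x^2-1}8}\frac{dy}{cx}\pmod p&\text{if } 2\nmid x \text{ and } x\equiv\pm4d,\pm9d\pmod{11},\\ \mp(-1)^{\frac{p-5}8}\frac yx\pmod p&\text{if } 2\mid x \text{ and } x\equiv\pm4c,\pm9c\pmod{11},\\ \mp(-1)^{\frac{p-5}8}\frac{dy}{cx}\pmod p&\text{if } 2\mid x \text{ and } x\equiv\pm4d,\pm9d\pmod{11}.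 \end{cases}$$ -/

import Mathlib

open UniqueFactorizationMonoid

/-! Write π = c + di. Since (x/y)² = -11 in 𝔽_p, the power (x/y)^((p-1)/4) equals (-11)^[p/8] when p
≡ 1 mod 8 and (-11)^[p/8]·(x/y) when p ≡ 5 mod 8. It is also the image of the quotient (x/π)/(y/π)
of quartic residue symbols under the map ℤ[i] → 𝔽_p with i ↦ d/c, which kills π
(`pow_eq_of_quartic_eq`). So the theorem amounts to evaluating that quotient.

For odd x put A = x + 2π. Then N(A) = 2x(x+2c) + 11y² and A² = 4π(x+2c) - 11y². The first identity
gives -2x(x+2c) ≡ 11y² mod A, a relation between symbols modulo A. Reciprocity turns (x/A) into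
(2π/x) and then into (x/π), (11/A) into (A/11), and (y/A)² into (A²/y), which the second identity
reduces to (π/y). Rational integers have symbol 1 modulo coprime odd rational integers, so what
remains is (x/π) = (power of i)·(A/11)·(y/π). The power of i comes from the supplementary laws, and
(A/11) is read off from x modulo 11 in terms of c or d (`quartic_symbol_of_odd`,
`quartic_eleven_cases`).

For even x one has p = X² + 11Y² with x = 2X, y = 2Y, and A = X - iπ plays the same role. Both its
coordinates are odd, so a factor 1 ± i has to be split off first, at the price of the supplementary
law for 1 + i (`quartic_symbol_of_even`).

These relations need coprime entries. A common divisor g of x+2c and 2d (of X+d and c in the even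
case) divides y once and the first entry twice, so it can be divided out of A
(`exists_common_square_factor`). The only obstruction is the prime 11; when it occurs, x is replaced
by -x.

The reciprocity law used, (n/a) = (a/n) for a rational integer n ≡ 1 mod 4 (`quartic_reciprocity`),
comes from Gauss sums: the Jacobi sum J of the quartic character modulo π is ±π, the Gauss sum
satisfies g⁴ = pJ², and g^q is computed by Frobenius in characteristic q. -/

/-! ### Gaussian integers and fourth roots of unity. -/

/-- The Gaussian unit `i`. -/
def gaussI : GaussianInt := ⟨0, 1⟩

theorem gaussI_sq : gaussI ^ 2 = -1 := by
  rw [gaussI, pow_two]; ext <;> simp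

theorem gaussI_mul_self : gaussI * gaussI = -1 := by
  rw [← pow_two, gaussI_sq]

theorem gaussI_pow_four : gaussI ^ 4 = 1 := by
  rw [show (4 : ℕ) = 2 * 2 from rfl, pow_mul, gaussI_sq]; norm_num

theorem star_gaussI : star gaussI = -gaussI := by
  rw [gaussI]; ext <;> simp

theorem gaussian_eq (b : GaussianInt) : b = (b.re : GaussianInt) + (b.im : GaussianInt) * gaussI := by
  rw [gaussI]; ext <;> simp

theorem gaussian_norm_eq (b : GaussianInt) : b.norm = b.re ^ 2 + b.im ^ 2 := by
  rw [Zsqrtd.norm_def]; ring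

theorem gaussian_norm_cast (b : GaussianInt) : ((b.norm : ℤ) : GaussianInt) = b * star b :=
  Zsqrtd.norm_eq_mul_conj b

theorem fourth_root_cases {z : GaussianInt} (h : z ^ 4 = 1) :
    z = 1 ∨ z = -1 ∨ z = gaussI ∨ z = -gaussI := by
  have h1 : (z - 1) * ((z + 1) * ((z - gaussI) * (z + gaussI))) = 0 := by
    linear_combination h + (1 - z ^ 2) * gaussI_sq
  rcases mul_eq_zero.1 h1 with h | h
  · exact Or.inl (sub_eq_zero.1 h)
  rcases mul_eq_zero.1 h with h | h
  · exact Or.inr (Or.inl (eq_neg_of_add_eq_zero_left h))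
  rcases mul_eq_zero.1 h with h | h
  · exact Or.inr (Or.inr (Or.inl (sub_eq_zero.1 h)))
  · exact Or.inr (Or.inr (Or.inr (eq_neg_of_add_eq_zero_left h)))

theorem norm_sub_fourth_root_dvd {z w : GaussianInt} (hz : z ^ 4 = 1) (hw : w ^ 4 = 1)
    (hne : z ≠ w) : (z - w).norm ∣ 4 := by
  rcases fourth_root_cases hz with rfl | rfl | rfl | rfl <;>
  rcases fourth_root_cases hw with rfl | rfl | rfl | rfl <;>
  first
  | exact absurd rfl hne
  | simp [gaussI, Zsqrtd.norm_def]

theorem isUnit_of_fourth_root {z : GaussianInt} (hz : z ^ 4 = 1) : IsUnit z :=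
  IsUnit.of_pow_eq_one hz (by norm_num)

theorem star_mul_fourth_root {z : GaussianInt} (hz : z ^ 4 = 1) : star z = z ^ 3 := by
  rcases fourth_root_cases hz with rfl | rfl | rfl | rfl
  · simp
  · simp only [star_neg, star_one]; norm_num
  · rw [star_gaussI, pow_succ, gaussI_sq]; ring
  · rw [star_neg, star_gaussI]; linear_combination gaussI * gaussI_sq

/-- Distinct fourth roots of unity differ by an element of norm dividing 4, which no prime of odd
norm divides. Symbols can therefore be identified by congruences. -/
theorem eq_of_dvd_sub_fourth_root {l z w : GaussianInt} (hl : Prime l) (ho : Odd l.norm)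
    (hz : z ^ 4 = 1) (hw : w ^ 4 = 1) (h : l ∣ z - w) : z = w := by
  by_contra hne
  have h1 : l.norm ∣ 4 := by
    obtain ⟨m, hm⟩ := h
    refine dvd_trans ⟨m.norm, ?_⟩ (norm_sub_fourth_root_dvd hz hw hne)
    rw [hm, Zsqrtd.norm_mul]
  have h2 : IsCoprime l.norm 4 := by
    have : IsCoprime l.norm (2 ^ 2) := by
      apply IsCoprime.pow_right
      obtain ⟨k, hk⟩ := ho
      exact ⟨1, -k, by rw [hk]; ring⟩
    exact this
  have h3 : IsUnit l.norm := h2.isUnit_of_dvd' dvd_rfl h1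
  exact hl.not_isUnit ((Zsqrtd.isUnit_iff_norm_isUnit l).2 h3)

/-! ### Frobenius and Fermat's little theorem in ℤ[i]. -/

/-- Binomial expansion modulo q plus Fermat for the rational coordinates. The value of i^q then
makes Frobenius the identity for q ≡ 1 mod 4 and conjugation for q ≡ 3 mod 4. -/
theorem dvd_pow_prime_sub {q : ℕ} [hq : Fact q.Prime] (b : GaussianInt) :
    (q : GaussianInt) ∣ b ^ q - ((b.re : GaussianInt) + (b.im : GaussianInt) * gaussI ^ q) := by
  obtain ⟨r, hr⟩ := exists_add_pow_prime_eq hq.out (b.re : GaussianInt)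
    ((b.im : GaussianInt) * gaussI)
  rw [← gaussian_eq] at hr
  have key : ∀ a : ℤ, (q : GaussianInt) ∣ (a : GaussianInt) ^ q - a := by
    intro a
    have : (q : ℤ) ∣ a ^ q - a := by
      rw [← ZMod.intCast_eq_intCast_iff_dvd_sub]
      push_cast
      rw [ZMod.pow_card]
    have := (Int.castRingHom GaussianInt).map_dvd this
    simpa using this
  obtain ⟨s, hs⟩ := key b.re
  obtain ⟨t, ht⟩ := key b.im
  rw [hr]
  exact ⟨s + t * gaussI ^ q + b.re * (b.im * gaussI) * r, by
    rw [mul_pow]; linear_combination hs + gaussI ^ q * ht⟩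

theorem dvd_pow_sub_self {q : ℕ} [hq : Fact q.Prime] (h4 : q % 4 = 1) (b : GaussianInt) :
    (q : GaussianInt) ∣ b ^ q - b := by
  have h := dvd_pow_prime_sub (q := q) b
  have h1 : gaussI ^ q = gaussI := by
    rw [← Nat.div_add_mod q 4, h4, pow_add, pow_mul, gaussI_pow_four]; simp
  rwa [h1, ← gaussian_eq] at h

theorem dvd_pow_sub_star {q : ℕ} [hq : Fact q.Prime] (h4 : q % 4 = 3) (b : GaussianInt) :
    (q : GaussianInt) ∣ b ^ q - star b := by
  have h := dvd_pow_prime_sub (q := q) b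
  have h1 : gaussI ^ q = -gaussI := by
    rw [← Nat.div_add_mod q 4, h4, pow_add, pow_mul, gaussI_pow_four]
    linear_combination gaussI * gaussI_sq
  have h2 : star b = b.re + b.im * gaussI ^ q := by
    rw [h1, gaussI]; ext <;> simp
  rwa [← h2] at h

/-- The prime l divides some rational prime q dividing N(l), so N(l) divides q². Either N(l) = q, an
odd sum of two squares, or N(l) = q² and q is inert. -/
theorem odd_prime_classification {l : GaussianInt} (hl : Prime l) (ho : Odd l.norm) :
    (∃ q : ℕ, q.Prime ∧ q % 4 = 1 ∧ l.norm = q) ∨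
      (∃ q : ℕ, q.Prime ∧ q % 4 = 3 ∧ Associated l (q : GaussianInt)) := by
  have hn0 : 0 < l.norm := GaussianInt.norm_pos.2 hl.ne_zero
  obtain ⟨N, hN⟩ : ∃ N : ℕ, l.norm = N := ⟨l.norm.natAbs, by omega⟩
  have hNpos : N ≠ 0 := by omega
  have h1 : l ∣ ((N : ℕ) : GaussianInt) := by
    have := gaussian_norm_cast l
    rw [hN] at this
    exact ⟨star l, by simpa using this⟩
  obtain ⟨q, hqp, hqN, hlq⟩ : ∃ q : ℕ, q.Prime ∧ q ∣ N ∧ l ∣ (q : GaussianInt) := by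
    have h2 : l ∣ ((N.primeFactorsList.map (Nat.cast : ℕ → GaussianInt))).prod := by
      rw [← Nat.cast_list_prod, Nat.prod_primeFactorsList hNpos]
      exact h1
    obtain ⟨a, ha, hla⟩ := (Prime.dvd_prod_iff hl).1 h2
    obtain ⟨q, hq, rfl⟩ := List.mem_map.1 ha
    exact ⟨q, Nat.prime_of_mem_primeFactorsList hq, Nat.dvd_of_mem_primeFactorsList hq, hla⟩
  have hqodd : Odd q := by
    have : Odd N := by rw [hN] at ho; exact_mod_cast ho
    exact this.of_dvd_nat hqN
  obtain ⟨m, hm⟩ := hlq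
  have h3 : (q : ℤ) ^ 2 = l.norm * m.norm := by
    rw [← Zsqrtd.norm_mul, ← hm]
    simp [Zsqrtd.norm_def, pow_two]
  have h4 : N ∣ q ^ 2 := by
    rw [hN] at h3
    have : (N : ℤ) ∣ (q : ℤ) ^ 2 := ⟨_, h3⟩
    exact_mod_cast this
  obtain ⟨k, hk, hNk⟩ := (Nat.dvd_prime_pow hqp).1 h4
  have : Fact q.Prime := ⟨hqp⟩
  interval_cases k
  · exfalso
    apply hl.not_isUnit
    rw [Zsqrtd.isUnit_iff_norm_isUnit, hN, hNk]; simp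
  · left
    refine ⟨q, hqp, ?_, by rw [hN, hNk]; simp⟩
    have h5 := gaussian_norm_eq l
    rw [hN, hNk] at h5
    have : q % 2 = 1 := Nat.odd_iff.1 hqodd
    have h6 : ((q : ℤ)) % 4 = (l.re ^ 2 + l.im ^ 2) % 4 := by rw [← h5]; simp
    have h7 : ∀ a : ℤ, a ^ 2 % 4 = 0 ∨ a ^ 2 % 4 = 1 := by
      intro a
      rcases Int.even_or_odd' a with ⟨b, rfl | rfl⟩
      · left; ring_nf; omega
      · right; ring_nf; omega
    rcases h7 l.re with h | h <;> rcases h7 l.im with h' | h' <;> omega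
  · right
    have h5 : m.norm = 1 := by
      rw [hN, hNk] at h3
      have h0 : ((q ^ 2 : ℕ) : ℤ) ≠ 0 := by
        have := hqp.pos; positivity
      apply mul_left_cancel₀ h0
      rw [← h3]; push_cast; ring
    have hmu : IsUnit m := (Zsqrtd.isUnit_iff_norm_isUnit m).2 (by rw [h5]; exact isUnit_one)
    have has : Associated l (q : GaussianInt) := ⟨hmu.unit, by rw [hm]; simp⟩
    refine ⟨q, hqp, ?_, has⟩
    exact GaussianInt.mod_four_eq_three_of_nat_prime_of_prime q (has.prime hl)

theorem norm_eq_of_associated {a b : GaussianInt} (h : Associated a b) : a.norm = b.norm := by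
  obtain ⟨u, rfl⟩ := h
  have h1 : (u : GaussianInt).norm = 1 := by
    have h0 := (Zsqrtd.isUnit_iff_norm_isUnit (u : GaussianInt)).1 u.isUnit
    have := GaussianInt.norm_nonneg (u : GaussianInt)
    rcases Int.isUnit_iff.1 h0 with h | h <;> omega
  rw [Zsqrtd.norm_mul, h1, mul_one]

theorem norm_natCast_gaussian (q : ℕ) : (q : GaussianInt).norm = (q : ℤ) ^ 2 := by
  simp [Zsqrtd.norm_def, pow_two]

theorem odd_norm_mod_four {a : GaussianInt} (ho : Odd a.norm) : a.norm.natAbs % 4 = 1 := by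
  have h7 : ∀ a : ℤ, a ^ 2 % 4 = 0 ∨ a ^ 2 % 4 = 1 := by
    intro a
    rcases Int.even_or_odd' a with ⟨b, rfl | rfl⟩
    · left; ring_nf; omega
    · right; ring_nf; omega
  have h0 := GaussianInt.norm_nonneg a
  have h1 := gaussian_norm_eq a
  have h2 := Int.odd_iff.1 ho
  rcases h7 a.re with h | h <;> rcases h7 a.im with h' | h' <;> omega

/-- For split q one Frobenius already fixes b modulo l; for inert q it is conjugation and has to be
applied twice. -/
theorem dvd_pow_norm_sub_one {l b : GaussianInt} (hl : Prime l) (ho : Odd l.norm) (hb : ¬ l ∣ b) :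
    l ∣ b ^ (l.norm.natAbs - 1) - 1 := by
  have key : l ∣ b ^ l.norm.natAbs - b := by
    rcases odd_prime_classification hl ho with ⟨q, hq, h4, hn⟩ | ⟨q, hq, h4, ha⟩
    · have : Fact q.Prime := ⟨hq⟩
      have h1 : l ∣ (q : GaussianInt) := by
        have := gaussian_norm_cast l
        rw [hn] at this
        exact ⟨star l, by simpa using this⟩
      rw [hn]
      exact h1.trans (dvd_pow_sub_self h4 b)
    · have : Fact q.Prime := ⟨hq⟩
      rw [norm_eq_of_associated ha, norm_natCast_gaussian]
      refine ha.dvd.trans ?_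
      have e : ((q : ℤ) ^ 2).natAbs = q * q := by
        rw [Int.natAbs_pow]; simp [pow_two]
      rw [e, pow_mul]
      obtain ⟨r, hr⟩ := dvd_pow_sub_star h4 b
      obtain ⟨s, hs⟩ := dvd_pow_sub_star h4 (star b)
      rw [star_star] at hs
      have h5 : (q : GaussianInt) ∣ (b ^ q) ^ q - (star b) ^ q :=
        (Dvd.intro _ hr.symm).trans (sub_dvd_pow_sub_pow _ _ _)
      obtain ⟨t, ht⟩ := h5
      exact ⟨t + s, by linear_combination ht + hs⟩
  have h1 : 0 < l.norm.natAbs := by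
    have := GaussianInt.norm_pos.2 hl.ne_zero; omega
  have h2 : b ^ l.norm.natAbs - b = b * (b ^ (l.norm.natAbs - 1) - 1) := by
    obtain ⟨k, hk⟩ := Nat.exists_eq_succ_of_ne_zero h1.ne'
    rw [hk, Nat.succ_sub_one, pow_succ]; ring
  rw [h2] at key
  exact (hl.dvd_or_dvd key).resolve_left hb

theorem exists_fourth_root {l b : GaussianInt} (hl : Prime l) (ho : Odd l.norm) (hb : ¬ l ∣ b) :
    ∃ z : GaussianInt, z ^ 4 = 1 ∧ l ∣ b ^ ((l.norm.natAbs - 1) / 4) - z := by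
  have h := dvd_pow_norm_sub_one hl ho hb
  have h4 := odd_norm_mod_four ho
  have e : l.norm.natAbs - 1 = (l.norm.natAbs - 1) / 4 * 4 := by omega
  rw [e, pow_mul] at h
  set c := b ^ ((l.norm.natAbs - 1) / 4) with hc
  have h1 : c ^ 4 - 1 = (c - 1) * ((c - (-1)) * ((c - gaussI) * (c - (-gaussI)))) := by
    linear_combination (c ^ 2 - 1) * gaussI_sq
  rw [h1] at h
  rcases hl.dvd_or_dvd h with h | h
  · exact ⟨1, by norm_num, h⟩
  rcases hl.dvd_or_dvd h with h | h
  · exact ⟨-1, by norm_num, h⟩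
  rcases hl.dvd_or_dvd h with h | h
  · exact ⟨gaussI, gaussI_pow_four, h⟩
  · exact ⟨-gaussI, by rw [Even.neg_pow (by decide), gaussI_pow_four], h⟩

/-! ### The quartic residue symbol. -/

open Classical in
/-- The quartic residue symbol of `b` modulo the Gaussian prime `l`. -/
noncomputable def quarticPrime (l b : GaussianInt) : GaussianInt :=
  -- For a prime l of odd norm the default 0 is taken exactly when l divides b, which is the value a
  -- multiplicative character needs there.
  if h : ∃ z : GaussianInt, z ^ 4 = 1 ∧ l ∣ b ^ ((l.norm.natAbs - 1) / 4) - z then h.choose else 0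

theorem quarticPrime_spec {l b : GaussianInt} (hl : Prime l) (ho : Odd l.norm) (hb : ¬ l ∣ b) :
    quarticPrime l b ^ 4 = 1 ∧ l ∣ b ^ ((l.norm.natAbs - 1) / 4) - quarticPrime l b := by
  have h := exists_fourth_root hl ho hb
  rw [quarticPrime, dif_pos h]
  exact h.choose_spec

theorem quarticPrime_eq {l b z : GaussianInt} (hl : Prime l) (ho : Odd l.norm) (hb : ¬ l ∣ b)
    (hz : z ^ 4 = 1) (h : l ∣ b ^ ((l.norm.natAbs - 1) / 4) - z) : quarticPrime l b = z := by
  obtain ⟨h1, h2⟩ := quarticPrime_spec hl ho hb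
  apply eq_of_dvd_sub_fourth_root hl ho h1 hz
  have := dvd_sub h h2
  rwa [sub_sub_sub_cancel_left] at this

theorem quarticPrime_of_associated {l l' : GaussianInt} (h : Associated l l') (b : GaussianInt) :
    quarticPrime l b = quarticPrime l' b := by
  have : (fun z : GaussianInt => z ^ 4 = 1 ∧ l ∣ b ^ ((l.norm.natAbs - 1) / 4) - z) =
      (fun z : GaussianInt => z ^ 4 = 1 ∧ l' ∣ b ^ ((l'.norm.natAbs - 1) / 4) - z) := by
    funext z
    rw [norm_eq_of_associated h, h.dvd_iff_dvd_left]
  unfold quarticPrime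
  congr! 1
  all_goals simp [norm_eq_of_associated h, h.dvd_iff_dvd_left]

theorem quarticPrime_congr {l b b' : GaussianInt} (h : l ∣ b - b') :
    quarticPrime l b = quarticPrime l b' := by
  have key : ∀ z : GaussianInt, (l ∣ b ^ ((l.norm.natAbs - 1) / 4) - z) ↔
      (l ∣ b' ^ ((l.norm.natAbs - 1) / 4) - z) := by
    intro z
    apply dvd_iff_dvd_of_dvd_sub
    rw [sub_sub_sub_cancel_right]
    exact h.trans (sub_dvd_pow_sub_pow _ _ _)
  unfold quarticPrime
  congr! 1
  all_goals simp [key]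

theorem quarticPrime_mul {l b c : GaussianInt} (hl : Prime l) (ho : Odd l.norm) (hb : ¬ l ∣ b)
    (hc : ¬ l ∣ c) : quarticPrime l (b * c) = quarticPrime l b * quarticPrime l c := by
  obtain ⟨h1, h2⟩ := quarticPrime_spec hl ho hb
  obtain ⟨h3, h4⟩ := quarticPrime_spec hl ho hc
  apply quarticPrime_eq hl ho
  · exact fun h => (hl.dvd_or_dvd h).elim hb hc
  · rw [mul_pow, h1, h3, one_mul]
  · obtain ⟨s, hs⟩ := h2
    obtain ⟨t, ht⟩ := h4
    refine ⟨s * c ^ ((l.norm.natAbs - 1) / 4) + quarticPrime l b * t, ?_⟩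
    rw [mul_pow]
    linear_combination hs * c ^ ((l.norm.natAbs - 1) / 4) + quarticPrime l b * ht

theorem star_dvd_star_iff {a b : GaussianInt} : star a ∣ star b ↔ a ∣ b := by
  constructor
  · rintro ⟨c, hc⟩
    refine ⟨star c, ?_⟩
    rw [← star_star b, hc, star_mul, star_star, mul_comm]
  · rintro ⟨c, rfl⟩
    exact ⟨star c, by rw [star_mul, mul_comm]⟩

theorem prime_star {l : GaussianInt} (hl : Prime l) : Prime (star l) := by
  refine ⟨fun h => hl.ne_zero (star_eq_zero.1 h), fun h => hl.not_isUnit (isUnit_star.1 h), ?_⟩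
  intro a b h
  have h' : l ∣ star a * star b := by
    rw [← star_dvd_star_iff, star_mul, star_star, star_star, mul_comm]; exact h
  rcases hl.dvd_or_dvd h' with h | h
  · left; rw [← star_dvd_star_iff, star_star] at h; exact h
  · right; rw [← star_dvd_star_iff, star_star] at h; exact h

theorem quarticPrime_star {l b : GaussianInt} (hl : Prime l) (ho : Odd l.norm) (hb : ¬ l ∣ b) :
    quarticPrime (star l) (star b) = star (quarticPrime l b) := by
  obtain ⟨h1, h2⟩ := quarticPrime_spec hl ho hb
  have hn : (star l).norm = l.norm := Zsqrtd.norm_conj l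
  apply quarticPrime_eq (prime_star hl) (by rwa [hn]) (by rwa [star_dvd_star_iff])
  · rw [← star_pow, h1, star_one]
  · rw [hn, ← star_pow, ← star_sub, star_dvd_star_iff]
    exact h2

/-- The quartic Jacobi symbol of `b` modulo the Gaussian integer `a`. -/
noncomputable def quartic (b a : GaussianInt) : GaussianInt :=
  ((factors a).map (fun l => quarticPrime l b)).prod

/-- `factors` is multiplicative only up to associates; this is harmless because the prime symbol
does not change when l is replaced by an associate. -/
theorem quartic_mul_right {a a' : GaussianInt} (ha : a ≠ 0) (ha' : a' ≠ 0) (b : GaussianInt) :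
    quartic b (a * a') = quartic b a * quartic b a' := by
  have h := factors_mul ha ha'
  rw [quartic, quartic, quartic, ← Multiset.prod_add, ← Multiset.map_add]
  congr 1
  rw [← Multiset.rel_eq, Multiset.rel_map]
  exact h.mono (fun x _ y _ hxy => quarticPrime_of_associated hxy b)

theorem quartic_of_isUnit {a : GaussianInt} (ha : IsUnit a) (b : GaussianInt) :
    quartic b a = 1 := by
  have : factors a = 0 := (factors_of_isUnit ha)
  rw [quartic, this]; simp

theorem quartic_of_associated {a a' : GaussianInt} (h : Associated a a') (b : GaussianInt) :
    quartic b a = quartic b a' := by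
  obtain ⟨u, rfl⟩ := h
  rcases eq_or_ne a 0 with rfl | ha
  · simp
  · rw [quartic_mul_right ha u.ne_zero, quartic_of_isUnit u.isUnit, mul_one]

theorem quartic_prime {l : GaussianInt} (hl : Prime l) (b : GaussianInt) :
    quartic b l = quarticPrime l b := by
  obtain ⟨p, hp, hf⟩ := factors_eq_singleton_of_irreducible hl.irreducible
  rw [quartic, hf]
  simp [quarticPrime_of_associated hp b]

theorem odd_norm_induction {P : GaussianInt → Prop} (hu : ∀ u, IsUnit u → P u)
    (hm : ∀ l a, Prime l → Odd l.norm → Odd a.norm → P a → P (l * a)) :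
    ∀ a : GaussianInt, Odd a.norm → P a := by
  intro a
  induction a using induction_on_prime with
  | h₁ => intro h; simp at h
  | h₂ x hx => exact fun _ => hu x hx
  | h₃ a p ha hp ih =>
    intro h
    rw [Zsqrtd.norm_mul, Int.odd_mul] at h
    exact hm p a hp h.1 h.2 (ih h.2)

theorem ne_zero_of_odd_norm {a : GaussianInt} (h : Odd a.norm) : a ≠ 0 := by
  rintro rfl; simp at h

theorem not_dvd_of_isCoprime {l b : GaussianInt} (hl : Prime l) (h : IsCoprime b l) : ¬ l ∣ b :=
  fun hd => hl.not_isUnit (h.isUnit_of_dvd' hd dvd_rfl)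

theorem quartic_pow_four {a b : GaussianInt} (ha : Odd a.norm) (h : IsCoprime b a) :
    quartic b a ^ 4 = 1 := by
  revert h
  refine odd_norm_induction (P := fun a => IsCoprime b a → quartic b a ^ 4 = 1) ?_ ?_ a ha
  · intro u hu _; rw [quartic_of_isUnit hu, one_pow]
  · intro l a hl ho ha ih h
    rw [quartic_mul_right hl.ne_zero (ne_zero_of_odd_norm ha), mul_pow,
      ih h.of_mul_right_right, quartic_prime hl,
      (quarticPrime_spec hl ho (not_dvd_of_isCoprime hl h.of_mul_right_left)).1, one_mul]

theorem quartic_ne_zero {a b : GaussianInt} (ha : Odd a.norm) (h : IsCoprime b a) :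
    quartic b a ≠ 0 := by
  intro h0
  have := quartic_pow_four ha h
  rw [h0] at this; norm_num at this

theorem quartic_mul_left {a b c : GaussianInt} (ha : Odd a.norm) (hb : IsCoprime b a)
    (hc : IsCoprime c a) : quartic (b * c) a = quartic b a * quartic c a := by
  revert hb hc
  refine odd_norm_induction (P := fun a => IsCoprime b a → IsCoprime c a →
    quartic (b * c) a = quartic b a * quartic c a) ?_ ?_ a ha
  · intro u hu _ _; simp only [quartic_of_isUnit hu, one_mul]
  · intro l a hl ho ha ih hb hc
    have ha0 := ne_zero_of_odd_norm ha
    rw [quartic_mul_right hl.ne_zero ha0, quartic_mul_right hl.ne_zero ha0,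
      quartic_mul_right hl.ne_zero ha0, ih hb.of_mul_right_right hc.of_mul_right_right,
      quartic_prime hl, quartic_prime hl, quartic_prime hl,
      quarticPrime_mul hl ho (not_dvd_of_isCoprime hl hb.of_mul_right_left)
        (not_dvd_of_isCoprime hl hc.of_mul_right_left)]
    ring

theorem quartic_congr {a b b' : GaussianInt} (h : a ∣ b - b') : quartic b a = quartic b' a := by
  rcases eq_or_ne a 0 with rfl | ha
  · rw [sub_eq_zero.1 (zero_dvd_iff.1 h)]
  rw [quartic, quartic]
  congr 1
  apply Multiset.map_congr rfl
  intro l hl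
  exact quarticPrime_congr ((dvd_of_mem_factors hl).trans h)

theorem quartic_one_left {a : GaussianInt} (ha : Odd a.norm) : quartic 1 a = 1 := by
  have h := quartic_mul_left ha (isCoprime_one_left (x := a)) (isCoprime_one_left (x := a))
  rw [mul_one] at h
  exact (mul_eq_left₀ (quartic_ne_zero ha isCoprime_one_left)).1 h.symm

theorem quartic_pow_left {a b : GaussianInt} (ha : Odd a.norm) (hb : IsCoprime b a) (n : ℕ) :
    quartic (b ^ n) a = quartic b a ^ n := by
  induction n with
  | zero => simp [quartic_one_left ha]
  | succ n ih => rw [pow_succ, quartic_mul_left ha hb.pow_left hb, ih, pow_succ]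

theorem quartic_star {a b : GaussianInt} (ha : Odd a.norm) (hb : IsCoprime b a) :
    quartic (star b) (star a) = star (quartic b a) := by
  revert hb
  refine odd_norm_induction (P := fun a => IsCoprime b a →
    quartic (star b) (star a) = star (quartic b a)) ?_ ?_ a ha
  · intro u hu _
    rw [quartic_of_isUnit hu, quartic_of_isUnit (isUnit_star.2 hu), star_one]
  · intro l a hl ho ha ih hb
    have ha0 := ne_zero_of_odd_norm ha
    rw [quartic_mul_right hl.ne_zero ha0, star_mul, quartic_mul_right (star_ne_zero.2 ha0)
      (star_ne_zero.2 hl.ne_zero), ih hb.of_mul_right_right, quartic_prime hl,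
      quartic_prime (prime_star hl),
      quarticPrime_star hl ho (not_dvd_of_isCoprime hl hb.of_mul_right_left), star_mul]

/-! ### Powers of i, symbols modulo rational integers, and the laws for i and 1 + i. -/

/-- The Gaussian unit `i`, as an element of the unit group. -/
def gaussIUnit : GaussianIntˣ := ⟨gaussI, -gaussI, by
  rw [mul_neg, gaussI_mul_self, neg_neg], by rw [neg_mul, gaussI_mul_self, neg_neg]⟩

/-- The integral power `i ^ k` in the Gaussian integers. -/
def gaussIPow (k : ℤ) : GaussianInt := ((gaussIUnit ^ k : GaussianIntˣ) : GaussianInt)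

theorem gaussIPow_add (j k : ℤ) : gaussIPow (j + k) = gaussIPow j * gaussIPow k := by
  rw [gaussIPow, zpow_add, Units.val_mul]; rfl

theorem gaussIPow_zero : gaussIPow 0 = 1 := by rw [gaussIPow, zpow_zero, Units.val_one]

theorem gaussIPow_one : gaussIPow 1 = gaussI := by rw [gaussIPow, zpow_one]; rfl

theorem gaussIPow_natCast (k : ℕ) : gaussIPow k = gaussI ^ k := by
  rw [gaussIPow, zpow_natCast, Units.val_pow_eq_pow_val]; rfl

theorem gaussIPow_two : gaussIPow 2 = -1 := by
  have := gaussIPow_natCast 2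
  rwa [gaussI_sq] at this

theorem gaussIPow_neg_mul (k : ℤ) : gaussIPow (-k) * gaussIPow k = 1 := by
  rw [← gaussIPow_add, neg_add_cancel, gaussIPow_zero]

theorem gaussIUnit_pow_four : gaussIUnit ^ (4 : ℤ) = 1 := by
  ext1
  have := gaussIPow_natCast 4
  rw [gaussI_pow_four] at this
  exact this

theorem gaussIPow_congr {j k : ℤ} (h : j ≡ k [ZMOD 4]) : gaussIPow j = gaussIPow k := by
  obtain ⟨m, hm⟩ := h.dvd
  have : k = j + 4 * m := by linarith
  rw [this, gaussIPow, gaussIPow, zpow_add, zpow_mul, gaussIUnit_pow_four, one_zpow, mul_one]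

theorem gaussIPow_mul (j k : ℤ) : gaussIPow (j * k) = ((gaussIUnit ^ j) ^ k : GaussianIntˣ) := by
  rw [gaussIPow, zpow_mul]

theorem gaussIPow_pow (j : ℤ) (n : ℕ) : gaussIPow j ^ n = gaussIPow (j * n) := by
  rw [gaussIPow_mul, zpow_natCast, Units.val_pow_eq_pow_val]; rfl

theorem gaussIPow_pow_four (k : ℤ) : gaussIPow k ^ 4 = 1 := by
  rw [gaussIPow_pow, ← gaussIPow_zero]
  apply gaussIPow_congr
  rw [Int.modEq_zero_iff_dvd]
  exact ⟨k, by push_cast; ring⟩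

theorem gaussIPow_ne_zero (k : ℤ) : gaussIPow k ≠ 0 := Units.ne_zero _

theorem star_gaussIPow (k : ℤ) : star (gaussIPow k) = gaussIPow (-k) := by
  rw [star_mul_fourth_root (gaussIPow_pow_four k), gaussIPow_pow]
  apply gaussIPow_congr
  rw [Int.modEq_iff_dvd]
  exact ⟨-k, by push_cast; ring⟩

theorem prime_of_norm_prime {l : GaussianInt} {q : ℕ} (hq : q.Prime) (h : l.norm = q) :
    Prime l := by
  rw [← irreducible_iff_prime]
  refine ⟨fun hu => ?_, fun a b hab => ?_⟩
  · rw [Zsqrtd.isUnit_iff_norm_isUnit, h, Int.isUnit_iff] at hu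
    have := hq.two_le
    omega
  · have h1 : (q : ℤ) = a.norm * b.norm := by rw [← h, hab, Zsqrtd.norm_mul]
    have hqi : Irreducible (q : ℤ) := (Nat.prime_iff_prime_int.1 hq).irreducible
    rcases hqi.isUnit_or_isUnit h1 with hu | hu
    · exact Or.inl ((Zsqrtd.isUnit_iff_norm_isUnit a).2 hu)
    · exact Or.inr ((Zsqrtd.isUnit_iff_norm_isUnit b).2 hu)

theorem odd_norm_natCast {q : ℕ} (h : Odd q) : Odd (q : GaussianInt).norm := by
  rw [norm_natCast_gaussian]
  have : Odd (q : ℤ) := by exact_mod_cast h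
  exact this.pow

theorem norm_intCast_gaussian (q : ℤ) : (q : GaussianInt).norm = q ^ 2 := by
  simp [Zsqrtd.norm_def, pow_two]

theorem odd_norm_intCast {q : ℤ} (h : Odd q) : Odd (q : GaussianInt).norm := by
  rw [norm_intCast_gaussian]
  exact h.pow

theorem prime_three_mod_four {q : ℕ} [Fact q.Prime] (h : q % 4 = 3) : Prime (q : GaussianInt) :=
  GaussianInt.prime_of_nat_prime_of_mod_four_eq_three q h

theorem exists_gaussian_norm_eq {q : ℕ} [hq : Fact q.Prime] (h : q % 4 = 1) :
    ∃ l : GaussianInt, Prime l ∧ l.norm = q ∧ (q : GaussianInt) = l * star l := by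
  obtain ⟨a, b, hab⟩ := Nat.Prime.sq_add_sq (p := q) (by omega)
  have hn : (⟨a, b⟩ : GaussianInt).norm = q := by
    rw [gaussian_norm_eq]; dsimp only; exact_mod_cast hab
  refine ⟨⟨a, b⟩, prime_of_norm_prime hq.out hn, hn, ?_⟩
  rw [← gaussian_norm_cast, hn]; simp

/-- The factor at the conjugate prime is the conjugate of the symbol of `star b` at l, and
conjugation cubes a fourth root of unity. A symbol modulo a split q becomes a computation at l
alone. -/
theorem quartic_natPrime_one_mod_four {q : ℕ} {l b : GaussianInt} (hl : Prime l)
    (hn : l.norm = q) (ho : Odd q) (hql : (q : GaussianInt) = l * star l)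
    (hb : IsCoprime b (q : GaussianInt)) :
    quartic b q = quarticPrime l b * quarticPrime l (star b) ^ 3 ∧ ¬ l ∣ b ∧ ¬ l ∣ star b := by
  have hol : Odd l.norm := by rw [hn]; exact_mod_cast ho
  rw [hql] at hb
  have h1 := not_dvd_of_isCoprime hl hb.of_mul_right_left
  have h2 : ¬ l ∣ star b := by
    rw [← star_dvd_star_iff, star_star]
    exact not_dvd_of_isCoprime (prime_star hl) hb.of_mul_right_right
  refine ⟨?_, h1, h2⟩
  have h3 := quarticPrime_star hl hol h2
  rw [star_star] at h3
  rw [hql, quartic_mul_right hl.ne_zero (prime_star hl).ne_zero, quartic_prime hl,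
    quartic_prime (prime_star hl), h3,
    star_mul_fourth_root (quarticPrime_spec hl hol h2).1]

/-- For inert q the exponent (q²-1)/4 factors as (q-1)·((q+1)/4). This form is convenient because
Frobenius determines b^(q-1) modulo q. -/
theorem quartic_natPrime_three_mod_four {q : ℕ} [hq : Fact q.Prime] (h4 : q % 4 = 3)
    {b z : GaussianInt} (hb : IsCoprime b (q : GaussianInt)) (hz : z ^ 4 = 1)
    (h : (q : GaussianInt) ∣ (b ^ (q - 1)) ^ ((q + 1) / 4) - z) : quartic b q = z := by
  have hp := prime_three_mod_four h4
  have ho : Odd q := Nat.odd_iff.2 (by omega)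
  rw [quartic_prime hp]
  apply quarticPrime_eq hp (odd_norm_natCast ho) (not_dvd_of_isCoprime hp hb) hz
  rw [norm_natCast_gaussian]
  have e : (((q : ℤ) ^ 2).natAbs - 1) / 4 = (q - 1) * ((q + 1) / 4) := by
    have e1 : ((q : ℤ) ^ 2).natAbs = q ^ 2 := by rw [Int.natAbs_pow]; simp
    rw [e1]
    obtain ⟨k, hk⟩ : ∃ k, q = 4 * k + 3 := ⟨q / 4, by omega⟩
    rw [hk, show (4 * k + 3 + 1) / 4 = k + 1 by omega, show 4 * k + 3 - 1 = 4 * k + 2 by omega]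
    have : (4 * k + 3) ^ 2 - 1 = 4 * ((4 * k + 2) * (k + 1)) := by
      have : (4 * k + 3) ^ 2 = 4 * ((4 * k + 2) * (k + 1)) + 1 := by ring
      omega
    rw [this]; omega
  rwa [e, pow_mul]

theorem star_intCast_gaussian (m : ℤ) : star (m : GaussianInt) = m := by
  ext <;> simp

/-- For split q the two conjugate factors multiply to z·z³ = 1; for inert q already m^(q-1) ≡ 1. -/
theorem quartic_intCast_natPrime {q : ℕ} [hq : Fact q.Prime] (ho : Odd q) {m : ℤ}
    (hm : IsCoprime (m : GaussianInt) (q : GaussianInt)) : quartic m q = 1 := by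
  have : q % 4 = 1 ∨ q % 4 = 3 := by have := Nat.odd_iff.1 ho; omega
  rcases this with h4 | h4
  · obtain ⟨l, hl, hn, hql⟩ := exists_gaussian_norm_eq h4
    obtain ⟨h1, h2, -⟩ := quartic_natPrime_one_mod_four hl hn ho hql hm
    rw [h1, star_intCast_gaussian, ← pow_succ']
    exact (quarticPrime_spec hl (by rw [hn]; exact_mod_cast ho) h2).1
  · apply quartic_natPrime_three_mod_four h4 hm (one_pow 4)
    have hp := prime_three_mod_four h4
    have h1 : (q : GaussianInt) ∣ (m : GaussianInt) ^ (q - 1) - 1 := by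
      have h2 : (m : ZMod q) ≠ 0 := by
        intro h0
        rw [ZMod.intCast_zmod_eq_zero_iff_dvd] at h0
        apply not_dvd_of_isCoprime hp hm
        have := (Int.castRingHom GaussianInt).map_dvd h0
        simpa using this
      have h3 := ZMod.pow_card_sub_one_eq_one h2
      have h4 : (q : ℤ) ∣ m ^ (q - 1) - 1 := by
        rw [← ZMod.intCast_eq_intCast_iff_dvd_sub]
        push_cast
        exact h3.symm
      have := (Int.castRingHom GaussianInt).map_dvd h4
      simpa using this
    have := h1.trans (sub_dvd_pow_sub_pow _ _ ((q + 1) / 4))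
    rwa [one_pow] at this

/-- Induction over odd natural numbers through prime factors. -/
theorem odd_nat_induction {P : ℕ → Prop} (h1 : P 1)
    (hm : ∀ q n : ℕ, q.Prime → Odd q → Odd n → P n → P (q * n)) : ∀ n : ℕ, Odd n → P n := by
  intro n
  induction n using induction_on_primes with
  | zero => intro h; simp at h
  | one => exact fun _ => h1
  | prime_mul p a hp ih =>
    intro h
    rw [Nat.odd_mul] at h
    exact hm p a hp h.1 h.2 (ih h.2)

theorem natCast_gaussian_ne_zero {n : ℕ} (h : Odd n) : (n : GaussianInt) ≠ 0 :=
  ne_zero_of_odd_norm (odd_norm_natCast h)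

theorem associated_natAbs (n : ℤ) : Associated (n : GaussianInt) (n.natAbs : GaussianInt) := by
  rcases Int.natAbs_eq n with h | h
  · have : (n : GaussianInt) = (n.natAbs : GaussianInt) := by
      conv_lhs => rw [h]
      simp
    rw [this]
  · have : (n : GaussianInt) = -(n.natAbs : GaussianInt) := by
      conv_lhs => rw [h]
      simp
    rw [this]
    exact (Associated.refl _).neg_left

theorem isCoprime_congr_right {a b b' : GaussianInt} (h : Associated b b') :
    IsCoprime a b ↔ IsCoprime a b' := by
  obtain ⟨u, rfl⟩ := h
  exact (isCoprime_mul_unit_right_right u.isUnit a b).symm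

/-- A rational integer is a quartic residue for every coprime odd rational integer. -/
theorem quartic_intCast_intCast {m n : ℤ} (hn : Odd n)
    (h : IsCoprime (m : GaussianInt) (n : GaussianInt)) : quartic m n = 1 := by
  rw [quartic_of_associated (associated_natAbs n)]
  rw [isCoprime_congr_right (associated_natAbs n)] at h
  revert h
  refine odd_nat_induction (P := fun n => IsCoprime (m : GaussianInt) (n : GaussianInt) →
    quartic m n = 1) ?_ ?_ _ (Int.natAbs_odd.2 hn)
  · intro _; rw [quartic_of_isUnit (by simp)]
  · intro q n hq ho hon ih h
    have : Fact q.Prime := ⟨hq⟩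
    rw [Nat.cast_mul] at h ⊢
    rw [quartic_mul_right (natCast_gaussian_ne_zero ho) (natCast_gaussian_ne_zero hon),
      quartic_intCast_natPrime ho h.of_mul_right_left, ih h.of_mul_right_right, one_mul]

theorem isCoprime_of_isUnit_left {u a : GaussianInt} (h : IsUnit u) : IsCoprime u a :=
  (isUnit_iff_exists_inv'.1 h).elim fun v hv => ⟨v, 0, by rw [hv]; ring⟩

theorem isUnit_gaussI : IsUnit gaussI := isUnit_of_fourth_root gaussI_pow_four

theorem quarticPrime_gaussI {l : GaussianInt} (hl : Prime l) (ho : Odd l.norm) :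
    quarticPrime l gaussI = gaussIPow ((l.norm - 1) / 4) := by
  have h4 := odd_norm_mod_four ho
  have h0 := GaussianInt.norm_nonneg l
  have e : (l.norm - 1) / 4 = ((l.norm.natAbs - 1) / 4 : ℕ) := by omega
  apply quarticPrime_eq hl ho (not_dvd_of_isCoprime hl (isCoprime_of_isUnit_left isUnit_gaussI))
    (gaussIPow_pow_four _)
  rw [e, gaussIPow_natCast, sub_self]
  exact dvd_zero _

theorem odd_norm_emod_four {a : GaussianInt} (ho : Odd a.norm) : a.norm % 4 = 1 := by
  have h4 := odd_norm_mod_four ho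
  have h0 := GaussianInt.norm_nonneg a
  omega

/-- On integers congruent to 1 modulo 4 the map N ↦ (N-1)/4 turns products into sums modulo 4, so
the prime case propagates. -/
theorem quartic_gaussI {a : GaussianInt} (ha : Odd a.norm) :
    quartic gaussI a = gaussIPow ((a.norm - 1) / 4) := by
  refine odd_norm_induction (P := fun a => quartic gaussI a = gaussIPow ((a.norm - 1) / 4))
    ?_ ?_ a ha
  · intro u hu
    have : Associated u 1 := associated_one_iff_isUnit.2 hu
    rw [quartic_of_isUnit hu, norm_eq_of_associated this]
    simp [gaussIPow_zero]
  · intro l a hl ho ha ih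
    rw [quartic_mul_right hl.ne_zero (ne_zero_of_odd_norm ha), ih, quartic_prime hl,
      quarticPrime_gaussI hl ho, ← gaussIPow_add, Zsqrtd.norm_mul]
    have h1 := odd_norm_emod_four ho
    have h2 := odd_norm_emod_four ha
    obtain ⟨j, hj⟩ : ∃ j, l.norm = 4 * j + 1 := ⟨l.norm / 4, by omega⟩
    obtain ⟨k, hk⟩ : ∃ k, a.norm = 4 * k + 1 := ⟨a.norm / 4, by omega⟩
    rw [hj, hk]
    apply gaussIPow_congr
    have e : (4 * j + 1) * (4 * k + 1) - 1 = 4 * (4 * (j * k) + j + k) := by ring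
    rw [e, Int.modEq_iff_dvd]
    exact ⟨j * k, by omega⟩

theorem quartic_neg_one {a : GaussianInt} (ha : Odd a.norm) :
    quartic (-1) a = gaussIPow ((a.norm - 1) / 2) := by
  rw [← gaussI_sq, quartic_pow_left ha (isCoprime_of_isUnit_left isUnit_gaussI),
    quartic_gaussI ha, gaussIPow_pow]
  have h1 := odd_norm_emod_four ha
  congr 1
  push_cast
  omega

theorem isCoprime_two_of_odd_norm {a : GaussianInt} (h : Odd a.norm) :
    IsCoprime (2 : GaussianInt) a := by
  obtain ⟨k, hk⟩ := h
  refine ⟨-(k : GaussianInt), star a, ?_⟩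
  have := gaussian_norm_cast a
  rw [hk] at this
  push_cast at this
  linear_combination -this

theorem isCoprime_one_add_gaussI {a : GaussianInt} (h : Odd a.norm) :
    IsCoprime (1 + gaussI) a := by
  apply (isCoprime_two_of_odd_norm h).of_isCoprime_of_dvd_left
  exact ⟨1 - gaussI, by linear_combination gaussI_sq⟩

/-- For split q write 1 + i = i·(1 - i): the parts from 1 - i cancel as z·z³ and only the symbol of
i survives. For inert q, (1+i)^q ≡ 1 - i gives (1+i)^(q-1) ≡ i⁻¹, which is then raised to the power
(q+1)/4. -/
theorem quartic_one_add_gaussI_natPrime {q : ℕ} [hq : Fact q.Prime] (ho : Odd q) {n : ℤ}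
    (hn : n = q ∨ n = -q) (h1 : n % 4 = 1) :
    quartic (1 + gaussI) q = gaussIPow ((n - 1) / 4) := by
  have hc := isCoprime_one_add_gaussI (odd_norm_natCast ho)
  have : q % 4 = 1 ∨ q % 4 = 3 := by have := Nat.odd_iff.1 ho; omega
  rcases this with h4 | h4
  · obtain ⟨l, hl, hnl, hql⟩ := exists_gaussian_norm_eq h4
    have hol : Odd l.norm := by rw [hnl]; exact_mod_cast ho
    obtain ⟨e1, h2, h3⟩ := quartic_natPrime_one_mod_four hl hnl ho hql hc
    have e2 : 1 + gaussI = gaussI * star (1 + gaussI) := by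
      rw [star_add, star_one, star_gaussI]; linear_combination gaussI_sq
    have e3 := quarticPrime_mul hl hol (b := gaussI) (c := star (1 + gaussI))
      (not_dvd_of_isCoprime hl (isCoprime_of_isUnit_left isUnit_gaussI)) h3
    rw [← e2] at e3
    rw [e1, e3, mul_assoc, ← pow_succ', (quarticPrime_spec hl hol h3).1, mul_one,
      quarticPrime_gaussI hl hol, hnl]
    congr 1
    omega
  · apply quartic_natPrime_three_mod_four h4 hc (gaussIPow_pow_four _)
    have hp := prime_three_mod_four h4
    have h5 := dvd_pow_sub_star h4 (1 + gaussI)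
    have e2 : star (1 + gaussI) = (1 + gaussI) * gaussIPow (-1) := by
      rw [← mul_right_inj' (gaussIPow_ne_zero 1), gaussIPow_one, star_add, star_one, star_gaussI]
      have := gaussIPow_neg_mul 1
      rw [gaussIPow_one] at this
      linear_combination -gaussI_sq - (1 + gaussI) * this
    have h6 : (1 + gaussI) ^ q - star (1 + gaussI) =
        (1 + gaussI) * ((1 + gaussI) ^ (q - 1) - gaussIPow (-1)) := by
      rw [e2, mul_sub, ← pow_succ']
      congr 3
      omega
    rw [h6] at h5
    have h7 := (hp.dvd_or_dvd h5).resolve_left (not_dvd_of_isCoprime hp hc)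
    have h8 := h7.trans (sub_dvd_pow_sub_pow _ _ ((q + 1) / 4))
    rw [gaussIPow_pow] at h8
    convert h8 using 3
    push_cast
    omega

theorem odd_nat_sign {n : ℕ} (h : Odd n) : ∃ s : ℤ, (s = 1 ∨ s = -1) ∧ (s * n) % 4 = 1 := by
  have := Nat.odd_iff.1 h
  rcases (by omega : n % 4 = 1 ∨ n % 4 = 3) with h | h
  · exact ⟨1, Or.inl rfl, by omega⟩
  · exact ⟨-1, Or.inr rfl, by omega⟩

/-- The supplementary law for `1 + i` modulo rational integers. -/
theorem quartic_one_add_gaussI {n : ℤ} (h : n % 4 = 1) :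
    quartic (1 + gaussI) n = gaussIPow ((n - 1) / 4) := by
  have key : ∀ n : ℕ, Odd n → ∀ m : ℤ, m = n ∨ m = -n → m % 4 = 1 →
      quartic (1 + gaussI) n = gaussIPow ((m - 1) / 4) := by
    refine odd_nat_induction ?_ ?_
    · intro m hm h
      rw [quartic_of_isUnit (by simp), show m = 1 by omega]
      simp [gaussIPow_zero]
    · intro q n hq ho hon ih m hm h
      have : Fact q.Prime := ⟨hq⟩
      obtain ⟨s, hs, hs4⟩ := odd_nat_sign ho
      obtain ⟨t, ht, ht4⟩ := odd_nat_sign hon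
      have e1 := quartic_one_add_gaussI_natPrime ho (n := s * q)
        (by rcases hs with rfl | rfl <;> simp) hs4
      have e2 := ih (t * n) (by rcases ht with rfl | rfl <;> simp) ht4
      obtain ⟨j, hj⟩ : ∃ j, s * q = 4 * j + 1 := ⟨s * q / 4, by omega⟩
      obtain ⟨k, hk⟩ : ∃ k, t * n = 4 * k + 1 := ⟨t * n / 4, by omega⟩
      have hst : m = (s * q) * (t * n) := by
        have h4 : ((s * q) * (t * n)) % 4 = 1 := by rw [Int.mul_emod, hs4, ht4]; norm_num
        have h5 : (s * q) * (t * n) = q * n ∨ (s * q) * (t * n) = -(q * n) := by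
          rcases hs with rfl | rfl <;> rcases ht with rfl | rfl <;> simp
        push_cast at hm
        omega
      rw [Nat.cast_mul, quartic_mul_right (natCast_gaussian_ne_zero ho)
        (natCast_gaussian_ne_zero hon), e1, e2, ← gaussIPow_add, hst, hj, hk]
      apply gaussIPow_congr
      have e : (4 * j + 1) * (4 * k + 1) - 1 = 4 * (4 * (j * k) + j + k) := by ring
      rw [e, Int.modEq_iff_dvd]
      exact ⟨j * k, by omega⟩
  rw [quartic_of_associated (associated_natAbs n)]
  exact key _ (Int.natAbs_odd.2 (Int.odd_iff.2 (by omega))) n (by omega) h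

theorem quartic_one_sub_gaussI {n : ℤ} (h : n % 4 = 1) :
    quartic (1 - gaussI) n = gaussIPow (-((n - 1) / 4)) := by
  have ho : Odd n := Int.odd_iff.2 (by omega)
  have := quartic_star (odd_norm_intCast ho) (isCoprime_one_add_gaussI (odd_norm_intCast ho))
  rw [star_intCast_gaussian, star_add, star_one, star_gaussI, ← sub_eq_add_neg,
    quartic_one_add_gaussI h, star_gaussIPow] at this
  exact this

/-! ### The quartic character of 𝔽_p and its Jacobi sum. -/

theorem quarticPrime_of_dvd {l b : GaussianInt} (hl : Prime l) (ho : Odd l.norm) (hb : l ∣ b) :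
    quarticPrime l b = 0 := by
  rw [quarticPrime, dif_neg]
  rintro ⟨z, hz, hd⟩
  have hk : (l.norm.natAbs - 1) / 4 ≠ 0 := by
    have h4 := odd_norm_mod_four ho
    intro h0
    have h1 : l.norm.natAbs = 1 := by omega
    exact hl.not_isUnit ((Zsqrtd.isUnit_iff_norm_isUnit l).2 (Int.isUnit_iff_natAbs_eq.2 h1))
  have h2 : l ∣ z := by
    have := dvd_sub (dvd_pow hb hk) hd
    rwa [sub_sub_cancel] at this
  exact hl.not_isUnit (isUnit_of_dvd_unit h2 (isUnit_of_fourth_root hz))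

theorem quarticPrime_mul' {l b c : GaussianInt} (hl : Prime l) (ho : Odd l.norm) :
    quarticPrime l (b * c) = quarticPrime l b * quarticPrime l c := by
  by_cases hb : l ∣ b
  · rw [quarticPrime_of_dvd hl ho hb, quarticPrime_of_dvd hl ho (hb.mul_right c), zero_mul]
  by_cases hc : l ∣ c
  · rw [quarticPrime_of_dvd hl ho hc, quarticPrime_of_dvd hl ho (hc.mul_left b), mul_zero]
  exact quarticPrime_mul hl ho hb hc

theorem dvd_pow_sub_quarticPrime {l : GaussianInt} (b : GaussianInt) (hl : Prime l)
    (ho : Odd l.norm) : l ∣ b ^ ((l.norm.natAbs - 1) / 4) - quarticPrime l b := by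
  by_cases hb : l ∣ b
  · rw [quarticPrime_of_dvd hl ho hb, sub_zero]
    refine dvd_pow hb ?_
    have h4 := odd_norm_mod_four ho
    intro h0
    have h1 : l.norm.natAbs = 1 := by omega
    exact hl.not_isUnit ((Zsqrtd.isUnit_iff_norm_isUnit l).2 (Int.isUnit_iff_natAbs_eq.2 h1))
  · exact (quarticPrime_spec hl ho hb).2

theorem dvd_intCast_iff {l : GaussianInt} {p : ℕ} (hp : p.Prime) (hn : l.norm = p) (m : ℤ) :
    l ∣ (m : GaussianInt) ↔ (p : ℤ) ∣ m := by
  constructor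
  · rintro ⟨k, hk⟩
    have h1 := congrArg Zsqrtd.norm hk
    rw [norm_intCast_gaussian, Zsqrtd.norm_mul, hn] at h1
    exact (Nat.prime_iff_prime_int.1 hp).dvd_of_dvd_pow ⟨_, h1⟩
  · rintro ⟨k, rfl⟩
    refine ⟨star l * k, ?_⟩
    rw [← mul_assoc, ← gaussian_norm_cast, hn]; push_cast; rfl

theorem dvd_natCast_sub_iff {l : GaussianInt} {p : ℕ} [hp : Fact p.Prime] (hn : l.norm = p)
    (m n : ℤ) : l ∣ (m : GaussianInt) - n ↔ (m : ZMod p) = n := by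
  rw [← Int.cast_sub, dvd_intCast_iff hp.out hn, ← ZMod.intCast_zmod_eq_zero_iff_dvd, Int.cast_sub,
    sub_eq_zero]

theorem norm_prime_odd {l : GaussianInt} {p : ℕ} (ho : Odd l.norm) (hn : l.norm = p) : p % 4 = 1 := by
  have h4 := odd_norm_mod_four ho
  have : l.norm.natAbs = p := by rw [hn]; simp
  omega

section char
variable {l : GaussianInt} {p : ℕ} [hp : Fact p.Prime]

/-- The quartic residue character modulo a Gaussian prime of norm `p`, on `ZMod p`. -/
noncomputable def quarticChar (hl : Prime l) (ho : Odd l.norm) (hn : l.norm = p) :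
    MulChar (ZMod p) GaussianInt where
  toFun t := quarticPrime l ((t.val : ℤ) : GaussianInt)
  map_one' := by
    have h : l ∣ (((1 : ZMod p).val : ℤ) : GaussianInt) - ((1 : ℤ) : GaussianInt) := by
      rw [dvd_natCast_sub_iff (p := p) hn]; simp
    rw [quarticPrime_congr h]
    have h1 : quarticPrime l 1 = 1 := by
      rw [← quartic_prime hl, quartic_one_left ho]
    simpa using h1
  map_mul' a b := by
    rw [← quarticPrime_mul' hl ho]
    apply quarticPrime_congr
    rw [← Int.cast_mul, dvd_natCast_sub_iff (p := p) hn]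
    simp
  map_nonunit' a ha := by
    have : a = 0 := by rwa [isUnit_iff_ne_zero, not_not] at ha
    subst this
    simp [quarticPrime_of_dvd hl ho]

theorem quarticChar_apply (hl : Prime l) (ho : Odd l.norm) (hn : l.norm = p) (t : ZMod p) :
    quarticChar hl ho hn t = quarticPrime l ((t.val : ℤ) : GaussianInt) := rfl

theorem quarticChar_intCast (hl : Prime l) (ho : Odd l.norm) (hn : l.norm = p) (m : ℤ) :
    quarticChar hl ho hn m = quarticPrime l m := by
  rw [quarticChar_apply]
  apply quarticPrime_congr
  rw [dvd_natCast_sub_iff (p := p) hn]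
  simp

/-- Squaring doubles the exponent (p-1)/4, and Euler's criterion applies. -/
theorem quarticPrime_sq_intCast (hl : Prime l) (ho : Odd l.norm) (hn : l.norm = p) (m : ℤ) :
    quarticPrime l m ^ 2 = (legendreSym p m : GaussianInt) := by
  have h4 := odd_norm_mod_four ho
  have hk : (l.norm.natAbs - 1) / 4 * 2 = p / 2 := by
    have : l.norm.natAbs = p := by rw [hn]; simp
    omega
  by_cases hm : (p : ℤ) ∣ m
  · rw [quarticPrime_of_dvd hl ho ((dvd_intCast_iff hp.out hn m).2 hm)]
    have : legendreSym p m = 0 := by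
      rwa [legendreSym.eq_zero_iff, ZMod.intCast_zmod_eq_zero_iff_dvd]
    rw [this]; simp
  have hm' : ¬ l ∣ (m : GaussianInt) := by rwa [dvd_intCast_iff hp.out hn]
  have hm0 : (m : ZMod p) ≠ 0 := by rwa [Ne, ZMod.intCast_zmod_eq_zero_iff_dvd]
  obtain ⟨h1, h2⟩ := quarticPrime_spec hl ho hm'
  apply eq_of_dvd_sub_fourth_root hl ho
  · rw [← pow_mul, mul_comm, pow_mul, h1, one_pow]
  · rcases legendreSym.eq_one_or_neg_one p hm0 with h | h <;> rw [h] <;> norm_num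
  · have h3 := h2.trans (sub_dvd_pow_sub_pow _ _ 2)
    rw [← pow_mul, hk] at h3
    have h5 : l ∣ ((m ^ (p / 2) : ℤ) : GaussianInt) - (legendreSym p m : ℤ) := by
      rw [dvd_natCast_sub_iff (p := p) hn, legendreSym.eq_pow]
      simp
    have := dvd_sub h5 h3
    push_cast at this
    rwa [sub_sub_sub_cancel_left] at this

theorem quarticChar_sq_apply (hl : Prime l) (ho : Odd l.norm) (hn : l.norm = p) (m : ℤ) :
    (quarticChar hl ho hn ^ 2) m = (legendreSym p m : GaussianInt) := by
  rw [MulChar.pow_apply' _ two_ne_zero, quarticChar_intCast, quarticPrime_sq_intCast hl ho hn]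

theorem zmod_exists_int (t : ZMod p) : ∃ m : ℤ, (m : ZMod p) = t := ⟨(t.val : ℤ), by simp⟩

theorem quarticChar_sq_isQuadratic (hl : Prime l) (ho : Odd l.norm) (hn : l.norm = p) :
    (quarticChar hl ho hn ^ 2).IsQuadratic := by
  intro t
  obtain ⟨m, rfl⟩ := zmod_exists_int t
  rw [quarticChar_sq_apply]
  by_cases hm0 : (m : ZMod p) = 0
  · left; rw [(legendreSym.eq_zero_iff p m).2 hm0]; simp
  · rcases legendreSym.eq_one_or_neg_one p hm0 with h | h <;> rw [h] <;> simp

theorem quarticChar_pow_four (hl : Prime l) (ho : Odd l.norm) (hn : l.norm = p) :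
    quarticChar hl ho hn ^ 4 = 1 := by
  rw [show (4 : ℕ) = 2 * 2 from rfl, pow_mul, (quarticChar_sq_isQuadratic hl ho hn).sq_eq_one]

theorem exists_quarticChar_sq_eq_neg_one (hl : Prime l) (ho : Odd l.norm) (hn : l.norm = p) :
    ∃ t : ZMod p, (quarticChar hl ho hn ^ 2) t = -1 := by
  have hp2 : ringChar (ZMod p) ≠ 2 := by
    rw [ZMod.ringChar_zmod_n]
    have := norm_prime_odd ho hn
    omega
  obtain ⟨t, ht⟩ := quadraticChar_exists_neg_one hp2
  obtain ⟨m, rfl⟩ := zmod_exists_int t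
  refine ⟨m, ?_⟩
  rw [quarticChar_sq_apply, legendreSym, ht]; simp

/-- Modulo l the character is t ↦ t^k with k = (p-1)/4, so the Jacobi sum becomes Σ t^k(1-t)^k. This
polynomial has degree at most 2k < p-1, hence its sum over 𝔽_p vanishes. -/
theorem dvd_jacobiSum_quarticChar (hl : Prime l) (ho : Odd l.norm) (hn : l.norm = p) :
    l ∣ jacobiSum (quarticChar hl ho hn) (quarticChar hl ho hn) := by
  set k := (l.norm.natAbs - 1) / 4 with hk
  have h1 : l ∣ ((∑ t : ZMod p, (t.val : ℤ) ^ k * ((1 - t).val : ℤ) ^ k : ℤ) : GaussianInt) := by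
    rw [dvd_intCast_iff hp.out hn, ← ZMod.intCast_zmod_eq_zero_iff_dvd]
    push_cast
    simp only [ZMod.natCast_val, ZMod.cast_id', id_eq]
    open Polynomial in
    have h2 : ∀ t : ZMod p, t ^ k * (1 - t) ^ k =
        ∑ i ∈ Finset.range (2 * k + 1), ((X ^ k * (1 - X) ^ k : (ZMod p)[X]).coeff i) * t ^ i := by
      intro t
      have hd : (X ^ k * (1 - X) ^ k : (ZMod p)[X]).natDegree < 2 * k + 1 := by
        have h1 : (1 - X : (ZMod p)[X]).natDegree ≤ 1 := by
          refine (natDegree_sub_le _ _).trans ?_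
          simp
        have h3 := natDegree_pow_le_of_le k h1
        have h4 : (X ^ k : (ZMod p)[X]).natDegree ≤ k := natDegree_X_pow_le k
        have := natDegree_mul_le_of_le h4 h3
        omega
      have := eval_eq_sum_range' hd t
      rw [← this]; simp
    rw [Finset.sum_congr rfl (fun t _ => h2 t), Finset.sum_comm]
    apply Finset.sum_eq_zero
    intro i hi
    rw [← Finset.mul_sum, FiniteField.sum_pow_lt_card_sub_one, mul_zero]
    rw [Finset.mem_range] at hi
    rw [ZMod.card]
    have := hp.out.two_le
    omega
  have h2 : l ∣ ∑ t : ZMod p, ((((t.val : ℤ) : GaussianInt)) ^ k * (((1 - t).val : ℤ) : GaussianInt) ^ k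
      - quarticChar hl ho hn t * quarticChar hl ho hn (1 - t)) := by
    apply Finset.dvd_sum
    intro t _
    obtain ⟨a, ha⟩ := dvd_pow_sub_quarticPrime ((t.val : ℤ) : GaussianInt) hl ho
    obtain ⟨b, hb⟩ := dvd_pow_sub_quarticPrime (((1 - t).val : ℤ) : GaussianInt) hl ho
    rw [quarticChar_apply, quarticChar_apply]
    exact ⟨a * (((1 - t).val : ℤ) : GaussianInt) ^ k + quarticPrime l ((t.val : ℤ) : GaussianInt) * b,
      by linear_combination ha * (((1 - t).val : ℤ) : GaussianInt) ^ k
          + quarticPrime l ((t.val : ℤ) : GaussianInt) * hb⟩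
  rw [Finset.sum_sub_distrib] at h2
  have := dvd_sub h1 h2
  push_cast at this
  simpa [jacobiSum] using this

theorem quarticChar_ne_one (hl : Prime l) (ho : Odd l.norm) (hn : l.norm = p) :
    quarticChar hl ho hn ^ 2 ≠ 1 := by
  intro h
  obtain ⟨t, ht⟩ := exists_quarticChar_sq_eq_neg_one hl ho hn
  by_cases h0 : IsUnit t
  · rw [h, MulChar.one_apply h0] at ht
    exact absurd ht (by decide)
  · rw [MulChar.map_nonunit _ h0] at ht
    exact absurd ht (by decide)

theorem jacobiSum_quarticChar_inv (hl : Prime l) (ho : Odd l.norm) (hn : l.norm = p) :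
    jacobiSum (quarticChar hl ho hn)⁻¹ (quarticChar hl ho hn)⁻¹ =
      star (jacobiSum (quarticChar hl ho hn) (quarticChar hl ho hn)) := by
  have h : (quarticChar hl ho hn)⁻¹ = (quarticChar hl ho hn).ringHomComp (starRingEnd GaussianInt) := by
    refine MulChar.ext fun t => ?_
    have h3 : (quarticChar hl ho hn)⁻¹ = quarticChar hl ho hn ^ 3 := by
      rw [inv_eq_iff_mul_eq_one, ← pow_succ', quarticChar_pow_four]
    rw [h3, MulChar.pow_apply_coe, MulChar.ringHomComp_apply]
    refine (star_mul_fourth_root ?_).symm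
    rw [← MulChar.pow_apply_coe, quarticChar_pow_four, MulChar.one_apply_coe]
  rw [h, jacobiSum_ringHomComp]; rfl

/-- The product formula for Jacobi sums of inverse characters is applied over ℂ and pulled back
along the injection ℤ[i] → ℂ; inverse characters are conjugate ones here. -/
theorem jacobiSum_quarticChar_mul_star (hl : Prime l) (ho : Odd l.norm) (hn : l.norm = p) :
    jacobiSum (quarticChar hl ho hn) (quarticChar hl ho hn) *
      star (jacobiSum (quarticChar hl ho hn) (quarticChar hl ho hn)) = p := by
  have hinj := GaussianInt.toComplex_injective
  have h2 := quarticChar_ne_one hl ho hn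
  have h1 : quarticChar hl ho hn ≠ 1 := by
    intro h; rw [h, one_pow] at h2; exact h2 rfl
  have h := jacobiSum_mul_jacobiSum_inv (F := ZMod p) (F' := ℂ)
    (χ := (quarticChar hl ho hn).ringHomComp GaussianInt.toComplex)
    (φ := (quarticChar hl ho hn).ringHomComp GaussianInt.toComplex)
    (by rw [ZMod.ringChar_zmod_n, ringChar.eq_zero]; exact hp.out.ne_zero.symm)
    ((MulChar.ringHomComp_ne_one_iff hinj).2 h1) ((MulChar.ringHomComp_ne_one_iff hinj).2 h1)
    (by rw [← MulChar.ringHomComp_mul, ← pow_two]; exact (MulChar.ringHomComp_ne_one_iff hinj).2 h2)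
  rw [MulChar.ringHomComp_inv, jacobiSum_ringHomComp, jacobiSum_ringHomComp, ← map_mul,
    jacobiSum_quarticChar_inv, ZMod.card] at h
  apply hinj
  rw [h]; simp

/-- A Jacobi sum of characters of order dividing 4 is ≡ -1 modulo (i-1)² = -2i. -/
theorem jacobiSum_quarticChar_primary (hl : Prime l) (ho : Odd l.norm) (hn : l.norm = p) :
    Odd (jacobiSum (quarticChar hl ho hn) (quarticChar hl ho hn)).re ∧
      Even (jacobiSum (quarticChar hl ho hn) (quarticChar hl ho hn)).im := by
  have hprim : IsPrimitiveRoot gaussI 4 := by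
    rw [IsPrimitiveRoot.iff (by norm_num)]
    refine ⟨gaussI_pow_four, fun k hk0 hk4 => ?_⟩
    interval_cases k <;> decide
  obtain ⟨z, -, hz⟩ := exists_jacobiSum_eq_neg_one_add (F := ZMod p) (n := 4) (by norm_num)
    (quarticChar_pow_four hl ho hn) (quarticChar_pow_four hl ho hn)
    (by rw [ZMod.card]; have := norm_prime_odd ho hn; omega) hprim
  have e : jacobiSum (quarticChar hl ho hn) (quarticChar hl ho hn) = -1 + 2 * (-(z * gaussI)) := by
    rw [hz]; linear_combination z * gaussI_sq
  rw [e]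
  constructor
  · exact ⟨-1 + (-(z * gaussI)).re, by simp; ring⟩
  · exact ⟨(-(z * gaussI)).im, by simp; ring⟩

end char

/-- The quotient is a unit, and ±i would swap the parities of the coordinates. This is what
identifies the Jacobi sum with ±l. -/
theorem eq_or_eq_neg_of_dvd {a b : GaussianInt} (h : a ∣ b) (hn : a.norm = b.norm)
    (hb : Odd b.re ∧ Even b.im) (ha : Odd a.re ∧ Even a.im) : b = a ∨ b = -a := by
  obtain ⟨u, rfl⟩ := h
  have ha0 : a.norm ≠ 0 := by
    intro h0
    rw [GaussianInt.norm_eq_zero] at h0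
    rw [h0] at ha; simp at ha
  have hu : u.norm = 1 := by
    rw [Zsqrtd.norm_mul] at hn
    exact (mul_eq_left₀ ha0).1 hn.symm
  have h1 := gaussian_norm_eq u
  rw [hu] at h1
  have hre : u.im = 0 := by
    by_contra h0
    have : 1 ≤ u.im ^ 2 := by have := sq_nonneg u.im; have := pow_ne_zero 2 h0; omega
    have h2 : u.re ^ 2 = 0 := by nlinarith [sq_nonneg u.re]
    have h3 : u.re = 0 := by simpa using h2
    have h4 : (a * u).re = -(a.im * u.im) := by simp [h3]
    rw [h4] at hb
    exact Int.not_even_iff_odd.2 hb.1 ((ha.2.mul_right _).neg)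
  have h2 : u.re = 1 ∨ u.re = -1 := by
    rw [hre] at h1
    have h5 : (u.re - 1) * (u.re + 1) = 0 := by linear_combination -h1
    rcases mul_eq_zero.1 h5 with h | h
    · left; linarith
    · right; linarith
  rcases h2 with h2 | h2
  · left
    have : u = 1 := by ext <;> simp [h2, hre]
    rw [this, mul_one]
  · right
    have : u = -1 := by ext <;> simp [h2, hre]
    rw [this, mul_neg, mul_one]

/-! ### Quartic Gauss sums in characteristic q. -/

theorem hom_eq_of_fourth_root {R : Type*} [Field R] (f : GaussianInt →+* R) (h2 : (2 : R) ≠ 0)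
    {z w : GaussianInt} (hz : z ^ 4 = 1) (hw : w ^ 4 = 1) (h : f z = f w) : z = w := by
  by_contra hne
  obtain ⟨m, hm⟩ := norm_sub_fourth_root_dvd hz hw hne
  have h1 : (4 : GaussianInt) = (z - w) * (star (z - w) * m) := by
    rw [← mul_assoc, ← gaussian_norm_cast, ← Int.cast_mul, ← hm]; norm_num
  have h3 := congrArg f h1
  rw [map_mul, map_sub, h, sub_self, zero_mul] at h3
  have h4 : (4 : R) = 0 := by rw [← h3, map_ofNat]
  have : (2 : R) * 2 = 0 := by rw [← h4]; norm_num
  exact h2 (by simpa using this)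

section gauss
variable {l : GaussianInt} {p q : ℕ} [hp : Fact p.Prime] [hq : Fact q.Prime]
  {R : Type*} [Field R] [CharP R q] (f : GaussianInt →+* R) (hl : Prime l) (ho : Odd l.norm)
  (hn : l.norm = p) {ψ : AddChar (ZMod p) R}

theorem quarticChar_sq_hom_ne_one (h2 : (2 : R) ≠ 0) :
    ((quarticChar hl ho hn).ringHomComp f) ^ 2 ≠ 1 := by
  intro h
  obtain ⟨t, ht⟩ := exists_quarticChar_sq_eq_neg_one hl ho hn
  rw [MulChar.ringHomComp_pow] at h
  have h1 : f ((quarticChar hl ho hn ^ 2) t) = -1 := by rw [ht, map_neg, map_one]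
  rw [← MulChar.ringHomComp_apply, h] at h1
  by_cases h0 : IsUnit t
  · rw [MulChar.one_apply h0] at h1
    apply h2
    linear_combination h1
  · rw [MulChar.map_nonunit _ h0] at h1
    exact one_ne_zero (neg_eq_zero.1 h1.symm)

theorem quarticChar_hom_ne_one (h2 : (2 : R) ≠ 0) :
    (quarticChar hl ho hn).ringHomComp f ≠ 1 := by
  intro h
  apply quarticChar_sq_hom_ne_one f hl ho hn h2
  rw [h, one_pow]

/-- The fourth power of the quartic Gauss sum. -/
theorem gaussSum_quarticChar_pow_four (h2 : (2 : R) ≠ 0) (hψ : ψ.IsPrimitive) :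
    gaussSum ((quarticChar hl ho hn).ringHomComp f) ψ ^ 4 =
      p * f (jacobiSum (quarticChar hl ho hn) (quarticChar hl ho hn)) ^ 2 := by
  set χ := (quarticChar hl ho hn).ringHomComp f with hχ
  have hsq := quarticChar_sq_hom_ne_one f hl ho hn h2
  -- g(χ)² = g(χ²)·J(χ,χ), and g(χ²)² = p because χ² is quadratic with χ²(-1) = 1.
  have h3 := jacobiSum_mul_nontrivial (χ := χ) (φ := χ) (by rwa [← pow_two]) ψ
  rw [hχ, jacobiSum_ringHomComp, ← hχ, ← pow_two, ← pow_two] at h3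
  have hquad : (χ ^ 2).IsQuadratic := by
    rw [hχ, MulChar.ringHomComp_pow]
    exact (quarticChar_sq_isQuadratic hl ho hn).comp f
  have h4 := gaussSum_sq hsq hquad hψ
  have h5 : (χ ^ 2) (-1) = 1 := by
    rw [MulChar.pow_apply' _ two_ne_zero, ← map_pow, neg_one_sq, map_one]
  rw [h5, one_mul, ZMod.card] at h4
  rw [show (4 : ℕ) = 2 * 2 from rfl, pow_mul, ← h3, mul_pow, h4]

theorem gaussSum_quarticChar_ne_zero (h2 : (2 : R) ≠ 0) (hψ : ψ.IsPrimitive)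
    (hpR : (p : R) ≠ 0) : gaussSum ((quarticChar hl ho hn).ringHomComp f) ψ ≠ 0 := by
  apply gaussSum_ne_zero_of_nontrivial _ (quarticChar_hom_ne_one f hl ho hn h2) hψ
  rwa [ZMod.card]

end gauss

theorem exists_primitive_addChar (p q : ℕ) [hp : Fact p.Prime] [hq : Fact q.Prime] (h : p ≠ q) :
    ∃ ψ : AddChar (ZMod p) (AlgebraicClosure (ZMod q)), ψ.IsPrimitive := by
  have : NeZero ((p : ℕ) : ZMod q) := ⟨by
    rw [Ne, ZMod.natCast_eq_zero_iff, Nat.prime_dvd_prime_iff_eq hq.out hp.out]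
    exact h.symm⟩
  obtain ⟨ζ, hζ⟩ := HasEnoughRootsOfUnity.exists_primitiveRoot (AlgebraicClosure (ZMod q)) p
  exact ⟨_, AddChar.zmodChar_primitive_of_primitive_root p hζ⟩

theorem exists_gaussian_hom (R : Type*) [Field R] [IsAlgClosed R] :
    Nonempty (GaussianInt →+* R) := by
  obtain ⟨r, hr⟩ := IsAlgClosed.exists_pow_nat_eq (-1 : R) (n := 2) (by norm_num)
  exact ⟨Zsqrtd.lift ⟨r, by rw [← pow_two, hr]; simp⟩⟩

section recip
variable {l : GaussianInt} {p q : ℕ} [hp : Fact p.Prime] [hq : Fact q.Prime]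
  (hl : Prime l) (ho : Odd l.norm) (hn : l.norm = p)

theorem natCast_ne_zero_of_primes {R : Type*} [Field R] [CharP R q] {r : ℕ} (hr : r.Prime)
    (h : r ≠ q) : (r : R) ≠ 0 := by
  rw [Ne, CharP.cast_eq_zero_iff R q, Nat.prime_dvd_prime_iff_eq hq.out hr]
  exact h.symm

theorem isCoprime_of_mul_star_eq {J : GaussianInt} (hJ : J * star J = p) (h : p ≠ q) :
    IsCoprime J q := by
  have h1 : IsCoprime ((p : ℕ) : GaussianInt) (q : GaussianInt) := by
    have h2 : IsCoprime (p : ℤ) q := Nat.isCoprime_iff_coprime.2 ((Nat.coprime_primes hp.out hq.out).2 h)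
    have := h2.map (Int.castRingHom GaussianInt)
    simpa using this
  rw [← hJ] at h1
  exact h1.of_mul_left_left

theorem quarticChar_apply_pow_four {t : ZMod p} (ht : t ≠ 0) :
    quarticChar hl ho hn t ^ 4 = 1 := by
  rw [← MulChar.pow_apply' _ (by norm_num), quarticChar_pow_four,
    MulChar.one_apply (isUnit_iff_ne_zero.2 ht)]

theorem zmod_prime_ne_zero (h : p ≠ q) : (q : ZMod p) ≠ 0 := by
  rw [Ne, ZMod.natCast_eq_zero_iff, Nat.prime_dvd_prime_iff_eq hp.out hq.out]
  exact h

/-- Let q = 4k + 1. Frobenius gives χ(q)·g^q = g, that is χ(q)·(pJ²)^k = 1. The symbol of J modulo q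
maps to (J·J̄³)^k, and J·J̄³·pJ² = p⁴ with p^(4k) = 1, so both are inverse to (pJ²)^k. -/
theorem quartic_jacobiSum_one_mod_four (hpq : p ≠ q) (h4 : q % 4 = 1) :
    quartic (jacobiSum (quarticChar hl ho hn) (quarticChar hl ho hn)) q =
      quarticChar hl ho hn q := by
  set χ := quarticChar hl ho hn with hχ
  set J := jacobiSum χ χ with hJ
  have hJJ : J * star J = p := jacobiSum_quarticChar_mul_star hl ho hn
  let R := AlgebraicClosure (ZMod q)
  have : CharP R q := charP_of_injective_algebraMap (algebraMap (ZMod q) R).injective q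
  have h2 : (2 : R) ≠ 0 := by
    have := natCast_ne_zero_of_primes (R := R) (q := q) Nat.prime_two (by omega)
    exact_mod_cast this
  have hpR : (p : R) ≠ 0 := natCast_ne_zero_of_primes hp.out hpq
  obtain ⟨ψ, hψ⟩ := exists_primitive_addChar p q hpq
  obtain ⟨f⟩ := exists_gaussian_hom R
  -- Of the two primes above q, κ is one killed by f, so that f computes symbols modulo κ as powers.
  obtain ⟨κ, hκ, hκn, hκq, hfκ⟩ : ∃ κ : GaussianInt, Prime κ ∧ κ.norm = q ∧
      (q : GaussianInt) = κ * star κ ∧ f κ = 0 := by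
    obtain ⟨κ, hκ, hκn, hκq⟩ := exists_gaussian_norm_eq h4
    have h0 : f κ * f (star κ) = 0 := by
      rw [← map_mul, ← hκq, map_natCast, CharP.cast_eq_zero]
    rcases mul_eq_zero.1 h0 with h | h
    · exact ⟨κ, hκ, hκn, hκq, h⟩
    · exact ⟨star κ, prime_star hκ, by rw [Zsqrtd.norm_conj, hκn], by rw [star_star, mul_comm, hκq],
        h⟩
  have hoq : Odd q := Nat.odd_iff.2 (by omega)
  have hoκ : Odd κ.norm := by rw [hκn]; exact_mod_cast hoq
  obtain ⟨e1, hJ1, hJ2⟩ := quartic_natPrime_one_mod_four hκ hκn hoq hκq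
    (isCoprime_of_mul_star_eq hJJ hpq)
  have hval : ∀ b, f (quarticPrime κ b) = f b ^ ((q - 1) / 4) := by
    intro b
    obtain ⟨c, hc⟩ := dvd_pow_sub_quarticPrime b hκ hoκ
    have := congrArg f hc
    rw [map_mul, hfκ, zero_mul, map_sub, map_pow, sub_eq_zero, hκn] at this
    simpa using this.symm
  have hqp : (q : ZMod p) ≠ 0 := zmod_prime_ne_zero hpq
  apply hom_eq_of_fourth_root f h2
    (quartic_pow_four (odd_norm_natCast hoq) (isCoprime_of_mul_star_eq hJJ hpq))
    (quarticChar_apply_pow_four hl ho hn hqp)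
  set g := gaussSum (χ.ringHomComp f) ψ with hg
  have hg0 : g ≠ 0 := gaussSum_quarticChar_ne_zero f hl ho hn h2 hψ hpR
  have hg4 : g ^ 4 = p * f J ^ 2 := gaussSum_quarticChar_pow_four f hl ho hn h2 hψ
  have hfrob := gaussSum_frob q (χ.ringHomComp f) ψ
  have hχq : (χ.ringHomComp f) ^ q = χ.ringHomComp f := by
    rw [MulChar.ringHomComp_pow]
    congr 1
    rw [← Nat.div_add_mod q 4, h4, pow_add, pow_mul, quarticChar_pow_four]; simp
  have hshift := gaussSum_mulShift (χ.ringHomComp f) ψ (Units.mk0 _ hqp)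
  rw [Units.val_mk0, ← AddChar.pow_mulShift, MulChar.ringHomComp_apply] at hshift
  rw [hχq] at hfrob
  rw [← hfrob, ← hg] at hshift
  obtain ⟨k, hk⟩ : ∃ k, q = 4 * k + 1 := ⟨q / 4, by omega⟩
  have hk' : (q - 1) / 4 = k := by omega
  have h5 : f (χ q) * (p * f J ^ 2) ^ k = 1 := by
    rw [← hg4, ← pow_mul]
    apply mul_right_cancel₀ hg0
    rw [one_mul, mul_assoc, ← pow_succ, ← hk, hshift]
  have h6 : f J * f (star J) = p := by rw [← map_mul, hJJ, map_natCast]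
  have h7 : (p : R) ^ (4 * k) = 1 := by
    have := ZMod.pow_card_sub_one_eq_one (p := q) (a := (p : ZMod q))
      (zmod_prime_ne_zero (p := q) (q := p) hpq.symm)
    have h8 := congrArg (algebraMap (ZMod q) R) this
    rw [map_pow, map_natCast, map_one, show q - 1 = 4 * k by omega] at h8
    exact h8
  rw [e1, map_mul, map_pow, hval, hval, hk']
  have h8 : (f J ^ k * (f (star J) ^ k) ^ 3) * (p * f J ^ 2) ^ k = 1 := by
    rw [← h7, ← h6]; ring
  have h9 : (p * f J ^ 2 : R) ^ k ≠ 0 := by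
    intro h0; rw [h0, mul_zero] at h8; exact zero_ne_one h8
  exact mul_right_cancel₀ h9 (h8.trans h5.symm)

/-- Now χ^q = χ⁻¹, so Frobenius together with g(χ)g(χ⁻¹) = χ(-1)p yields g^(q+1) = χ(-q)·p. As
conjugation is J ↦ J^q in characteristic q, also p = J^(q+1); with g⁴ = pJ² everything is a power of
J. -/
theorem quartic_jacobiSum_three_mod_four (hpq : p ≠ q) (h4 : q % 4 = 3) :
    quartic (jacobiSum (quarticChar hl ho hn) (quarticChar hl ho hn)) q =
      quarticChar hl ho hn (-q) := by
  set χ := quarticChar hl ho hn with hχ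
  set J := jacobiSum χ χ with hJ
  have hJJ : J * star J = p := jacobiSum_quarticChar_mul_star hl ho hn
  let R := AlgebraicClosure (ZMod q)
  have : CharP R q := charP_of_injective_algebraMap (algebraMap (ZMod q) R).injective q
  have h2 : (2 : R) ≠ 0 := by
    have := natCast_ne_zero_of_primes (R := R) (q := q) Nat.prime_two (by omega)
    exact_mod_cast this
  have hpR : (p : R) ≠ 0 := natCast_ne_zero_of_primes hp.out hpq
  obtain ⟨ψ, hψ⟩ := exists_primitive_addChar p q hpq
  obtain ⟨f⟩ := exists_gaussian_hom R
  have hqp : (q : ZMod p) ≠ 0 := zmod_prime_ne_zero hpq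
  have hqprime := prime_three_mod_four h4
  have hqR : f q = 0 := by rw [map_natCast, CharP.cast_eq_zero]
  have hker : ∀ b, f b = 0 → (q : GaussianInt) ∣ b := by
    intro b hb
    by_contra hnd
    obtain ⟨s, t, hst⟩ := (hqprime.irreducible.coprime_iff_not_dvd).2 hnd
    have := congrArg f hst
    rw [map_add, map_mul, map_mul, hb, hqR] at this
    simp at this
  apply quartic_natPrime_three_mod_four h4 (isCoprime_of_mul_star_eq hJJ hpq)
    (quarticChar_apply_pow_four hl ho hn (neg_ne_zero.2 hqp))
  apply hker
  set g := gaussSum (χ.ringHomComp f) ψ with hg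
  have hg4 : g ^ 4 = p * f J ^ 2 := gaussSum_quarticChar_pow_four f hl ho hn h2 hψ
  have hfrob := gaussSum_frob q (χ.ringHomComp f) ψ
  have hχ4 : (χ.ringHomComp f) ^ 4 = 1 := by
    rw [MulChar.ringHomComp_pow, quarticChar_pow_four, MulChar.ringHomComp_one]
  have hχq : (χ.ringHomComp f) ^ q = (χ.ringHomComp f)⁻¹ := by
    rw [eq_inv_iff_mul_eq_one, ← pow_succ, ← Nat.div_add_mod (q + 1) 4,
      show (q + 1) % 4 = 0 by omega, add_zero, pow_mul, hχ4, one_pow]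
  have hshift := gaussSum_mulShift (χ.ringHomComp f)⁻¹ ψ (Units.mk0 _ hqp)
  rw [Units.val_mk0, ← AddChar.pow_mulShift, ← hχq, ← hfrob, ← hg, hχq] at hshift
  have hcard := gaussSum_mul_gaussSum_eq_card (quarticChar_hom_ne_one f hl ho hn h2) hψ
  have hinv := mul_gaussSum_inv_eq_gaussSum (χ.ringHomComp f)⁻¹ ψ
  rw [← hinv] at hshift
  rw [← hχ, ← hg, ZMod.card] at hcard
  have hcinv : ∀ t : ZMod p, t ≠ 0 → f (χ t) * (χ.ringHomComp f)⁻¹ t = 1 := by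
    intro t ht
    rw [← MulChar.ringHomComp_apply, ← MulChar.mul_apply, mul_inv_cancel,
      MulChar.one_apply (isUnit_iff_ne_zero.2 ht)]
  have hm1 : (χ.ringHomComp f)⁻¹ (-1) = f (χ (-1)) := by
    have h1 := hcinv (-1) (by simp)
    have h3 : f (χ (-1)) * f (χ (-1)) = 1 := by
      rw [← map_mul, ← map_mul]; simp
    have h0 : f (χ (-1)) ≠ 0 := left_ne_zero_of_mul_eq_one h1
    exact mul_left_cancel₀ h0 (h1.trans h3.symm)
  rw [hm1] at hshift
  have hgq : g ^ (q + 1) = f (χ (-q)) * p := by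
    have h1 := hcinv q hqp
    have h3 : χ (-(q : ZMod p)) = χ (-1) * χ q := by rw [← map_mul, neg_one_mul]
    rw [h3, map_mul, ← hcard, pow_succ]
    linear_combination (-g ^ q * g) * h1 + f (χ q) * g * hshift
  have hstar : f (star J) = f J ^ q := by
    obtain ⟨c, hc⟩ := dvd_pow_sub_star h4 J
    have := congrArg f hc
    rw [map_mul, hqR, zero_mul, map_sub, map_pow, sub_eq_zero] at this
    exact this.symm
  have h6 : f J ^ (q + 1) = p := by rw [pow_succ', ← hstar, ← map_mul, hJJ, map_natCast]
  obtain ⟨k, hk⟩ : ∃ k, q = 4 * k + 3 := ⟨q / 4, by omega⟩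
  have hk' : (q + 1) / 4 = k + 1 := by omega
  rw [show q + 1 = 4 * (k + 1) by omega, pow_mul, hg4, ← h6] at hgq
  rw [map_sub, map_pow, map_pow, hk', sub_eq_zero]
  have hJ0 : f J ^ (q + 1) ≠ 0 := by rw [h6]; exact hpR
  apply mul_right_cancel₀ hJ0
  rw [← hgq, ← pow_mul, ← pow_add, ← pow_add, ← pow_mul]
  congr 1
  rw [hk, show 4 * k + 3 - 1 = 4 * k + 2 by omega]
  ring

end recip

/-! ### Primary Gaussian integers and rational quartic reciprocity. -/

/-- A Gaussian integer with odd real part and even imaginary part. -/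
def IsPrimary (a : GaussianInt) : Prop := Odd a.re ∧ Even a.im

theorem IsPrimary.odd_norm {a : GaussianInt} (h : IsPrimary a) : Odd a.norm := by
  rw [gaussian_norm_eq]
  exact h.1.pow.add_even (h.2.pow_of_ne_zero two_ne_zero)

theorem isPrimary_intCast {n : ℤ} (h : Odd n) : IsPrimary n := by
  constructor
  · simpa using h
  · simp

theorem IsPrimary.of_mul_left {a b : GaussianInt} (ha : IsPrimary a) (hab : IsPrimary (a * b)) :
    IsPrimary b := by
  obtain ⟨h1, h2⟩ := ha
  obtain ⟨h3, h4⟩ := hab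
  rw [Zsqrtd.re_mul] at h3
  rw [Zsqrtd.im_mul] at h4
  have h5 : Even (-1 * a.im * b.im) := (h2.mul_left _).mul_right _
  have h6 : Even (a.im * b.re) := h2.mul_right _
  constructor
  · have := (Int.odd_add.1 h3).2 h5
    exact (Int.odd_mul.1 this).2
  · have := (Int.even_add.1 h4).2 h6
    rcases Int.even_mul.1 this with h | h
    · exact absurd h1 (Int.not_odd_iff_even.2 h)
    · exact h

theorem IsPrimary.eq_of_isUnit {a : GaussianInt} (ha : IsPrimary a) (hu : IsUnit a) :
    a = 1 ∨ a = -1 := by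
  have h1 : IsPrimary 1 := by
    have := isPrimary_intCast (n := 1) odd_one
    simpa using this
  apply eq_or_eq_neg_of_dvd (one_dvd a) _ ha h1
  rw [norm_eq_of_associated (associated_one_iff_isUnit.2 hu)]

theorem exists_unit_mul_isPrimary {a : GaussianInt} (h : Odd a.norm) :
    ∃ u : GaussianIntˣ, IsPrimary (u * a) := by
  rw [gaussian_norm_eq] at h
  rcases Int.even_or_odd a.im with hi | hi
  · refine ⟨1, ?_⟩
    rw [Units.val_one, one_mul]
    refine ⟨?_, hi⟩
    have := (Int.odd_add.1 h).2 (hi.pow_of_ne_zero two_ne_zero)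
    exact Int.Odd.of_mul_left (by rwa [pow_two] at this)
  · refine ⟨gaussIUnit, ?_⟩
    have hr : Even a.re := by
      rcases Int.even_or_odd a.re with h1 | h1
      · exact h1
      · exact absurd h (Int.not_odd_iff_even.2 (h1.pow.add_odd hi.pow))
    have e : ((gaussIUnit : GaussianIntˣ) : GaussianInt) = ⟨0, 1⟩ := rfl
    rw [e]
    constructor
    · simpa using hi
    · simpa using hr

/-- Every prime of odd norm has a primary associate; the unit left over is then itself primary,
hence ±1. -/
theorem primary_induction {P : GaussianInt → Prop} (h1 : P 1) (hneg : P (-1))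
    (hm : ∀ l a, Prime l → IsPrimary l → IsPrimary a → P a → P (l * a)) :
    ∀ a, IsPrimary a → P a := by
  have key : ∀ a : GaussianInt, Odd a.norm → ∀ e : GaussianIntˣ, IsPrimary (e * a) → P (e * a) := by
    refine odd_norm_induction ?_ ?_
    · intro u hu e he
      rcases he.eq_of_isUnit (e.isUnit.mul hu) with h | h <;> rw [h]
      · exact h1
      · exact hneg
    · intro l a hl ho ha ih e he
      obtain ⟨w, hw⟩ := exists_unit_mul_isPrimary ho
      have e1 : (e : GaussianInt) * (l * a) = (w * l) * ((e * w⁻¹ : GaussianIntˣ) * a) := by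
        have : (w : GaussianInt) * ((w⁻¹ : GaussianIntˣ) : GaussianInt) = 1 := w.mul_inv
        rw [Units.val_mul]
        linear_combination (-(e * l * a : GaussianInt)) * this
      rw [e1] at he ⊢
      have h2 := hw.of_mul_left he
      exact hm _ _ ((associated_unit_mul_left l _ w.isUnit).symm.prime hl) hw h2 (ih _ h2)
  intro a ha
  have := key a ha.odd_norm 1
  rw [Units.val_one, one_mul] at this
  exact this ha

theorem quartic_neg_left_intCast {b : GaussianInt} {n : ℤ} (hn : Odd n)
    (hb : IsCoprime b (n : GaussianInt)) : quartic (-b) n = quartic b n := by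
  rw [← neg_one_mul, quartic_mul_left (odd_norm_intCast hn)
    (isCoprime_of_isUnit_left isUnit_one.neg) hb]
  have h := quartic_intCast_intCast (m := -1) hn (by
    push_cast; exact isCoprime_of_isUnit_left isUnit_one.neg)
  push_cast at h
  rw [h, one_mul]

/-- The Jacobi sum is ±l, and -1 has symbol 1 modulo q, so the Gauss sum computation of J modulo q
is one of l modulo q. The cases q ≡ 1 and q ≡ 3 mod 4 are n = q and n = -q. -/
theorem quartic_reciprocity_prime_of_norm {l : GaussianInt} (hl : Prime l) (hpl : IsPrimary l)
    {p q : ℕ} [hp : Fact p.Prime] [hq : Fact q.Prime] (hn : l.norm = p) (hoq : Odd q) {n : ℤ}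
    (hnq : n = q ∨ n = -q) (h1 : n % 4 = 1) (hpq : p ≠ q) : quartic n l = quartic l q := by
  have ho := hpl.odd_norm
  have hJJ := jacobiSum_quarticChar_mul_star hl ho hn
  have hcJ : IsCoprime (jacobiSum (quarticChar hl ho hn) (quarticChar hl ho hn))
    ((q : ℤ) : GaussianInt) := by
    rw [Int.cast_natCast]; exact isCoprime_of_mul_star_eq hJJ hpq
  have hoq' : Odd (q : ℤ) := by exact_mod_cast hoq
  have e1 : quartic (jacobiSum (quarticChar hl ho hn) (quarticChar hl ho hn)) q = quartic l q := by
    have hnorm : l.norm = (jacobiSum (quarticChar hl ho hn) (quarticChar hl ho hn)).norm := by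
      rw [hn]
      rw [← gaussian_norm_cast] at hJJ
      have := congrArg Zsqrtd.re hJJ
      simpa using this.symm
    rcases eq_or_eq_neg_of_dvd (dvd_jacobiSum_quarticChar hl ho hn) hnorm
      (jacobiSum_quarticChar_primary hl ho hn) hpl with h | h
    · rw [h]
    · have := quartic_neg_left_intCast hoq' hcJ
      rw [Int.cast_natCast] at this
      rw [← this, h, neg_neg]
  rw [quartic_prime hl, ← quarticChar_intCast (p := p) hl ho hn, ← e1]
  rcases hnq with rfl | rfl
  · rw [quartic_jacobiSum_one_mod_four hl ho hn hpq (by omega)]; simp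
  · rw [quartic_jacobiSum_three_mod_four hl ho hn hpq (by omega)]; simp

theorem IsPrimary.prime_cases {l : GaussianInt} (hpl : IsPrimary l) (hl : Prime l) :
    (∃ p : ℕ, p.Prime ∧ l.norm = p) ∨ ∃ m : ℤ, Odd m ∧ l = m := by
  rcases odd_prime_classification hl hpl.odd_norm with ⟨p, hp, -, hn⟩ | ⟨p, hp, h4, ha⟩
  · exact Or.inl ⟨p, hp, hn⟩
  · right
    have hop : Odd (p : ℤ) := Int.odd_iff.2 (by omega)
    have hpp : IsPrimary (p : GaussianInt) := by
      have := isPrimary_intCast hop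
      simpa using this
    rcases eq_or_eq_neg_of_dvd ha.symm.dvd (norm_eq_of_associated ha).symm hpl hpp with h | h
    · exact ⟨p, hop, by rw [h]; simp⟩
    · exact ⟨-p, hop.neg, by rw [h]; simp⟩

theorem isCoprime_intCast_of_natAbs {a : GaussianInt} {n : ℤ} {q : ℕ} (hnq : n = q ∨ n = -q) :
    IsCoprime (n : GaussianInt) a ↔ IsCoprime (q : GaussianInt) a := by
  rcases hnq with rfl | rfl
  · simp
  · simp [IsCoprime.neg_left_iff]

/-- By multiplicativity in a. Gauss sums are needed only at primes of prime norm: the other primary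
primes are rational integers, for which both symbols are 1. -/
theorem quartic_reciprocity_prime {a : GaussianInt} (ha : IsPrimary a) {q : ℕ}
    [hq : Fact q.Prime] (hoq : Odd q) {n : ℤ}
    (hnq : n = q ∨ n = -q) (h1 : n % 4 = 1) (hc : IsCoprime (n : GaussianInt) a) :
    quartic n a = quartic a q := by
  have hoq' : Odd (q : ℤ) := by exact_mod_cast hoq
  revert hc
  refine primary_induction (P := fun a => IsCoprime (n : GaussianInt) a →
    quartic n a = quartic a q) ?_ ?_ ?_ a ha
  · intro _
    rw [quartic_of_isUnit isUnit_one, quartic_one_left (odd_norm_natCast hoq)]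
  · intro _
    have h := quartic_intCast_intCast (m := -1) hoq' (by
      push_cast; exact isCoprime_of_isUnit_left isUnit_one.neg)
    push_cast at h
    rw [quartic_of_isUnit isUnit_one.neg, h]
  · intro l a hl hpl hpa ih hc
    have hcl := hc.of_mul_right_left
    have hca := hc.of_mul_right_right
    have key : quartic n l = quartic l q := by
      rcases hpl.prime_cases hl with ⟨p, hp, hn⟩ | ⟨m, hm, rfl⟩
      · have : Fact p.Prime := ⟨hp⟩
        refine quartic_reciprocity_prime_of_norm hl hpl hn hoq hnq h1 ?_
        rintro rfl
        apply not_dvd_of_isCoprime hl hcl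
        rw [dvd_intCast_iff hp hn]
        rcases hnq with rfl | rfl <;> simp
      · rw [quartic_intCast_intCast hm hcl]
        have := quartic_intCast_intCast (m := m) hoq' (by
          rw [Int.cast_natCast]
          exact ((isCoprime_intCast_of_natAbs hnq).1 hcl).symm)
        rw [Int.cast_natCast] at this
        exact this.symm
    rw [quartic_mul_right hl.ne_zero (ne_zero_of_odd_norm hpa.odd_norm), key, ih hca,
      quartic_mul_left (odd_norm_natCast hoq) ((isCoprime_intCast_of_natAbs hnq).1 hcl).symm
        ((isCoprime_intCast_of_natAbs hnq).1 hca).symm]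

/-- Quartic reciprocity between a rational integer and a Gaussian integer. -/
theorem quartic_reciprocity {a : GaussianInt} (ha : IsPrimary a) {n : ℤ} (h : n % 4 = 1)
    (hc : IsCoprime (n : GaussianInt) a) : quartic n a = quartic a n := by
  have key : ∀ n : ℕ, Odd n → ∀ m : ℤ, m = n ∨ m = -n → m % 4 = 1 →
      IsCoprime (m : GaussianInt) a → quartic m a = quartic a n := by
    refine odd_nat_induction ?_ ?_
    · intro m hm h _
      rw [quartic_of_isUnit (a := ((1 : ℕ) : GaussianInt)) (by simp), show m = 1 by omega,
        Int.cast_one, quartic_one_left ha.odd_norm]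
    · intro q n hq ho hon ih m hm h hc
      have : Fact q.Prime := ⟨hq⟩
      obtain ⟨s, hs, hs4⟩ := odd_nat_sign ho
      obtain ⟨t, ht, ht4⟩ := odd_nat_sign hon
      have hst : m = (s * q) * (t * n) := by
        have h4 : ((s * q) * (t * n)) % 4 = 1 := by rw [Int.mul_emod, hs4, ht4]; norm_num
        have h5 : (s * q) * (t * n) = q * n ∨ (s * q) * (t * n) = -(q * n) := by
          rcases hs with rfl | rfl <;> rcases ht with rfl | rfl <;> simp
        push_cast at hm
        omega
      rw [hst, Int.cast_mul] at hc
      have hc1 := hc.of_mul_left_left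
      have hc2 := hc.of_mul_left_right
      have e1 := quartic_reciprocity_prime ha ho (n := s * q)
        (by rcases hs with rfl | rfl <;> simp) hs4 hc1
      have e2 := ih (t * n) (by rcases ht with rfl | rfl <;> simp) ht4 hc2
      rw [hst, Int.cast_mul, quartic_mul_left ha.odd_norm hc1 hc2, e1, e2, Nat.cast_mul,
        quartic_mul_right (natCast_gaussian_ne_zero ho) (natCast_gaussian_ne_zero hon)]
  rw [quartic_of_associated (associated_natAbs n) a]
  exact key _ (Int.natAbs_odd.2 (Int.odd_iff.2 (by omega))) n (by omega) h hc

/-! ### The supplementary law for 2, and the sign in reciprocity. -/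

theorem legendreSym_eq_jacobiSym_natAbs {p : ℕ} [hp : Fact p.Prime] (h1 : p % 4 = 1) {m : ℤ}
    (hm : Odd m) : legendreSym p m = jacobiSym p m.natAbs := by
  have hom := Int.natAbs_odd.2 hm
  have h2 : legendreSym p m = legendreSym p (m.natAbs : ℤ) := by
    rcases Int.natAbs_eq m with h | h
    · rw [← h]
    · have h3 : legendreSym p (-1) = 1 := by
        rw [legendreSym.at_neg_one (by omega), ZMod.χ₄_nat_one_mod_four h1]
      conv_lhs => rw [h, ← neg_one_mul, legendreSym.mul, h3, one_mul]
  rw [h2, jacobiSym.legendreSym.to_jacobiSym, ← jacobiSym.quadratic_reciprocity_one_mod_four h1 hom]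

/-- Dirichlet's argument: modulo l = c + di one has d ≡ ci, so (c+d)² ≡ 2cd ≡ 2c²i. Squares of
symbols of rational integers are Legendre symbols, and those of c and c + d are known. The exponent
is ((c+d)²-1)/4 - (c²+d²-1)/4 = cd/2. -/
theorem quarticPrime_two {l : GaussianInt} (hl : Prime l) (hpl : IsPrimary l) {p : ℕ}
    [hp : Fact p.Prime] (hn : l.norm = p) :
    quarticPrime l 2 = gaussIPow (l.re * l.im / 2) := by
  have ho := hpl.odd_norm
  have h1 : p % 4 = 1 := norm_prime_odd ho hn
  set c := l.re with hc
  set d := l.im with hd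
  have hcd : (p : ℤ) = c ^ 2 + d ^ 2 := by rw [← hn, gaussian_norm_eq]
  have hcop : IsCoprime c d := by
    rw [Int.isCoprime_iff_gcd_eq_one]
    by_contra hg
    obtain ⟨r, hr, hrg⟩ := Nat.exists_prime_and_dvd hg
    have hrc : (r : ℤ) ∣ c := (Int.natCast_dvd_natCast.2 hrg).trans (Int.gcd_dvd_left ..)
    have hrd : (r : ℤ) ∣ d := (Int.natCast_dvd_natCast.2 hrg).trans (Int.gcd_dvd_right ..)
    have h2 : (r : ℤ) ^ 2 ∣ p := by
      rw [hcd]; exact dvd_add (pow_dvd_pow_of_dvd hrc 2) (pow_dvd_pow_of_dvd hrd 2)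
    have h3 : r ^ 2 ∣ p := by exact_mod_cast h2
    have h4 : r ∣ p := (Dvd.intro _ (pow_two r).symm).trans h3
    rw [Nat.prime_dvd_prime_iff_eq hr hp.out] at h4
    subst h4
    have h5 := Nat.le_of_dvd hp.out.pos h3
    have := hr.two_le
    nlinarith
  have hoc : Odd c := hpl.1
  have hed : Even d := hpl.2
  have hos : Odd (c + d) := hoc.add_even hed
  -- By quadratic reciprocity, since p ≡ d² modulo c.
  have hl1 : legendreSym p c = 1 := by
    rw [legendreSym_eq_jacobiSym_natAbs h1 hoc, jacobiSym.mod_left, hcd]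
    have : (c ^ 2 + d ^ 2) % (c.natAbs : ℤ) = d ^ 2 % (c.natAbs : ℤ) := by
      apply Int.ModEq.symm
      rw [Int.modEq_iff_dvd, Int.natCast_natAbs, abs_dvd]
      exact ⟨c, by ring⟩
    rw [this, ← jacobiSym.mod_left]
    apply jacobiSym.sq_one'
    rw [Int.gcd_comm, Int.gcd, Int.natAbs_natCast]
    exact Int.isCoprime_iff_gcd_eq_one.1 hcop
  have hcopx : Int.gcd (c - d) (c + d).natAbs = 1 := by
    have h2 : IsCoprime (c - d) (c + d) := by
      have h3 : IsCoprime (2 * c) (c + d) := by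
        apply IsCoprime.mul_left
        · exact (Int.isCoprime_two_left (m := c + d)).2 hos
        · have : IsCoprime c (d + c * 1) := hcop.add_mul_left_right 1
          rwa [mul_one, add_comm] at this
      have h4 : c - d = 2 * c + (c + d) * (-1) := by ring
      rw [h4]
      exact h3.add_mul_left_left (-1)
    rw [Int.gcd, Int.natAbs_natCast]
    exact Int.isCoprime_iff_gcd_eq_one.1 h2
  -- From 2p = (c+d)² + (c-d)², 2p is a square modulo c + d.
  have hl2 : legendreSym p (c + d) = ZMod.χ₈ (c + d).natAbs := by
    rw [legendreSym_eq_jacobiSym_natAbs h1 hos]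
    have ho' := Int.natAbs_odd.2 hos
    have h2 : jacobiSym (2 * p) (c + d).natAbs = 1 := by
      rw [jacobiSym.mod_left]
      have : (2 * (p : ℤ)) % ((c + d).natAbs : ℤ) = (c - d) ^ 2 % ((c + d).natAbs : ℤ) := by
        apply Int.ModEq.symm
        rw [Int.modEq_iff_dvd, Int.natCast_natAbs, abs_dvd, hcd]
        exact ⟨c + d, by ring⟩
      rw [this, ← jacobiSym.mod_left]
      exact jacobiSym.sq_one' hcopx
    rw [jacobiSym.mul_left, jacobiSym.at_two ho'] at h2
    rcases Int.isUnit_iff.1 (IsUnit.of_mul_eq_one _ h2) with h | h <;> rw [h] at h2 ⊢ <;> linarith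
  have hsum : quarticPrime l ((c + d : ℤ) : GaussianInt) ^ 2 =
      quarticPrime l 2 * quarticPrime l c ^ 2 * quarticPrime l gaussI := by
    rw [pow_two, pow_two, ← quarticPrime_mul' hl ho, ← quarticPrime_mul' hl ho,
      ← quarticPrime_mul' hl ho, ← quarticPrime_mul' hl ho]
    apply quarticPrime_congr
    refine ⟨star l - 2 * c * gaussI, ?_⟩
    have e : (((c + d : ℤ) : GaussianInt)) = c + d := by push_cast; rfl
    rw [e, mul_sub, ← gaussian_norm_cast, gaussian_norm_eq]
    have el : l = c + d * gaussI := gaussian_eq l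
    nth_rw 3 [el]
    push_cast
    linear_combination 2 * (c : GaussianInt) * d * gaussI_sq
  rw [quarticPrime_sq_intCast (p := p) hl ho hn, quarticPrime_sq_intCast (p := p) hl ho hn, hl1, hl2,
    quarticPrime_gaussI hl ho, Int.cast_one, mul_one] at hsum
  have hchi : ((ZMod.χ₈ ((c + d).natAbs : ZMod 8) : ℤ) : GaussianInt) =
      gaussIPow (((c + d) ^ 2 - 1) / 4) := by
    have ho' := Int.odd_iff.1 hos
    have key : ∀ s : ℤ, s % 2 = 1 → ∃ k, s = 8 * k + 1 ∨ s = 8 * k + 3 ∨ s = 8 * k + 5 ∨ s = 8 * k + 7 :=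
      fun s hs => ⟨s / 8, by omega⟩
    rw [ZMod.χ₈_nat_eq_if_mod_eight]
    obtain ⟨k, hk⟩ := key _ ho'
    rcases hk with hk | hk | hk | hk
    · rw [if_neg (by omega), if_pos (by omega), hk,
        show (8 * k + 1) ^ 2 - 1 = 4 * (4 * (4 * k ^ 2 + k)) by ring]
      rw [Int.mul_ediv_cancel_left _ (by norm_num), Int.cast_one, ← gaussIPow_zero]
      exact gaussIPow_congr (Int.modEq_iff_dvd.2 ⟨_, sub_zero _⟩)
    · rw [if_neg (by omega), if_neg (by omega), hk,
        show (8 * k + 3) ^ 2 - 1 = 4 * (2 + 4 * (4 * k ^ 2 + 3 * k)) by ring]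
      rw [Int.mul_ediv_cancel_left _ (by norm_num), Int.cast_neg, Int.cast_one, ← gaussIPow_two]
      exact gaussIPow_congr (Int.modEq_iff_dvd.2 ⟨_, add_sub_cancel_left _ _⟩)
    · rw [if_neg (by omega), if_neg (by omega), hk,
        show (8 * k + 5) ^ 2 - 1 = 4 * (2 + 4 * (4 * k ^ 2 + 5 * k + 1)) by ring]
      rw [Int.mul_ediv_cancel_left _ (by norm_num), Int.cast_neg, Int.cast_one, ← gaussIPow_two]
      exact gaussIPow_congr (Int.modEq_iff_dvd.2 ⟨_, add_sub_cancel_left _ _⟩)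
    · rw [if_neg (by omega), if_pos (by omega), hk,
        show (8 * k + 7) ^ 2 - 1 = 4 * (4 * (4 * k ^ 2 + 7 * k + 3)) by ring]
      rw [Int.mul_ediv_cancel_left _ (by norm_num), Int.cast_one, ← gaussIPow_zero]
      exact gaussIPow_congr (Int.modEq_iff_dvd.2 ⟨_, sub_zero _⟩)
  rw [hchi] at hsum
  apply mul_right_cancel₀ (gaussIPow_ne_zero ((l.norm - 1) / 4))
  rw [← hsum, ← gaussIPow_add]
  congr 1
  rw [hn, hcd]
  obtain ⟨j, hj⟩ := hoc
  obtain ⟨k, hk⟩ := hed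
  rw [hj, hk]
  have e1 : (2 * j + 1) * (k + k) = 2 * ((2 * j + 1) * k) := by ring
  have e2 : (2 * j + 1) ^ 2 + (k + k) ^ 2 - 1 = 4 * (j ^ 2 + j + k ^ 2) := by ring
  have e3 : (2 * j + 1 + (k + k)) ^ 2 - 1 = 4 * (j ^ 2 + j + k ^ 2 + (2 * j + 1) * k) := by ring
  rw [e1, e2, e3]
  omega

/-- The supplementary law for `2`. -/
theorem quartic_two {a : GaussianInt} (ha : IsPrimary a) :
    quartic 2 a = gaussIPow (a.re * a.im / 2) := by
  refine primary_induction (P := fun a => quartic 2 a = gaussIPow (a.re * a.im / 2)) ?_ ?_ ?_ a ha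
  · rw [quartic_of_isUnit isUnit_one]; simp [gaussIPow_zero]
  · rw [quartic_of_isUnit isUnit_one.neg]; simp [gaussIPow_zero]
  · intro l a hl hpl hpa ih
    have key : quartic 2 l = gaussIPow (l.re * l.im / 2) := by
      rcases hpl.prime_cases hl with ⟨p, hp, hn⟩ | ⟨m, hm, rfl⟩
      · have : Fact p.Prime := ⟨hp⟩
        rw [quartic_prime hl, quarticPrime_two hl hpl hn]
      · have := quartic_intCast_intCast (m := 2) hm (by
          push_cast; exact isCoprime_two_of_odd_norm (odd_norm_intCast hm))
        push_cast at this
        rw [this]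
        simp [gaussIPow_zero]
    rw [quartic_mul_right hl.ne_zero (ne_zero_of_odd_norm hpa.odd_norm), key, ih, ← gaussIPow_add]
    obtain ⟨⟨j, hj⟩, ⟨k, hk⟩⟩ := hpl
    obtain ⟨⟨m, hm⟩, ⟨n, hn⟩⟩ := hpa
    rw [Zsqrtd.re_mul, Zsqrtd.im_mul, hj, hk, hm, hn]
    apply gaussIPow_congr
    have e1 : (2 * j + 1) * (k + k) = 2 * ((2 * j + 1) * k) := by ring
    have e2 : (2 * m + 1) * (n + n) = 2 * ((2 * m + 1) * n) := by ring
    have e3 : ((2 * j + 1) * (2 * m + 1) + -1 * (k + k) * (n + n)) *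
        ((2 * j + 1) * (n + n) + (k + k) * (2 * m + 1)) =
        2 * ((2 * j + 1) * k + (2 * m + 1) * n + 4 * ((j ^ 2 + j) * (2 * m + 1) * n
          + (m ^ 2 + m) * (2 * j + 1) * k - k * n * ((2 * j + 1) * n + k * (2 * m + 1)))) := by
      ring
    rw [e1, e2, e3, Int.mul_ediv_cancel_left _ (by norm_num),
      Int.mul_ediv_cancel_left _ (by norm_num), Int.mul_ediv_cancel_left _ (by norm_num),
      Int.modEq_iff_dvd]
    exact ⟨_, add_sub_cancel_left _ _⟩

theorem isCoprime_intCast_gaussian {m n : ℤ} (h : IsCoprime m n) :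
    IsCoprime (m : GaussianInt) (n : GaussianInt) := by
  simpa using h.map (Int.castRingHom GaussianInt)

theorem isCoprime_intCast_of_norm {m : ℤ} {a : GaussianInt} (h : IsCoprime m a.norm) :
    IsCoprime (m : GaussianInt) a := by
  have h1 := isCoprime_intCast_gaussian h
  rw [gaussian_norm_cast] at h1
  exact h1.of_mul_right_left

theorem isCoprime_gaussI (a : GaussianInt) : IsCoprime gaussI a :=
  isCoprime_of_isUnit_left isUnit_gaussI

theorem isCoprime_neg_one (a : GaussianInt) : IsCoprime (-1) a :=
  isCoprime_of_isUnit_left isUnit_one.neg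

/-- Reciprocity for an arbitrary odd rational integer, with the sign it requires. -/
theorem quartic_reciprocity_odd {a : GaussianInt} (ha : IsPrimary a) {m : ℤ} (hm : Odd m)
    (hc : IsCoprime (m : GaussianInt) a) :
    quartic m a = gaussIPow ((m - 1) / 2 * ((a.norm - 1) / 2)) * quartic a m := by
  have h2 := Int.odd_iff.1 hm
  have hN := odd_norm_emod_four ha.odd_norm
  obtain ⟨k, hk⟩ : ∃ k, (a.norm - 1) / 2 = 2 * k := ⟨(a.norm - 1) / 4, by omega⟩
  rcases (by omega : m % 4 = 1 ∨ m % 4 = 3) with h | h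
  · rw [quartic_reciprocity ha h hc]
    obtain ⟨j, hj⟩ : ∃ j, (m - 1) / 2 = 2 * j := ⟨(m - 1) / 4, by omega⟩
    rw [hj, hk, gaussIPow_congr (k := 0) (Int.modEq_zero_iff_dvd.2 ⟨j * k, by ring⟩),
      gaussIPow_zero, one_mul]
  · have hc' : IsCoprime ((-m : ℤ) : GaussianInt) a := by
      push_cast; exact hc.neg_left
    have h1 := quartic_reciprocity ha (n := -m) (by omega) hc'
    have e : (m : GaussianInt) = -1 * ((-m : ℤ) : GaussianInt) := by push_cast; ring
    obtain ⟨j, hj⟩ : ∃ j, (m - 1) / 2 = 2 * j + 1 := ⟨(m - 3) / 4, by omega⟩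
    have h3 : quartic a ((-m : ℤ) : GaussianInt) = quartic a m := by
      apply quartic_of_associated
      push_cast
      exact (Associated.refl _).neg_left
    nth_rw 1 [e]
    rw [quartic_mul_left ha.odd_norm (isCoprime_neg_one a) hc', h1, h3,
      quartic_neg_one ha.odd_norm, hj, hk]
    congr 1
    apply gaussIPow_congr
    rw [Int.modEq_iff_dvd]
    exact ⟨j * k, by ring⟩

/-! ### Symbols modulo 11. -/

/-- The rational factor m has symbol 1, so only a fixed k remains. As 11 is inert, its symbol is k
to the power (121-1)/4 = 10·3. -/
theorem quartic_eq_of_dvd_sub_mul {a k z : GaussianInt} {m : ℤ}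
    (h : ((11 : ℤ) : GaussianInt) ∣ a - m * k) (hm : ¬ (11 : ℤ) ∣ m) (hz : z ^ 4 = 1)
    (hk : ((11 : ℤ) : GaussianInt) ∣ (k ^ 10) ^ 3 - z) : quartic a ((11 : ℤ) : GaussianInt) = z := by
  have h11 : Odd (11 : ℤ) := by decide
  have : Fact (Nat.Prime 11) := ⟨by norm_num⟩
  have hp : Prime ((11 : ℤ) : GaussianInt) := by
    have := prime_three_mod_four (q := 11) (by norm_num)
    simpa using this
  have hmc : IsCoprime (m : GaussianInt) ((11 : ℤ) : GaussianInt) := by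
    apply isCoprime_intCast_gaussian
    have h11p : Prime (11 : ℤ) := by
      have := Nat.prime_iff_prime_int.1 (show Nat.Prime 11 by norm_num)
      simpa using this
    exact (h11p.irreducible.coprime_iff_not_dvd.2 hm).symm
  have hkc : IsCoprime k ((11 : ℤ) : GaussianInt) := by
    refine (hp.irreducible.coprime_iff_not_dvd.2 fun hd => ?_).symm
    have h1 : ((11 : ℤ) : GaussianInt) ∣ z := by
      have := dvd_sub (dvd_pow (dvd_pow hd (by norm_num : 10 ≠ 0)) (by norm_num : 3 ≠ 0)) hk
      rwa [sub_sub_cancel] at this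
    exact hp.not_isUnit (isUnit_of_dvd_unit h1 (isUnit_of_fourth_root hz))
  rw [quartic_congr h, quartic_mul_left (odd_norm_intCast h11) hmc hkc,
    quartic_intCast_intCast h11 hmc, one_mul]
  have := quartic_natPrime_three_mod_four (q := 11) (by norm_num) (b := k) (z := z)
    (by simpa using hkc) hz (by simpa using hk)
  simpa using this

/-- If x ≡ ±4a then b² ≡ 3a² ≡ (5a)², so b ≡ ±5a; if x ≡ ±9a then b ≡ 0. Either way x + 2a + 2bi is
a times one of a few constants modulo 11. -/
theorem quartic_eleven_re {a b x e : ℤ} (hx : (11 : ℤ) ∣ x ^ 2 - 4 * (a ^ 2 + b ^ 2))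
    (h11 : ¬ ((11 : ℤ) ∣ b ∧ (11 : ℤ) ∣ x + 2 * a)) (he : e = 1 ∨ e = -1)
    (h : (11 : ℤ) ∣ x - e * (4 * a) ∨ (11 : ℤ) ∣ x - e * (9 * a)) :
    quartic ⟨x + 2 * a, 2 * b⟩ ((11 : ℤ) : GaussianInt) = -e := by
  have h11p : Prime (11 : ℤ) := by
    have := Nat.prime_iff_prime_int.1 (show Nat.Prime 11 by norm_num)
    simpa using this
  have ha : ¬ (11 : ℤ) ∣ a := by
    intro ha
    have hxa : (11 : ℤ) ∣ x := by rcases he with rfl | rfl <;> omega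
    apply h11
    refine ⟨?_, by omega⟩
    have h1 : (11 : ℤ) ∣ 4 * b ^ 2 := by
      have : 4 * b ^ 2 = x * x - 4 * (a * a) - (x ^ 2 - 4 * (a ^ 2 + b ^ 2)) := by ring
      rw [this]
      exact dvd_sub (dvd_sub (hxa.mul_right _) ((ha.mul_right _).mul_left _)) hx
    exact h11p.dvd_of_dvd_pow (by omega : (11 : ℤ) ∣ b ^ 2)
  have hz : (-(e : GaussianInt)) ^ 4 = 1 := by rcases he with rfl | rfl <;> norm_num
  rcases h with h | h
  · have hb : (11 : ℤ) ∣ (b - 5 * a) * (b + 5 * a) := by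
      obtain ⟨s, hs⟩ := h
      obtain ⟨t, ht⟩ := hx
      have he2 : e ^ 2 = 1 := by rcases he with rfl | rfl <;> norm_num
      refine ⟨3 * (-t + s * (x + e * (4 * a))) + a ^ 2 - b ^ 2, ?_⟩
      linear_combination (-3) * ht + 3 * (x + e * (4 * a)) * hs + 48 * a ^ 2 * he2
    rcases h11p.dvd_or_dvd hb with hb | hb
    · apply quartic_eq_of_dvd_sub_mul (m := a) (k := ⟨4 * e + 2, 10⟩) _ ha hz
      · rw [Zsqrtd.intCast_dvd]
        rcases he with rfl | rfl <;> decide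
      · rw [Zsqrtd.intCast_dvd]
        rcases he with rfl | rfl <;> simp <;> omega
    · apply quartic_eq_of_dvd_sub_mul (m := a) (k := ⟨4 * e + 2, -10⟩) _ ha hz
      · rw [Zsqrtd.intCast_dvd]
        rcases he with rfl | rfl <;> decide
      · rw [Zsqrtd.intCast_dvd]
        rcases he with rfl | rfl <;> simp <;> omega
  · have hb : (11 : ℤ) ∣ b := by
      obtain ⟨s, hs⟩ := h
      obtain ⟨t, ht⟩ := hx
      have he2 : e ^ 2 = 1 := by rcases he with rfl | rfl <;> norm_num
      apply h11p.dvd_of_dvd_pow (n := 2)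
      refine ⟨3 * (-t + s * (x + e * (9 * a))) + 21 * a ^ 2 - b ^ 2, ?_⟩
      linear_combination (-3) * ht + 3 * (x + e * (9 * a)) * hs + 243 * a ^ 2 * he2
    -- Here the argument is (9e+2)a modulo 11: zero for e = 1, which `h11` excludes, and 4a for e =
    -- -1.
    rcases he with rfl | rfl
    · exact absurd ⟨hb, by omega⟩ h11
    · apply quartic_eq_of_dvd_sub_mul (m := a) (k := 4) _ ha hz
      · rw [Zsqrtd.intCast_dvd]; decide
      · rw [Zsqrtd.intCast_dvd]
        have e4 : (4 : GaussianInt) = ⟨4, 0⟩ := rfl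
        rw [e4]
        simp; omega

theorem quartic_eleven_im {a b x e : ℤ} (hx : (11 : ℤ) ∣ x ^ 2 - 4 * (a ^ 2 + b ^ 2))
    (h11 : ¬ ((11 : ℤ) ∣ b ∧ (11 : ℤ) ∣ x + 2 * a)) (he : e = 1 ∨ e = -1)
    (h : (11 : ℤ) ∣ x - e * (4 * b) ∨ (11 : ℤ) ∣ x - e * (9 * b)) :
    quartic ⟨x + 2 * a, 2 * b⟩ ((11 : ℤ) : GaussianInt) = -e * gaussI := by
  have h11p : Prime (11 : ℤ) := by
    have := Nat.prime_iff_prime_int.1 (show Nat.Prime 11 by norm_num)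
    simpa using this
  have hb : ¬ (11 : ℤ) ∣ b := by
    intro hb
    have hxb : (11 : ℤ) ∣ x := by rcases he with rfl | rfl <;> omega
    have h1 : (11 : ℤ) ∣ 4 * a ^ 2 := by
      have : 4 * a ^ 2 = x * x - 4 * (b * b) - (x ^ 2 - 4 * (a ^ 2 + b ^ 2)) := by ring
      rw [this]
      exact dvd_sub (dvd_sub (hxb.mul_right _) ((hb.mul_right _).mul_left _)) hx
    have h2 := h11p.dvd_of_dvd_pow (by omega : (11 : ℤ) ∣ a ^ 2)
    exact h11 ⟨hb, by omega⟩
  have hz : (-(e : GaussianInt) * gaussI) ^ 4 = 1 := by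
    rw [mul_pow, gaussI_pow_four]
    rcases he with rfl | rfl <;> norm_num
  rcases h with h | h
  · have ha : (11 : ℤ) ∣ (a - 5 * b) * (a + 5 * b) := by
      obtain ⟨s, hs⟩ := h
      obtain ⟨t, ht⟩ := hx
      have he2 : e ^ 2 = 1 := by rcases he with rfl | rfl <;> norm_num
      refine ⟨3 * (-t + s * (x + e * (4 * b))) + b ^ 2 - a ^ 2, ?_⟩
      linear_combination (-3) * ht + 3 * (x + e * (4 * b)) * hs + 48 * b ^ 2 * he2
    rcases h11p.dvd_or_dvd ha with ha | ha
    · apply quartic_eq_of_dvd_sub_mul (m := b) (k := ⟨4 * e + 10, 2⟩) _ hb hz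
      · rw [Zsqrtd.intCast_dvd]
        rcases he with rfl | rfl <;> decide
      · rw [Zsqrtd.intCast_dvd]
        rcases he with rfl | rfl <;> simp <;> omega
    · apply quartic_eq_of_dvd_sub_mul (m := b) (k := ⟨4 * e - 10, 2⟩) _ hb hz
      · rw [Zsqrtd.intCast_dvd]
        rcases he with rfl | rfl <;> decide
      · rw [Zsqrtd.intCast_dvd]
        rcases he with rfl | rfl <;> simp <;> omega
  · have ha : (11 : ℤ) ∣ a := by
      obtain ⟨s, hs⟩ := h
      obtain ⟨t, ht⟩ := hx
      have he2 : e ^ 2 = 1 := by rcases he with rfl | rfl <;> norm_num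
      apply h11p.dvd_of_dvd_pow (n := 2)
      refine ⟨3 * (-t + s * (x + e * (9 * b))) + 21 * b ^ 2 - a ^ 2, ?_⟩
      linear_combination (-3) * ht + 3 * (x + e * (9 * b)) * hs + 243 * b ^ 2 * he2
    apply quartic_eq_of_dvd_sub_mul (m := b) (k := ⟨9 * e, 2⟩) _ hb hz
    · rw [Zsqrtd.intCast_dvd]
      rcases he with rfl | rfl <;> decide
    · rw [Zsqrtd.intCast_dvd]
      rcases he with rfl | rfl <;> simp <;> omega

/-! ### Removal of common factors and the symbol relation for odd x. -/

/-- Removal of the common factor of `c` and `n` in a representation `11 y² = c² - w n`. -/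
theorem exists_common_square_factor (w : ℤ) : ∀ (k : ℕ) (c n y : ℤ), c.natAbs ≤ k → c ≠ 0 →
    11 * y ^ 2 = c ^ 2 - w * n →
    (∀ q : ℕ, q.Prime → (q : ℤ) ∣ c → (q : ℤ) ∣ n → q ≠ 11 ∧ ¬ (q : ℤ) ∣ w) →
    ∃ g c₁ n₁ y₁ : ℤ, c = g * c₁ ∧ n = g ^ 2 * n₁ ∧ y = g * y₁ ∧ IsCoprime c₁ n₁ := by
  intro k
  induction k with
  | zero => intro c n y hk hc; omega
  | succ k ih =>
    intro c n y hk hc h hq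
    by_cases hg : Int.gcd c n = 1
    · exact ⟨1, c, n, y, by ring, by ring, by ring, Int.isCoprime_iff_gcd_eq_one.2 hg⟩
    obtain ⟨r, hr, hrg⟩ := Nat.exists_prime_and_dvd hg
    have hrc : (r : ℤ) ∣ c := (Int.natCast_dvd_natCast.2 hrg).trans (Int.gcd_dvd_left ..)
    have hrn : (r : ℤ) ∣ n := (Int.natCast_dvd_natCast.2 hrg).trans (Int.gcd_dvd_right ..)
    obtain ⟨h11, hw⟩ := hq r hr hrc hrn
    have hrp := Nat.prime_iff_prime_int.1 hr
    have hr0 : (r : ℤ) ≠ 0 := hrp.ne_zero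
    -- A common prime r ≠ 11 divides 11y², hence y; then r² divides wn, and r ∤ w moves the whole r²
    -- into n. Dividing by r keeps the shape of the equation.
    have hry : (r : ℤ) ∣ y := by
      have h1 : (r : ℤ) ∣ 11 * y ^ 2 := by
        rw [h]; exact dvd_sub (dvd_pow hrc two_ne_zero) (hrn.mul_left _)
      rcases hrp.dvd_or_dvd h1 with h2 | h2
      · exact absurd ((Nat.prime_dvd_prime_iff_eq hr (by norm_num : Nat.Prime 11)).1
          (by exact_mod_cast h2)) h11
      · exact hrp.dvd_of_dvd_pow h2
    obtain ⟨c', rfl⟩ := hrc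
    obtain ⟨y', rfl⟩ := hry
    have h2 : (r : ℤ) ^ 2 ∣ n := by
      have h3 : (r : ℤ) ^ 2 ∣ n * w := ⟨c' ^ 2 - 11 * y' ^ 2, by linear_combination h⟩
      exact IsCoprime.dvd_of_dvd_mul_right
        (IsCoprime.pow_left (hrp.irreducible.coprime_iff_not_dvd.2 hw)) h3
    obtain ⟨n', rfl⟩ := h2
    have hc' : c' ≠ 0 := right_ne_zero_of_mul hc
    have hk' : c'.natAbs ≤ k := by
      rw [Int.natAbs_mul, Int.natAbs_natCast] at hk
      have := hr.two_le
      nlinarith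
    obtain ⟨g, c₁, n₁, y₁, e1, e2, e3, hcop⟩ := ih c' n' y' hk' hc'
      (by
        apply mul_left_cancel₀ (pow_ne_zero 2 hr0)
        linear_combination h)
      (fun q hqp hqc hqn => hq q hqp (hqc.mul_left _) (hqn.mul_left _))
    exact ⟨r * g, c₁, n₁, y₁, by rw [e1]; ring, by rw [e2]; ring, by rw [e3]; ring, hcop⟩

/-- Oddness of g is inherited from n, and the sign of g is free because n involves only g². -/
theorem exists_odd_common_square_factor {w c n y : ℤ} (hc : c ≠ 0) (hn : Odd n)
    (h : 11 * y ^ 2 = c ^ 2 - w * n)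
    (hq : ∀ q : ℕ, q.Prime → (q : ℤ) ∣ c → (q : ℤ) ∣ n → q ≠ 11 ∧ ¬ (q : ℤ) ∣ w) :
    ∃ g c₁ n₁ y₁ : ℤ, c = g * c₁ ∧ n = g ^ 2 * n₁ ∧ y = g * y₁ ∧ IsCoprime c₁ n₁ ∧ g % 4 = 1 := by
  obtain ⟨g, c₁, n₁, y₁, e1, e2, e3, hcop⟩ :=
    exists_common_square_factor w c.natAbs c n y le_rfl hc h hq
  have hg : Odd g := by
    rw [e2, pow_two, mul_assoc] at hn
    exact (Int.odd_mul.1 hn).1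
  have := Int.odd_iff.1 hg
  rcases (by omega : g % 4 = 1 ∨ g % 4 = 3) with h4 | h4
  · exact ⟨g, c₁, n₁, y₁, e1, e2, e3, hcop, h4⟩
  · exact ⟨-g, -c₁, n₁, -y₁, by rw [e1]; ring, by rw [e2]; ring, by rw [e3]; ring, hcop.neg_left,
      by omega⟩

theorem isCoprime_of_forall_prime {m n : ℤ} (h : ∀ q : ℤ, Prime q → q ∣ m → ¬ q ∣ n)
    (h0 : m ≠ 0) : IsCoprime m n :=
  isCoprime_of_prime_dvd (fun h1 => h0 h1.1) h

theorem odd_of_dvd_int {m n : ℤ} (h : Odd n) (hd : m ∣ n) : Odd m := by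
  obtain ⟨k, rfl⟩ := hd
  exact (Int.odd_mul.1 h).1

theorem int_prime_eleven : Prime (11 : ℤ) := by
  have := Nat.prime_iff_prime_int.1 (show Nat.Prime 11 by norm_num)
  simpa using this

theorem isCoprime_of_prime_eq_sq_add_sq {p : ℕ} (hp : p.Prime) {k c d : ℤ}
    (h : (p : ℤ) = c ^ 2 + k * d ^ 2) : IsCoprime c d := by
  have hpi := Nat.prime_iff_prime_int.1 hp
  by_cases h0 : c = 0 ∧ d = 0
  · rw [h0.1, h0.2] at h
    exact absurd (by linarith : (p : ℤ) = 0) hpi.ne_zero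
  refine isCoprime_of_prime_dvd h0 fun q hq hqc hqd => ?_
  have h1 : q * q ∣ (p : ℤ) := by
    rw [h, ← pow_two]
    exact dvd_add (pow_dvd_pow_of_dvd hqc 2) ((pow_dvd_pow_of_dvd hqd 2).mul_left _)
  obtain ⟨m, hm⟩ := h1
  rcases hpi.irreducible.isUnit_or_isUnit (a := q) (b := q * m) (by rw [hm]; ring) with h | h
  · exact hq.not_isUnit h
  · exact hq.not_isUnit (isUnit_of_mul_isUnit_left h)

theorem isCoprime_mul_add {m n a b N : ℤ} (h : IsCoprime (m * a) (n * b))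
    (hN : N = m * a + n * b) : IsCoprime m N ∧ IsCoprime a N ∧ IsCoprime n N ∧ IsCoprime b N := by
  have h1 : IsCoprime (m * a) N := by
    have : IsCoprime (m * a) (n * b + (m * a) * 1) := h.add_mul_left_right 1
    rw [hN]; rwa [mul_one, add_comm] at this
  have h2 : IsCoprime (n * b) N := by
    have : IsCoprime (n * b) (m * a + (n * b) * 1) := h.symm.add_mul_left_right 1
    rw [hN]; rwa [mul_one] at this
  exact ⟨h1.of_mul_left_left, h1.of_mul_left_right, h2.of_mul_left_left, h2.of_mul_left_right⟩

/-- With A = x + 2π = gA₁ one has N(A₁) = 2n₁x + 11y₁². Reading this modulo A₁ and applying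
reciprocity to each factor leaves the symbols of x and y modulo π, that of A modulo 11, and powers
of i. -/
theorem quartic_symbol_of_odd {p : ℕ} (hp : p.Prime) (hp4 : p % 4 = 1) {c d x y : ℤ}
    (hcd : (p : ℤ) = c ^ 2 + d ^ 2) (hxy : 4 * (p : ℤ) = x ^ 2 + 11 * y ^ 2)
    (hc : c % 4 = 1) (hx : Odd x) (hy : y % 4 = 1)
    (h11 : ¬ ((11 : ℤ) ∣ d ∧ (11 : ℤ) ∣ x + 2 * c)) :
    quartic x ⟨c, d⟩ = gaussIPow (2 * ((x - 1) / 2 * (d / 2) + d / 2 + (x ^ 2 - 1) / 8 + (x + 1) / 2)) *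
      quartic ⟨x + 2 * c, 2 * d⟩ ((11 : ℤ) : GaussianInt) * quartic y ⟨c, d⟩ := by
  have hpi := Nat.prime_iff_prime_int.1 hp
  have hed : Even d := by
    rcases Int.even_or_odd d with h | h
    · exact h
    · exfalso
      obtain ⟨k, hk⟩ := h
      obtain ⟨j, hj⟩ : ∃ j, c = 4 * j + 1 := ⟨c / 4, by omega⟩
      have : (p : ℤ) = 2 * (8 * j ^ 2 + 4 * j + 2 * k ^ 2 + 2 * k + 1) := by
        rw [hcd, hj, hk]; ring
      omega
  have hoc : Odd c := Int.odd_iff.2 (by omega)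
  have hoy : Odd y := Int.odd_iff.2 (by omega)
  have hπ : IsPrimary ⟨c, d⟩ := ⟨hoc, hed⟩
  have hπn : (⟨c, d⟩ : GaussianInt).norm = p := by rw [gaussian_norm_eq, hcd]
  have hccd : IsCoprime c d := isCoprime_of_prime_eq_sq_add_sq hp (k := 1) (by rw [hcd]; ring)
  have hd0 : d ≠ 0 := by
    rintro rfl
    have hu : IsUnit c := isCoprime_zero_right.1 hccd
    rcases Int.isUnit_iff.1 hu with rfl | rfl
    · have := hp.two_le; norm_num at hcd; omega
    · omega
  have hx0 : x ≠ 0 := by rintro rfl; exact absurd hx (by decide)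
  have hcxy : IsCoprime x y := by
    refine isCoprime_of_forall_prime (fun q hq hqx hqy => ?_) hx0
    have h1 : q ^ 2 ∣ 4 * (p : ℤ) := by
      rw [hxy]; exact dvd_add (pow_dvd_pow_of_dvd hqx 2) ((pow_dvd_pow_of_dvd hqy 2).mul_left _)
    have h2 : IsCoprime (q ^ 2) 4 := by
      have : IsCoprime (q ^ 2) (2 ^ 2) := by
        apply IsCoprime.pow
        exact (Int.isCoprime_two_right).2 (odd_of_dvd_int hx hqx)
      exact this
    obtain ⟨m, hm⟩ := h2.dvd_of_dvd_mul_left h1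
    rcases hpi.irreducible.isUnit_or_isUnit (a := q) (b := q * m) (by rw [hm]; ring) with h | h
    · exact hq.not_isUnit h
    · exact hq.not_isUnit (isUnit_of_mul_isUnit_left h)
  have hx11 : IsCoprime x 11 := by
    refine (int_prime_eleven.irreducible.coprime_iff_not_dvd.2 fun h => ?_).symm
    have h1 : (11 : ℤ) ∣ 4 * p := by
      rw [hxy]; exact dvd_add (dvd_pow h two_ne_zero) (dvd_mul_right _ _)
    have h2 : 11 ∣ p := by omega
    have := (Nat.prime_dvd_prime_iff_eq (by norm_num) hp).1 h2
    omega
  have hxyp : IsCoprime x (p : ℤ) ∧ IsCoprime y (p : ℤ) := by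
    have h1 : IsCoprime (x * x) (y * (11 * y)) :=
      (IsCoprime.mul_right hcxy (hx11.mul_right hcxy)).mul_left
        (IsCoprime.mul_right hcxy (hx11.mul_right hcxy))
    obtain ⟨h2, -, h3, -⟩ := isCoprime_mul_add (N := 4 * p) h1 (by rw [hxy]; ring)
    exact ⟨h2.of_mul_right_right, h3.of_mul_right_right⟩
  have hxπ : IsCoprime (x : GaussianInt) ⟨c, d⟩ :=
    isCoprime_intCast_of_norm (by rw [hπn]; exact hxyp.1)
  have hyπ : IsCoprime (y : GaussianInt) ⟨c, d⟩ :=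
    isCoprime_intCast_of_norm (by rw [hπn]; exact hxyp.2)
  have hon : Odd (x + 2 * c) := hx.add_even (even_two_mul c)
  obtain ⟨g, d₁', n₁, y₁, e1, e2, e3, hcop, hg4⟩ :=
    exists_odd_common_square_factor (w := x - 2 * c) (c := 2 * d) (n := x + 2 * c) (y := y)
      (by omega) hon (by linear_combination 4 * hcd - hxy) (by
        intro q hq hqd hqn
        have hqi := Nat.prime_iff_prime_int.1 hq
        have hoq : Odd (q : ℤ) := odd_of_dvd_int hon hqn
        have hq2 : ¬ (q : ℤ) ∣ 2 := fun h => by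
          have h1 := (Nat.prime_dvd_prime_iff_eq hq Nat.prime_two).1 (by exact_mod_cast h)
          rw [h1] at hoq; exact absurd hoq (by decide)
        have hqd' : (q : ℤ) ∣ d := (hqi.dvd_or_dvd hqd).resolve_left hq2
        refine ⟨fun h => ?_, fun h => ?_⟩
        · rw [h] at hqd' hqn
          exact h11 ⟨hqd', hqn⟩
        · have h1 : (q : ℤ) ∣ 2 * (2 * c) := by
            have := dvd_sub hqn h
            rwa [show x + 2 * c - (x - 2 * c) = 2 * (2 * c) by ring] at this
          have h2 := (hqi.dvd_or_dvd ((hqi.dvd_or_dvd h1).resolve_left hq2)).resolve_left hq2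
          exact hqi.not_isUnit (hccd.isUnit_of_dvd' h2 hqd'))
  have hog : Odd g := Int.odd_iff.2 (by omega)
  have hg0 : g ≠ 0 := by omega
  obtain ⟨d₁, rfl⟩ : Even d₁' := by
    have : Even (g * d₁') := by rw [← e1]; exact even_two_mul d
    exact (Int.even_mul.1 this).resolve_left (Int.not_even_iff_odd.2 hog)
  have ed : d = g * d₁ := by linarith
  have hed₁ : Even d₁ :=
    (Int.even_mul.1 (ed ▸ hed)).resolve_left (Int.not_even_iff_odd.2 hog)
  have hon₁ : Odd n₁ := by
    rw [e2] at hon; exact (Int.odd_mul.1 hon).2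
  have hoy₁ : Odd y₁ := by
    rw [e3] at hoy; exact (Int.odd_mul.1 hoy).2
  set A₁ : GaussianInt := ⟨g * n₁, 2 * d₁⟩ with hA₁
  have hA₁p : IsPrimary A₁ := ⟨hog.mul hon₁, even_two_mul d₁⟩
  have hA₁n : A₁.norm = (2 * n₁) * x + (11 * y₁) * y₁ := by
    rw [gaussian_norm_eq]
    apply mul_left_cancel₀ (pow_ne_zero 2 hg0)
    have h1 : (x + 2 * c) ^ 2 + 4 * d ^ 2 = 2 * x * (x + 2 * c) + 11 * y ^ 2 := by
      linear_combination (-4) * hcd + hxy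
    rw [hA₁]
    dsimp only
    rw [e2, ed, e3] at h1
    linear_combination h1
  have hcop2 : IsCoprime (2 * d₁) n₁ := by rw [two_mul]; exact hcop
  have hyn : IsCoprime n₁ (11 * y₁) ∧ IsCoprime n₁ y₁ := by
    have h1 : 11 * y₁ * y₁ = (2 * d₁) ^ 2 + n₁ * -(x - 2 * c) := by
      apply mul_left_cancel₀ (pow_ne_zero 2 hg0)
      have h2 : 11 * y ^ 2 = 4 * d ^ 2 - (x - 2 * c) * (x + 2 * c) := by
        linear_combination 4 * hcd - hxy
      rw [e2, ed, e3] at h2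
      linear_combination h2
    have h2 : IsCoprime n₁ ((2 * d₁) ^ 2 + n₁ * -(x - 2 * c)) :=
      (hcop2.symm.pow_right).add_mul_left_right _
    rw [← h1] at h2
    exact ⟨h2.of_mul_right_left, h2.of_mul_right_right⟩
  have hxy₁ : IsCoprime x y₁ := by rw [e3] at hcxy; exact hcxy.of_mul_right_right
  have hxg : IsCoprime x g := by rw [e3] at hcxy; exact hcxy.of_mul_right_left
  have hcg : IsCoprime c g := by rw [ed] at hccd; exact hccd.of_mul_right_left
  have hg11 : IsCoprime g 11 := by
    refine (int_prime_eleven.irreducible.coprime_iff_not_dvd.2 fun h => h11 ⟨?_, ?_⟩).symm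
    · rw [ed]; exact h.mul_right _
    · rw [e2, pow_two, mul_assoc]; exact h.mul_right _
  have h2o : ∀ {m : ℤ}, Odd m → IsCoprime 2 m := fun h => Int.isCoprime_two_left.2 h
  have hbig : IsCoprime ((2 * n₁) * x) ((11 * y₁) * y₁) := by
    have h2 : IsCoprime 2 (11 * y₁ * y₁) := h2o (((by decide : Odd (11 : ℤ)).mul hoy₁).mul hoy₁)
    exact (h2.mul_left (hyn.1.mul_right hyn.2)).mul_left
      ((hx11.mul_right hxy₁).mul_right hxy₁)
  obtain ⟨hN1, hNx, hN3, hNy⟩ := isCoprime_mul_add hbig hA₁n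
  have cop : ∀ {m : ℤ}, IsCoprime m A₁.norm → IsCoprime (m : GaussianInt) A₁ :=
    fun h => isCoprime_intCast_of_norm h
  have c2 := cop hN1.of_mul_left_left
  have cn := cop hN1.of_mul_left_right
  have cx := cop hNx
  have c11 := cop hN3.of_mul_left_left
  have cy := cop hNy
  have hA₁o := hA₁p.odd_norm
  -- reciprocity modulo the primary number `A₁`, whose norm is `1` modulo `8`
  have hrec : ∀ {m : ℤ}, Odd m → IsCoprime (m : GaussianInt) A₁ → quartic m A₁ = quartic A₁ m := by
    intro m hm hcm
    rw [quartic_reciprocity_odd hA₁p hm hcm]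
    obtain ⟨j, hj⟩ := hog.mul hon₁
    obtain ⟨k, hk⟩ := hed₁
    have : (A₁.norm - 1) / 2 = 4 * ((j ^ 2 + j) / 2 + 2 * k ^ 2) := by
      obtain ⟨i, hi⟩ : Even (j ^ 2 + j) := by
        have := Int.even_mul_succ_self j
        rwa [show j * (j + 1) = j ^ 2 + j by ring] at this
      rw [gaussian_norm_eq, hA₁]
      dsimp only
      rw [hj, hk, show (2 * j + 1) ^ 2 + (2 * (k + k)) ^ 2 - 1 = 4 * (j ^ 2 + j) + 16 * k ^ 2 by ring,
        hi]
      omega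
    rw [this, gaussIPow_congr (k := 0) (Int.modEq_zero_iff_dvd.2
      ((dvd_mul_right 4 _).mul_left _)), gaussIPow_zero, one_mul]
  have hneg : quartic (-1) A₁ = 1 := by
    have := hrec (m := -1) (by decide) (by push_cast; exact isCoprime_neg_one A₁)
    push_cast at this
    rw [this, quartic_of_isUnit isUnit_one.neg]
  have s2 : quartic 2 A₁ = gaussIPow (g * n₁ * d₁) := by
    rw [quartic_two hA₁p, hA₁]
    dsimp only
    congr 1
    rw [show g * n₁ * (2 * d₁) = 2 * (g * n₁ * d₁) by ring]
    omega
  have sI : ∀ {m : ℤ}, Odd m → quartic gaussI m = gaussIPow ((m ^ 2 - 1) / 4) := by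
    intro m hm
    rw [quartic_gaussI (odd_norm_intCast hm), norm_intCast_gaussian]
  have hA₁eq : A₁ = ((g * n₁ : ℤ) : GaussianInt) + ((2 * d₁ : ℤ) : GaussianInt) * gaussI :=
    gaussian_eq A₁
  -- Modulo n₁ only the imaginary part 2d₁·i of A₁ is left, and its rational factor has symbol 1.
  have sn : quartic n₁ A₁ = gaussIPow ((n₁ ^ 2 - 1) / 4) := by
    rw [hrec hon₁ cn, quartic_congr (b' := ((2 * d₁ : ℤ) : GaussianInt) * gaussI)
      ⟨g, by rw [hA₁eq]; push_cast; ring⟩,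
      quartic_mul_left (odd_norm_intCast hon₁) (isCoprime_intCast_gaussian hcop2)
        (isCoprime_gaussI _), quartic_intCast_intCast hon₁ (isCoprime_intCast_gaussian hcop2),
      one_mul, sI hon₁]
  have hAA : (⟨x + 2 * c, 2 * d⟩ : GaussianInt) = g * A₁ := by
    rw [hA₁, e2, ed]; ext <;> simp <;> ring
  have s11 : quartic ⟨x + 2 * c, 2 * d⟩ ((11 : ℤ) : GaussianInt) = quartic (11 : ℤ) A₁ := by
    have ho11 : Odd (11 : ℤ) := by decide
    rw [hrec ho11 c11, hAA, quartic_mul_left (odd_norm_intCast ho11)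
      (isCoprime_intCast_gaussian hg11) c11.symm,
      quartic_intCast_intCast ho11 (isCoprime_intCast_gaussian hg11), one_mul]
  have hπy₁ : IsCoprime (⟨c, d⟩ : GaussianInt) y₁ := by
    rw [e3] at hyπ; push_cast at hyπ; exact hyπ.of_mul_left_right.symm
  have hπeq : (⟨c, d⟩ : GaussianInt) = c + d * gaussI := gaussian_eq _
  have sy : quartic y ⟨c, d⟩ = quartic ⟨c, d⟩ y₁ := by
    rw [quartic_reciprocity hπ hy hyπ, e3, Int.cast_mul, quartic_mul_right
      (by exact_mod_cast hg0) (ne_zero_of_odd_norm (odd_norm_intCast hoy₁)),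
      quartic_congr (a := (g : GaussianInt)) (b' := (c : GaussianInt))
        ⟨d₁ * gaussI, by rw [hπeq, ed]; push_cast; ring⟩,
      quartic_intCast_intCast hog (isCoprime_intCast_gaussian hcg), one_mul]
  -- gA₁ = x + 2π is congruent to 2π modulo x.
  have sx : quartic ⟨c, d⟩ x = quartic x A₁ := by
    have hox := odd_norm_intCast hx
    have h2x := isCoprime_intCast_gaussian (h2o hx)
    have h1 : quartic (((2 : ℤ) : GaussianInt) * ⟨c, d⟩) x = quartic (g * A₁) x := by
      apply quartic_congr
      rw [← hAA]
      exact ⟨-1, by ext <;> simp⟩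
    rw [quartic_mul_left hox h2x hxπ.symm, quartic_intCast_intCast hx h2x, one_mul,
      quartic_mul_left hox (isCoprime_intCast_gaussian hxg.symm) cx.symm,
      quartic_intCast_intCast hx (isCoprime_intCast_gaussian hxg.symm), one_mul] at h1
    rw [h1, hrec hx cx]
  -- A₁² + 11y₁² = 4πn₁, so the square of A₁ is π up to a rational factor modulo y₁.
  have sy₁ : quartic y₁ A₁ ^ 2 = quartic ⟨c, d⟩ y₁ := by
    have hoy' := odd_norm_intCast hoy₁
    have h4n : IsCoprime (((4 * n₁ : ℤ)) : GaussianInt) y₁ := by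
      apply isCoprime_intCast_gaussian
      have : IsCoprime (2 * 2) y₁ := (h2o hoy₁).mul_left (h2o hoy₁)
      exact IsCoprime.mul_left this hyn.2
    rw [hrec hoy₁ cy, ← quartic_pow_left hoy' cy.symm]
    have h1 : 4 * ((⟨c, d⟩ : GaussianInt) * n₁) = A₁ ^ 2 + 11 * y₁ ^ 2 := by
      have hg0' : (g : GaussianInt) ≠ 0 := by exact_mod_cast hg0
      apply mul_left_cancel₀ (pow_ne_zero 2 hg0')
      have h2 : 4 * ((⟨c, d⟩ : GaussianInt) * ((x + 2 * c : ℤ) : GaussianInt)) =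
          (⟨x + 2 * c, 2 * d⟩ : GaussianInt) ^ 2 + 11 * (y : GaussianInt) ^ 2 := by
        have h3 : (4 * (c ^ 2 + d ^ 2) : ℤ) = x ^ 2 + 11 * y ^ 2 := by rw [← hcd, hxy]
        have h4 : ((4 * (c ^ 2 + d ^ 2) : ℤ) : GaussianInt) = ((x ^ 2 + 11 * y ^ 2 : ℤ) : GaussianInt) := by
          rw [h3]
        push_cast at h4
        have h5 : (⟨x + 2 * c, 2 * d⟩ : GaussianInt) = x + 2 * (c + d * gaussI) := by
          rw [← hπeq]; ext <;> simp
        rw [h5, hπeq]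
        push_cast
        linear_combination h4 - 4 * d ^ 2 * gaussI_sq
      rw [hAA, e2, e3] at h2
      push_cast at h2
      linear_combination h2
    rw [quartic_congr (b' := ((4 * n₁ : ℤ) : GaussianInt) * ⟨c, d⟩)
      ⟨-(11 * y₁), by push_cast; linear_combination -h1⟩,
      quartic_mul_left hoy' h4n hπy₁, quartic_intCast_intCast hoy₁ h4n, one_mul]
  have main : quartic 2 A₁ * quartic n₁ A₁ * quartic x A₁ =
      quartic (11 : ℤ) A₁ * quartic y₁ A₁ ^ 2 := by
    rw [pow_two, ← mul_assoc]
    rw [Int.cast_two] at c2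
    have c1 := isCoprime_neg_one A₁
    rw [← quartic_mul_left hA₁o c2 cn, ← quartic_mul_left hA₁o (c2.mul_left cn) cx,
      ← quartic_mul_left hA₁o c11 cy, ← quartic_mul_left hA₁o (c11.mul_left cy) cy,
      ← one_mul (quartic (2 * _ * _) _), ← hneg,
      ← quartic_mul_left hA₁o c1 ((c2.mul_left cn).mul_left cx)]
    apply quartic_congr
    refine ⟨-star A₁, ?_⟩
    rw [mul_neg, ← gaussian_norm_cast, hA₁n]
    push_cast
    ring
  have hπ2 : quartic x ⟨c, d⟩ = gaussIPow ((x - 1) / 2 * (((p : ℤ) - 1) / 2)) * quartic x A₁ := by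
    rw [quartic_reciprocity_odd hπ hx hxπ, hπn, sx]
  rw [s2, sn, sy₁, ← gaussIPow_add] at main
  rw [hπ2, s11, sy, mul_assoc, ← main, ← mul_assoc, ← gaussIPow_add]
  congr 1
  apply gaussIPow_congr
  -- the remaining congruence between exponents
  obtain ⟨j, hj⟩ : ∃ j, g = 4 * j + 1 := ⟨g / 4, by omega⟩
  obtain ⟨k, hk⟩ := hed₁
  obtain ⟨m, hm⟩ := hon₁
  obtain ⟨a, ha⟩ := hx
  obtain ⟨b, hb⟩ : ∃ b, c = 4 * b + 1 := ⟨c / 4, by omega⟩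
  have even_sq_add : ∀ s : ℤ, ∃ i, s ^ 2 + s = 2 * i := fun s => by
    obtain ⟨i, hi⟩ := Int.even_mul_succ_self s
    exact ⟨i, by linear_combination hi⟩
  obtain ⟨i, hi⟩ := even_sq_add a
  obtain ⟨e, he⟩ := even_sq_add (-(g * k))
  have t1 : (x - 1) / 2 = a := by omega
  have hD : d = 2 * (g * k) := by rw [ed, hk]; ring
  have t2 : ((p : ℤ) - 1) / 2 = 8 * b ^ 2 + 4 * b + 2 * (g * k) ^ 2 := by
    have : (p : ℤ) - 1 = 2 * (8 * b ^ 2 + 4 * b + 2 * (g * k) ^ 2) := by rw [hcd, hb, hD]; ring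
    omega
  have t3 : d / 2 = g * k := by omega
  have t4 : (x ^ 2 - 1) / 8 = i := by
    have : x ^ 2 - 1 = 8 * i := by rw [ha]; linear_combination 4 * hi
    omega
  have t5 : (x + 1) / 2 = a + 1 := by omega
  have t6 : (n₁ ^ 2 - 1) / 4 = m ^ 2 + m := by
    have : n₁ ^ 2 - 1 = 4 * (m ^ 2 + m) := by rw [hm]; ring
    omega
  -- This is x + 2c = g²n₁ with g² ≡ 1 modulo 8.
  have hM : a + 4 * b + 1 - m = 4 * ((2 * j ^ 2 + j) * (2 * m + 1)) := by
    rw [ha, hb, hj, hm] at e2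
    refine mul_left_cancel₀ (two_ne_zero (α := ℤ)) ?_
    linear_combination e2
  rw [t1, t2, t3, t4, t5, t6, hk, hm, Int.modEq_iff_dvd]
  refine ⟨-a * e + g * k * (m + 1) + (i + a + 1) + b * (2 * a + 3) + 4 * b ^ 2
    - (2 * j ^ 2 + j) * (2 * m + 1) * (a + 4 * b + 1 + m + 1) - a * (2 * b ^ 2 + b), ?_⟩
  linear_combination (-2 * a) * he + hi - (a + 4 * b + m + 2) * hM

/-! ### The symbol relation for even x; here x and y stand for the halves. -/

/-- The symbol does not see the sign of the modulus, so m may be replaced by τm ≡ 1 mod 4; s selects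
between 1 - i and 1 + i. -/
theorem quartic_one_sub_sign_mul_gaussI {s τ m : ℤ} (hs : s = 1 ∨ s = -1) (hτ : τ = 1 ∨ τ = -1)
    (h : (τ * m) % 4 = 1) :
    quartic (1 - s * gaussI) m = gaussIPow (-s * ((τ * m - 1) / 4)) := by
  have h1 : Associated (m : GaussianInt) ((τ * m : ℤ) : GaussianInt) := by
    rcases hτ with rfl | rfl
    · simp
    · push_cast
      rw [neg_one_mul]
      exact (Associated.refl _).neg_right
  rw [quartic_of_associated h1]
  rcases hs with rfl | rfl
  · rw [Int.cast_one, one_mul, quartic_one_sub_gaussI h, neg_one_mul]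
  · rw [Int.cast_neg, Int.cast_one, neg_one_mul, sub_neg_eq_add, quartic_one_add_gaussI h, neg_neg, one_mul]

/-- Here A = x + d - ci = x - iπ = gA₁, and A₁ = (1 - νi)B with B = u + vi primary and N(B) = n₁x +
22·4^r·y₂². This relation modulo B replaces the one modulo A₁ of the odd case. Each summand of the
exponent is the cost of one reciprocity or supplementary law; none is simplified yet. -/
theorem quartic_symbol_of_even {p : ℕ} (hp : p.Prime) (hp4 : p % 4 = 1) {c d x y y₀ τ ν : ℤ}
    {r : ℕ} (hcd : (p : ℤ) = c ^ 2 + d ^ 2) (hxy : (p : ℤ) = x ^ 2 + 11 * y ^ 2)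
    (hc : c % 4 = 1) (hy : y = 2 ^ (r + 1) * y₀) (hy₀ : y₀ % 4 = 1)
    (h11 : ¬ ((11 : ℤ) ∣ c ∧ (11 : ℤ) ∣ x + d))
    (hτ : τ = 1 ∨ τ = -1) (hτx : (τ * x) % 4 = 1)
    (hν : ν = 1 ∨ ν = -1) (hνn : (ν * (x + d)) % 4 = 1) :
    ∃ g n₁ c₁ u v : ℤ, g % 4 = 1 ∧ x + d = g ^ 2 * n₁ ∧ c = g * c₁ ∧
      2 * u = g * n₁ + ν * c₁ ∧ 2 * v = ν * (g * n₁) - c₁ ∧ Even v ∧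
    quartic x ⟨c, d⟩ = gaussIPow
      ((x - 1) / 2 * (((p : ℤ) - 1) / 2) + (x ^ 2 - 1) / 4 + -ν * ((τ * x - 1) / 4)
        + (2 * r + 1) * (u * v / 2) + 5 * ((u ^ 2 + v ^ 2 - 1) / 2) + -(-ν * (-3))
        - (u ^ 2 + v ^ 2 - 1) / 2 - (x - 1) / 2 * ((u ^ 2 + v ^ 2 - 1) / 2)
        - (n₁ - 1) / 2 * ((u ^ 2 + v ^ 2 - 1) / 2) - (n₁ ^ 2 - 1) / 4
        + -ν * ((ν * n₁ - 1) / 4) - (r + 1) * (c * d / 2) - (g ^ 2 - 1) / 4) *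
      quartic ⟨x + d, -c⟩ ((11 : ℤ) : GaussianInt) * quartic y ⟨c, d⟩ := by
  have hν2 : ν ^ 2 = 1 := by rcases hν with rfl | rfl <;> norm_num
  have hed : Even d := by
    rcases Int.even_or_odd d with h | h
    · exact h
    · exfalso
      obtain ⟨k, hk⟩ := h
      obtain ⟨j, hj⟩ : ∃ j, c = 4 * j + 1 := ⟨c / 4, by omega⟩
      have : (p : ℤ) = 2 * (8 * j ^ 2 + 4 * j + 2 * k ^ 2 + 2 * k + 1) := by
        rw [hcd, hj, hk]; ring
      omega
  have hoc : Odd c := Int.odd_iff.2 (by omega)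
  have hx : Odd x := by
    rw [Int.odd_iff]
    rcases hτ with rfl | rfl <;> omega
  have hoy₀ : Odd y₀ := Int.odd_iff.2 (by omega)
  have hπ : IsPrimary ⟨c, d⟩ := ⟨hoc, hed⟩
  have hπn : (⟨c, d⟩ : GaussianInt).norm = p := by rw [gaussian_norm_eq, hcd]
  have hccd : IsCoprime c d := isCoprime_of_prime_eq_sq_add_sq hp (k := 1) (by rw [hcd]; ring)
  have hcxy : IsCoprime x y := isCoprime_of_prime_eq_sq_add_sq hp hxy
  have hx11 : IsCoprime x 11 := by
    refine (int_prime_eleven.irreducible.coprime_iff_not_dvd.2 fun h => ?_).symm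
    have h1 : (11 : ℤ) ∣ p := by
      rw [hxy]; exact dvd_add (dvd_pow h two_ne_zero) (dvd_mul_right _ _)
    have h2 : 11 ∣ p := by omega
    have := (Nat.prime_dvd_prime_iff_eq (by norm_num) hp).1 h2
    omega
  have hxyp : IsCoprime x (p : ℤ) ∧ IsCoprime y (p : ℤ) := by
    have h1 : IsCoprime (x * x) (y * (11 * y)) :=
      (IsCoprime.mul_right hcxy (hx11.mul_right hcxy)).mul_left
        (IsCoprime.mul_right hcxy (hx11.mul_right hcxy))
    obtain ⟨h2, -, h3, -⟩ := isCoprime_mul_add (N := p) h1 (by rw [hxy]; ring)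
    exact ⟨h2, h3⟩
  have hxπ : IsCoprime (x : GaussianInt) ⟨c, d⟩ :=
    isCoprime_intCast_of_norm (by rw [hπn]; exact hxyp.1)
  have hyπ : IsCoprime (y : GaussianInt) ⟨c, d⟩ :=
    isCoprime_intCast_of_norm (by rw [hπn]; exact hxyp.2)
  have hon : Odd (x + d) := hx.add_even hed
  have hc0 : c ≠ 0 := by omega
  obtain ⟨g, c₁, n₁, y₁, e1, e2, e3, hcop, hg4⟩ :=
    exists_odd_common_square_factor (w := x - d) (c := c) (n := x + d) (y := y)
      hc0 hon (by linear_combination hcd - hxy) (by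
        intro q hq hqc hqn
        have hqi := Nat.prime_iff_prime_int.1 hq
        have hoq : Odd (q : ℤ) := odd_of_dvd_int hon hqn
        have hq2 : ¬ (q : ℤ) ∣ 2 := fun h => by
          have h1 := (Nat.prime_dvd_prime_iff_eq hq Nat.prime_two).1 (by exact_mod_cast h)
          rw [h1] at hoq; exact absurd hoq (by decide)
        refine ⟨fun h => ?_, fun h => ?_⟩
        · rw [h] at hqc hqn
          exact h11 ⟨hqc, hqn⟩
        · have h1 : (q : ℤ) ∣ 2 * d := by
            have := dvd_sub hqn h
            rwa [show x + d - (x - d) = 2 * d by ring] at this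
          have h2 := (hqi.dvd_or_dvd h1).resolve_left hq2
          exact hqi.not_isUnit (hccd.isUnit_of_dvd' hqc h2))
  have hog : Odd g := Int.odd_iff.2 (by omega)
  have hg0 : g ≠ 0 := by omega
  have h2o : ∀ {m : ℤ}, Odd m → IsCoprime 2 m := fun h => Int.isCoprime_two_left.2 h
  obtain ⟨y₂, ey₂⟩ : g ∣ y₀ := by
    have h1 : g ∣ 2 ^ (r + 1) * y₀ := by rw [← hy, e3]; exact dvd_mul_right _ _
    exact ((h2o hog).symm.pow_right).dvd_of_dvd_mul_left h1
  have ey₁ : y₁ = 2 ^ (r + 1) * y₂ := by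
    apply mul_left_cancel₀ hg0
    rw [← e3, hy, ey₂]; ring
  have hon₁ : Odd n₁ := by
    rw [e2] at hon; exact (Int.odd_mul.1 hon).2
  have hoy₂ : Odd y₂ := by
    rw [ey₂] at hoy₀; exact (Int.odd_mul.1 hoy₀).2
  obtain ⟨j, hj⟩ : ∃ j, g = 4 * j + 1 := ⟨g / 4, by omega⟩
  have hy₂4 : y₂ % 4 = 1 := by
    have h2 : y₀ = y₂ + 4 * (j * y₂) := by rw [ey₂, hj]; ring
    omega
  have hc₁4 : c₁ % 4 = 1 := by
    have h2 : c = c₁ + 4 * (j * c₁) := by rw [e1, hj]; ring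
    omega
  have hgn4 : (ν * (g * n₁)) % 4 = 1 := by
    have h2 : ν * (x + d) = ν * (g * n₁) + 4 * (j * (ν * (g * n₁))) := by rw [e2]; nth_rw 1 [pow_two, hj]; ring
    omega
  have hn₁4 : (ν * n₁) % 4 = 1 := by
    have h2 : ν * (g * n₁) = ν * n₁ + 4 * (j * (ν * n₁)) := by rw [hj]; ring
    omega
  -- The sign ν makes νgn₁ ≡ c₁ ≡ 1 mod 4; hence A₁ = gn₁ - c₁i is divisible by 1 - νi with a
  -- quotient of even imaginary part 2w.
  obtain ⟨w, hw⟩ : ∃ w, ν * (g * n₁) - c₁ = 4 * w := ⟨(ν * (g * n₁) - c₁) / 4, by omega⟩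
  have hgn : g * n₁ = ν * (c₁ + 4 * w) := by linear_combination ν * hw - g * n₁ * hν2
  refine ⟨g, n₁, c₁, ν * (c₁ + 2 * w), 2 * w, hg4, e2, e1, by rw [hgn]; ring, by linear_combination -hw,
    even_two_mul w, ?_⟩
  set u := ν * (c₁ + 2 * w) with hu
  set v := 2 * w with hv
  set ρ : GaussianInt := 1 - ν * gaussI with hρ
  set B : GaussianInt := ⟨u, v⟩ with hB
  set A₁ : GaussianInt := ⟨g * n₁, -c₁⟩ with hA₁
  have hou : Odd u := by
    rw [hu]
    have : Odd ν := by rcases hν with rfl | rfl <;> decide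
    exact this.mul ((Int.odd_iff.2 (by omega : c₁ % 2 = 1)).add_even (even_two_mul w))
  have hBp : IsPrimary B := ⟨hou, even_two_mul w⟩
  have hBn' : B.norm = u ^ 2 + v ^ 2 := by rw [gaussian_norm_eq]
  have hBeq : B = u + v * gaussI := gaussian_eq B
  have hA₁eq : A₁ = ((g * n₁ : ℤ) : GaussianInt) + ((-c₁ : ℤ) : GaussianInt) * gaussI :=
    gaussian_eq A₁
  have hν2' : (ν : GaussianInt) ^ 2 = 1 := by exact_mod_cast hν2
  have hρB : A₁ = ρ * B := by
    rw [hA₁eq, hBeq, hρ, hgn, hu, hv]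
    push_cast
    linear_combination (2 * w * ν) * gaussI_sq + (c₁ + 2 * w) * gaussI * hν2'
  have hBn : B.norm = n₁ * x + (11 * y₂) * (2 * (2 ^ r * 2 ^ r * y₂)) := by
    rw [hBn']
    have h1 : (x + d) ^ 2 + c ^ 2 = 2 * x * (x + d) + 11 * y ^ 2 := by
      linear_combination -hcd + hxy
    rw [e2, e3, e1] at h1
    have h2 : (g * n₁) ^ 2 + c₁ ^ 2 = 2 * x * n₁ + 11 * y₁ ^ 2 := by
      apply mul_left_cancel₀ (pow_ne_zero 2 hg0)
      linear_combination h1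
    rw [hgn, ey₁] at h2
    rw [hu, hv]
    refine mul_left_cancel₀ (two_ne_zero (α := ℤ)) ?_
    rw [pow_succ] at h2
    linear_combination h2 + (2 * (c₁ + 2 * w) ^ 2 - (c₁ + 4 * w) ^ 2) * hν2
  have hyn : IsCoprime n₁ (11 * y₂) ∧ IsCoprime n₁ y₂ := by
    have h1 : 11 * y₁ * y₁ = c₁ ^ 2 + n₁ * -(x - d) := by
      apply mul_left_cancel₀ (pow_ne_zero 2 hg0)
      have h2 : 11 * y ^ 2 = c ^ 2 - (x - d) * (x + d) := by
        linear_combination hcd - hxy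
      rw [e2, e1, e3] at h2
      linear_combination h2
    have h2 : IsCoprime n₁ (c₁ ^ 2 + n₁ * -(x - d)) :=
      (hcop.symm.pow_right).add_mul_left_right _
    rw [← h1, ey₁] at h2
    have h3 := h2.of_mul_right_right.of_mul_right_right
    exact ⟨h2.of_mul_right_left.of_mul_right_left.mul_right h3, h3⟩
  have hxy₂ : IsCoprime x y₂ := by
    rw [e3, ey₁] at hcxy; exact hcxy.of_mul_right_right.of_mul_right_right
  have hxg : IsCoprime x g := by rw [e3] at hcxy; exact hcxy.of_mul_right_left
  have hdg : IsCoprime d g := by rw [e1] at hccd; exact hccd.of_mul_left_left.symm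
  have hg11 : IsCoprime g 11 := by
    refine (int_prime_eleven.irreducible.coprime_iff_not_dvd.2 fun h => h11 ⟨?_, ?_⟩).symm
    · rw [e1]; exact h.mul_right _
    · rw [e2, pow_two, mul_assoc]; exact h.mul_right _
  have hbig : IsCoprime (n₁ * x) ((11 * y₂) * (2 * (2 ^ r * 2 ^ r * y₂))) := by
    have h2 : IsCoprime (n₁ * x) 2 := (h2o (hon₁.mul hx)).symm
    have h3 : IsCoprime (n₁ * x) y₂ := hyn.2.mul_left hxy₂
    exact (hyn.1.mul_left (hx11.mul_right hxy₂)).mul_right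
      (h2.mul_right ((h2.pow_right.mul_right h2.pow_right).mul_right h3))
  obtain ⟨hNn, hNx, hN3, -⟩ := isCoprime_mul_add hbig hBn
  have cop : ∀ {m : ℤ}, IsCoprime m B.norm → IsCoprime (m : GaussianInt) B :=
    fun h => isCoprime_intCast_of_norm h
  have hBo := hBp.odd_norm
  have c2 : IsCoprime (2 : GaussianInt) B := isCoprime_two_of_odd_norm hBo
  have cn := cop hNn
  have cx := cop hNx
  have c11 := cop hN3.of_mul_left_left
  have cy := cop hN3.of_mul_left_right
  have hρo : ∀ {m : ℤ}, Odd m → IsCoprime ρ (m : GaussianInt) := by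
    intro m hm
    have := isCoprime_two_of_odd_norm (odd_norm_intCast hm)
    apply this.of_isCoprime_of_dvd_left
    exact ⟨1 + ν * gaussI, by rw [hρ]; linear_combination gaussI_sq * ν ^ 2 - hν2'⟩
  have sI : ∀ {m : ℤ}, Odd m → quartic gaussI m = gaussIPow ((m ^ 2 - 1) / 4) := by
    intro m hm
    rw [quartic_gaussI (odd_norm_intCast hm), norm_intCast_gaussian]
  have sIq : ∀ {m k : ℤ}, Odd m → IsCoprime k m →
      quartic ((k : GaussianInt) * gaussI) m = quartic gaussI m := by
    intro m k hm hk
    rw [quartic_mul_left (odd_norm_intCast hm) (isCoprime_intCast_gaussian hk)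
      (isCoprime_gaussI _), quartic_intCast_intCast hm (isCoprime_intCast_gaussian hk), one_mul]
  set π' : GaussianInt := ⟨d, -c⟩ with hπ'
  have hπ'eq : π' = d - c * gaussI := by
    have := gaussian_eq π'
    rw [this, hπ']; push_cast; ring
  have hππ' : (⟨c, d⟩ : GaussianInt) = gaussI * π' := by
    have : (⟨c, d⟩ : GaussianInt) = c + d * gaussI := gaussian_eq _
    rw [this, hπ'eq]; linear_combination c * gaussI_sq
  have hAA : (⟨x + d, -c⟩ : GaussianInt) = g * A₁ := by
    rw [hA₁, e2, e1]; ext <;> simp; ring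
  have hAπ : (⟨x + d, -c⟩ : GaussianInt) = x + π' := by
    rw [hπ']; ext <;> simp
  have hπy₂ : IsCoprime (⟨c, d⟩ : GaussianInt) y₂ := by
    rw [e3, ey₁] at hyπ; push_cast at hyπ; exact hyπ.of_mul_left_right.of_mul_left_right.symm
  have hy₀π : IsCoprime (y₀ : GaussianInt) ⟨c, d⟩ := by
    rw [hy] at hyπ; push_cast at hyπ; exact hyπ.of_mul_left_right
  have h2π : IsCoprime (2 : GaussianInt) ⟨c, d⟩ := isCoprime_two_of_odd_norm hπ.odd_norm
  have sy₀ : quartic y₀ ⟨c, d⟩ = gaussIPow ((g ^ 2 - 1) / 4) * quartic ⟨c, d⟩ y₂ := by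
    rw [quartic_reciprocity hπ hy₀ hy₀π, ey₂, Int.cast_mul, quartic_mul_right
      (by exact_mod_cast hg0) (ne_zero_of_odd_norm (odd_norm_intCast hoy₂)),
      quartic_congr (a := (g : GaussianInt)) (b' := (d : GaussianInt) * gaussI)
        ⟨c₁, by rw [hππ', hπ'eq, e1]; push_cast; linear_combination (-g * c₁) * gaussI_sq⟩,
      sIq hog hdg, sI hog]
  have sy : quartic y ⟨c, d⟩ = gaussIPow ((r + 1) * (c * d / 2)) * quartic y₀ ⟨c, d⟩ := by
    rw [hy]
    push_cast
    rw [quartic_mul_left hπ.odd_norm h2π.pow_left hy₀π, quartic_pow_left hπ.odd_norm h2π,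
      quartic_two hπ, gaussIPow_pow]
    congr 2
    push_cast
    ring
  have hπ'co : ∀ {m : ℤ}, IsCoprime (⟨c, d⟩ : GaussianInt) m → IsCoprime π' m := by
    intro m h
    rw [hππ'] at h
    exact h.of_mul_left_right
  have sx : quartic ⟨c, d⟩ x = gaussIPow ((x ^ 2 - 1) / 4 + -ν * ((τ * x - 1) / 4)) * quartic B x := by
    have hox := odd_norm_intCast hx
    have h1 : quartic π' x = quartic (g * A₁) x := by
      apply quartic_congr
      rw [← hAA, hAπ]
      exact ⟨-1, by ring⟩
    rw [hππ', quartic_mul_left hox (isCoprime_gaussI _) (hπ'co hxπ.symm), h1, hρB,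
      quartic_mul_left hox (isCoprime_intCast_gaussian hxg.symm) ((hρo hx).mul_left cx.symm),
      quartic_intCast_intCast hx (isCoprime_intCast_gaussian hxg.symm), one_mul,
      quartic_mul_left hox (hρo hx) cx.symm, sI hx,
      quartic_one_sub_sign_mul_gaussI hν hτ hτx, gaussIPow_add, mul_assoc]
  have sn : quartic B n₁ = gaussIPow ((n₁ ^ 2 - 1) / 4 - -ν * ((ν * n₁ - 1) / 4)) := by
    apply mul_left_cancel₀ (gaussIPow_ne_zero (-ν * ((ν * n₁ - 1) / 4)))
    rw [← gaussIPow_add, ← quartic_one_sub_sign_mul_gaussI hν hν hn₁4,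
      ← quartic_mul_left (odd_norm_intCast hon₁) (hρo hon₁) cn.symm, ← hρB,
      quartic_congr (b' := ((-c₁ : ℤ) : GaussianInt) * gaussI)
        ⟨g, by rw [hA₁eq]; push_cast; ring⟩, sIq hon₁ hcop.neg_left, sI hon₁]
    congr 1
    ring
  -- The law for 1 - νi is applied to -11 ≡ 1 mod 4, whence -3 = (-11-1)/4.
  have s11 : quartic B ((11 : ℤ) : GaussianInt) =
      gaussIPow (-(-ν * (-3))) * quartic ⟨x + d, -c⟩ ((11 : ℤ) : GaussianInt) := by
    have ho11 : Odd (11 : ℤ) := by decide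
    apply mul_left_cancel₀ (gaussIPow_ne_zero (-ν * (-3)))
    have h1 := quartic_one_sub_sign_mul_gaussI (m := 11) hν (Or.inr rfl : (-1 : ℤ) = 1 ∨ (-1 : ℤ) = -1)
      (by norm_num)
    norm_num at h1
    rw [← mul_assoc, ← gaussIPow_add, add_neg_cancel, gaussIPow_zero, one_mul, hAA,
      quartic_mul_left (odd_norm_intCast ho11) (isCoprime_intCast_gaussian hg11)
        (hρB ▸ (hρo ho11).mul_left c11.symm),
      quartic_intCast_intCast ho11 (isCoprime_intCast_gaussian hg11), one_mul, hρB,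
      quartic_mul_left (odd_norm_intCast ho11) (hρo ho11) c11.symm]
    congr 1
    rw [hρ]
    push_cast
    rw [h1]
    congr 1
    ring
  have sy₂ : quartic y₂ B ^ 2 = quartic ⟨c, d⟩ y₂ := by
    have hoy' := odd_norm_intCast hoy₂
    have h2n : IsCoprime (((2 * n₁ : ℤ)) : GaussianInt) y₂ :=
      isCoprime_intCast_gaussian ((h2o hoy₂).mul_left hyn.2)
    have hρ2 : ρ ^ 2 = ((-2 * ν : ℤ) : GaussianInt) * gaussI := by
      rw [hρ]; push_cast
      linear_combination gaussI_sq * ν ^ 2 - hν2'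
    have hν2c : IsCoprime (-2 * ν) y₂ := by
      have h1 : IsCoprime (-2) y₂ := (h2o hoy₂).neg_left
      have h2 : IsCoprime ν y₂ := by
        rcases hν with rfl | rfl
        · exact isCoprime_one_left
        · exact isCoprime_one_left.neg_left
      exact h1.mul_left h2
    have h1 : 2 * (π' * n₁) = A₁ ^ 2 + 11 * y₁ ^ 2 := by
      have hg0' : (g : GaussianInt) ≠ 0 := by exact_mod_cast hg0
      apply mul_left_cancel₀ (pow_ne_zero 2 hg0')
      have h2 : 2 * (π' * ((x + d : ℤ) : GaussianInt)) =
          (⟨x + d, -c⟩ : GaussianInt) ^ 2 + 11 * (y : GaussianInt) ^ 2 := by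
        have h3 : (c ^ 2 + d ^ 2 : ℤ) = x ^ 2 + 11 * y ^ 2 := by rw [← hcd, hxy]
        have h4 : ((c ^ 2 + d ^ 2 : ℤ) : GaussianInt) = ((x ^ 2 + 11 * y ^ 2 : ℤ) : GaussianInt) := by
          rw [h3]
        push_cast at h4
        rw [hAπ, hπ'eq]
        push_cast
        linear_combination h4 - c ^ 2 * gaussI_sq
      rw [hAA, e2, e3] at h2
      push_cast at h2
      linear_combination h2
    have h5 : quartic gaussI y₂ ^ 2 = 1 := by
      rw [← quartic_pow_left hoy' (isCoprime_gaussI _), gaussI_sq]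
      have := quartic_intCast_intCast (m := -1) hoy₂ (by
        push_cast; exact isCoprime_neg_one _)
      push_cast at this
      exact this
    have h6 : quartic gaussI y₂ * quartic B y₂ ^ 2 = quartic π' y₂ := by
      rw [← sIq hoy₂ hν2c, ← hρ2, ← quartic_pow_left hoy' cy.symm,
        ← quartic_mul_left hoy' (hρo hoy₂).pow_left cy.symm.pow_left, ← mul_pow, ← hρB,
        quartic_congr (b' := ((2 * n₁ : ℤ) : GaussianInt) * π')
        ⟨-(11 * 2 ^ (r + 1) * y₁), by
          have : (y₁ : GaussianInt) = 2 ^ (r + 1) * y₂ := by rw [ey₁]; push_cast; ring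
          push_cast
          linear_combination -h1 - 11 * y₁ * this⟩,
        quartic_mul_left hoy' h2n (hπ'co hπy₂), quartic_intCast_intCast hoy₂ h2n, one_mul]
    rw [quartic_reciprocity hBp hy₂4 cy, hππ', quartic_mul_left hoy' (isCoprime_gaussI _)
      (hπ'co hπy₂), ← h6, ← mul_assoc, ← pow_two, h5, one_mul]
  -- The power 4^r of N(B) is written (2^r)², so its symbol is a square.
  have main : quartic (-1) B * quartic n₁ B * quartic x B =
      quartic 2 B * quartic (11 : ℤ) B * (quartic 2 B ^ r) ^ 2 * quartic y₂ B ^ 2 := by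
    have c1 := isCoprime_neg_one B
    have c2r : IsCoprime ((2 : GaussianInt) ^ r) B := c2.pow_left
    rw [← quartic_pow_left hBo c2, ← quartic_pow_left hBo c2r, ← quartic_pow_left hBo cy,
      ← quartic_mul_left hBo c1 cn, ← quartic_mul_left hBo (c1.mul_left cn) cx,
      ← quartic_mul_left hBo c2 c11, ← quartic_mul_left hBo (c2.mul_left c11) c2r.pow_left,
      ← quartic_mul_left hBo ((c2.mul_left c11).mul_left c2r.pow_left) cy.pow_left]
    apply quartic_congr
    refine ⟨-star B, ?_⟩
    rw [mul_neg, ← gaussian_norm_cast, hBn]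
    push_cast
    ring
  rw [quartic_neg_one hBo, quartic_reciprocity_odd hBp hon₁ cn, quartic_reciprocity_odd hBp hx cx,
    quartic_reciprocity_odd hBp (by decide) c11, quartic_two hBp, sn, s11, sy₂, hBn',
    gaussIPow_pow, gaussIPow_pow] at main
  rw [quartic_reciprocity_odd hπ hx hxπ, hπn, sx, sy, sy₀]
  set N := u ^ 2 + v ^ 2 with hN
  have e5 : ((11 : ℤ) - 1) / 2 = 5 := by norm_num
  rw [e5] at main
  set T := quartic ⟨x + d, -c⟩ ((11 : ℤ) : GaussianInt)
  set P := quartic ⟨c, d⟩ (y₂ : GaussianInt)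
  set X := quartic B (x : GaussianInt)
  set an := -ν * ((ν * n₁ - 1) / 4)
  set ax := -ν * ((τ * x - 1) / 4)
  have m2 : gaussIPow ((N - 1) / 2 + (n₁ - 1) / 2 * ((N - 1) / 2) + ((n₁ ^ 2 - 1) / 4 - an)
      + (x - 1) / 2 * ((N - 1) / 2)) * X =
      gaussIPow (u * v / 2 + 5 * ((N - 1) / 2) + -(-ν * (-3)) + u * v / 2 * r * (2 : ℕ)) * (T * P) := by
    simp only [gaussIPow_add]
    linear_combination main
  apply mul_left_cancel₀ (gaussIPow_ne_zero ((N - 1) / 2 + (n₁ - 1) / 2 * ((N - 1) / 2)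
    + ((n₁ ^ 2 - 1) / 4 - an) + (x - 1) / 2 * ((N - 1) / 2)))
  have e6 : ∀ (k₀ k a b : ℤ) (t q : GaussianInt), gaussIPow k₀ * (gaussIPow k * t *
      (gaussIPow a * (gaussIPow b * q))) = gaussIPow (k₀ + k + a + b) * (t * q) := by
    intro k₀ k a b t q
    simp only [gaussIPow_add]
    ring
  have e7 : ∀ (k₀ k j : ℤ) (q : GaussianInt), gaussIPow k₀ * (gaussIPow k * (gaussIPow j * q)) =
      gaussIPow (k + j) * (gaussIPow k₀ * q) := by
    intro k₀ k j q
    simp only [gaussIPow_add]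
    ring
  rw [e7, m2, e6, ← mul_assoc, ← gaussIPow_add]
  congr 2
  push_cast
  ring

/-- The exponent bookkeeping for p ≡ 1 mod 8. The letters G, a, b, j, m stand for (g-1)/4, (c₁-1)/4,
(c-1)/4, (νx-1)/4, (νn₁-1)/4, and w, Y, δ for v/2, y/4, d/4; the other capitals are the quotients in
the exponent of `quartic_symbol_of_even`. -/
theorem zmod_four_exponent_of_one {G m a b j r Y δ ν E F P X₂ U N N₂ D G₂ w : ZMod 4}
    (hν : ν = 1 ∨ ν = -1) (hE : 2 * E = 1 - ν) (hF : 2 * F = 1 - ν) (hP : P = 0)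
    (hX : X₂ = 2 * j) (hU : U = ν * (w * (2 * w + 1))) (hN : N = 2 * w) (hN₂ : N₂ = 2 * m)
    (hD : D = ν * (2 * (m - j))) (hG : G₂ = 2 * G) (hw : w = G + m - a) (hb : b = G + a)
    (hbj : b = j + 2 * Y + 2 * δ) (hδ : 2 * δ = 2 * (m - j)) :
    E * P + X₂ + -ν * j + (2 * r + 1) * U + 5 * N + -(-ν * (-3)) - N - E * N - F * N - N₂
      + -ν * m - (r + 1) * D - G₂ = ν + 2 * j + 2 * Y := by
  have hw' : w = j - m + 2 * G + 2 * Y := by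
    have h4 : (4 : ZMod 4) = 0 := by decide
    linear_combination hw + hb - hbj - hδ - Y * h4
  -- After elimination of a, b and δ only six free residues modulo 4 remain, a finite check.
  have key : ∀ G m j r Y ν : ZMod 4, (ν = 1 ∨ ν = -1) → ∀ w, w = j - m + 2 * G + 2 * Y →
      2 * j - ν * j + (2 * r + 1) * (ν * (w * (2 * w + 1))) + 5 * (2 * w) - 3 * ν - 2 * w -
        2 * ((1 - ν) * w) - 2 * m - ν * m - (r + 1) * (ν * (2 * (m - j))) - 2 * G
      = ν + 2 * j + 2 * Y := by decide
  rw [← key G m j r Y ν hν w hw']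
  subst hP hX hU hN hN₂ hD hG
  linear_combination -w * hE - w * hF

/-- The case p ≡ 5 mod 8, where r = 0 and x has sign -ν, so j stands for (-νx-1)/4; (p-1)/2 ≡ 2 mod
4 keeps the reciprocity sign of x alive. -/
theorem zmod_four_exponent_of_five {G m a b j ν E F P X₂ U N N₂ D G₂ w : ZMod 4}
    (hν : ν = 1 ∨ ν = -1) (hE : 2 * E = 1 + ν) (hF : 2 * F = 1 - ν) (hP : P = 2)
    (hX : X₂ = 2 * j) (hU : U = ν * (w * (2 * w + 1))) (hN : N = 2 * w) (hN₂ : N₂ = 2 * m)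
    (hD : D = ν * (2 * (m + j) + 1)) (hG : G₂ = 2 * G) (hw : w = G + m - a) (hb : b = G + a)
    (hbj : b = j - 1) :
    E * P + X₂ + -ν * j + (2 * 0 + 1) * U + 5 * N + -(-ν * (-3)) - N - E * N - F * N - N₂
      + -ν * m - (0 + 1) * D - G₂ = 3 + 2 * j := by
  have hw' : w = m + 2 * G - j + 1 := by
    linear_combination hw + hb - hbj
  have key : ∀ G m j ν : ZMod 4, (ν = 1 ∨ ν = -1) → ∀ w, w = m + 2 * G - j + 1 →
      (1 + ν) + 2 * j - ν * j + ν * (w * (2 * w + 1)) + 5 * (2 * w) - 3 * ν - 2 * w -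
        (1 + ν) * w - (1 - ν) * w - 2 * m - ν * m - ν * (2 * (m + j) + 1) - 2 * G
      = 3 + 2 * j := by decide
  rw [← key G m j ν hν w hw']
  subst hP hX hU hN hN₂ hD hG
  linear_combination hE - w * hE - w * hF

/-- Rewrites the integer quotients in the exponent as polynomials in residues modulo 4. F is kept
abstract: it is (n₁-1)/2, and only 2F matters since it multiplies 2w. -/
theorem quartic_symbol_of_even_zmod {p : ℕ} (hp : p.Prime) (hp4 : p % 4 = 1) {c d x y y₀ τ ν j : ℤ}
    {r : ℕ} (hcd : (p : ℤ) = c ^ 2 + d ^ 2) (hxy : (p : ℤ) = x ^ 2 + 11 * y ^ 2)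
    (hc : c % 4 = 1) (hy : y = 2 ^ (r + 1) * y₀) (hy₀ : y₀ % 4 = 1)
    (h11 : ¬ ((11 : ℤ) ∣ c ∧ (11 : ℤ) ∣ x + d))
    (hτ : τ = 1 ∨ τ = -1) (hj : τ * x = 4 * j + 1)
    (hν : ν = 1 ∨ ν = -1) (hνn : (ν * (x + d)) % 4 = 1) :
    ∃ G m a K : ℤ, x + d = (4 * G + 1) ^ 2 * (ν * (4 * m + 1)) ∧
      c = (4 * G + 1) * (4 * a + 1) ∧
      quartic x ⟨c, d⟩ = gaussIPow K * quartic ⟨x + d, -c⟩ ((11 : ℤ) : GaussianInt) *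
        quartic y ⟨c, d⟩ ∧
      ∃ F w : ZMod 4, 2 * F = 1 - ν ∧ w = G + m - a ∧
        (K : ZMod 4) = (((x - 1) / 2 : ℤ) : ZMod 4) * ((((p : ℤ) - 1) / 2 : ℤ) : ZMod 4) + 2 * j
          + -ν * j + (2 * r + 1) * (ν * (w * (2 * w + 1))) + 5 * (2 * w) + -(-ν * (-3)) - 2 * w
          - (((x - 1) / 2 : ℤ) : ZMod 4) * (2 * w) - F * (2 * w) - 2 * m + -ν * m
          - (r + 1) * ((c * d / 2 : ℤ) : ZMod 4) - 2 * G := by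
  have h4 : (4 : ZMod 4) = 0 := by decide
  obtain ⟨b, hb⟩ : ∃ b, c = 4 * b + 1 := ⟨c / 4, by omega⟩
  have hν2 : ν * ν = 1 := by rcases hν with rfl | rfl <;> norm_num
  have hτ2 : τ * τ = 1 := by rcases hτ with rfl | rfl <;> norm_num
  obtain ⟨g, n₁, c₁, u, v, hg, hn, hcg, hu, hv, hve, hK⟩ :=
    quartic_symbol_of_even hp hp4 hcd hxy hc hy hy₀ h11 hτ (by omega) hν hνn
  obtain ⟨w, hw⟩ := hve
  obtain ⟨G, hG⟩ : ∃ G, g = 4 * G + 1 := ⟨g / 4, by omega⟩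
  obtain ⟨a, ha⟩ : ∃ a, c₁ = 4 * a + 1 := by
    refine ⟨c₁ / 4, ?_⟩
    have : 4 * b + 1 = 4 * (G * c₁) + c₁ := by rw [← hb, hcg, hG]; ring
    omega
  obtain ⟨m, hm⟩ : ∃ m, ν * n₁ = 4 * m + 1 := by
    refine ⟨ν * n₁ / 4, ?_⟩
    have : ν * (x + d) = 4 * ((4 * G ^ 2 + 2 * G) * (ν * n₁)) + ν * n₁ := by
      rw [hn, hG]; ring
    omega
  have hx' : x = τ * (4 * j + 1) := by rw [← hj, ← mul_assoc, hτ2, one_mul]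
  have hn' : n₁ = ν * (4 * m + 1) := by rw [← hm, ← mul_assoc, hν2, one_mul]
  have hw' : w = 4 * (G * m) + G + m - a := by
    have : 2 * v = g * (ν * n₁) - c₁ := by rw [hv]; ring
    rw [hm, hG, ha] at this
    linarith
  have hu' : u = ν * (2 * w + 4 * a + 1) := by
    have : 2 * u = ν * (g * (ν * n₁)) + ν * c₁ := by
      rw [hu, show ν * (g * (ν * n₁)) = (ν * ν) * (g * n₁) by ring, hν2, one_mul]
    rw [hm, hG, ha] at this
    rw [hw']
    linarith
  have hv2 : v = 2 * w := by omega
  have hN : (u ^ 2 + v ^ 2 - 1) / 2 = 4 * (w ^ 2 + 2 * w * a + 2 * a ^ 2 + a) + 2 * w := by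
    have : u ^ 2 + v ^ 2 - 1 = 2 * (4 * (w ^ 2 + 2 * w * a + 2 * a ^ 2 + a) + 2 * w) := by
      rw [hu', hv2]; linear_combination (2 * w + 4 * a + 1) ^ 2 * hν2
    omega
  have hU : u * v / 2 = ν * (w * (2 * w + 4 * a + 1)) := by
    have : u * v = 2 * (ν * (w * (2 * w + 4 * a + 1))) := by rw [hu', hv2]; ring
    omega
  have hX : (x ^ 2 - 1) / 4 = 4 * j ^ 2 + 2 * j := by
    have : x ^ 2 - 1 = 4 * (4 * j ^ 2 + 2 * j) := by
      rw [hx']; linear_combination (4 * j + 1) ^ 2 * hτ2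
    omega
  have hN₂ : (n₁ ^ 2 - 1) / 4 = 4 * m ^ 2 + 2 * m := by
    have : n₁ ^ 2 - 1 = 4 * (4 * m ^ 2 + 2 * m) := by
      rw [hn']; linear_combination (4 * m + 1) ^ 2 * hν2
    omega
  have hG₂ : (g ^ 2 - 1) / 4 = 4 * G ^ 2 + 2 * G := by
    have : g ^ 2 - 1 = 4 * (4 * G ^ 2 + 2 * G) := by rw [hG]; ring
    omega
  have hF : 2 * (((n₁ - 1) / 2 : ℤ) : ZMod 4) = 1 - ν := by
    rcases hν with rfl | rfl
    · have : (n₁ - 1) / 2 = 2 * m := by omega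
      rw [this]; push_cast; linear_combination (m : ZMod 4) * h4
    · have : (n₁ - 1) / 2 = -2 * m - 1 := by omega
      rw [this]; push_cast; linear_combination -((m : ZMod 4) + 1) * h4
  have hj4 : (τ * x - 1) / 4 = j := by omega
  have hm4 : (ν * n₁ - 1) / 4 = m := by omega
  refine ⟨G, m, a, _, by rw [hn, hG, hn'], by rw [hcg, hG, ha], hK, ((n₁ - 1) / 2 : ℤ), w, hF,
    by rw [hw']; push_cast; rw [h4]; ring, ?_⟩
  rw [hN, hU, hX, hN₂, hG₂, hj4, hm4]
  push_cast
  rw [h4]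
  ring

theorem quartic_symbol_of_even_of_one {p : ℕ} (hp : p.Prime) (hp8 : p % 8 = 1) {c d x y y₀ : ℤ}
    {r : ℕ} (hcd : (p : ℤ) = c ^ 2 + d ^ 2) (hxy : (p : ℤ) = x ^ 2 + 11 * y ^ 2)
    (hc : c % 4 = 1) (hy : y = 2 ^ (r + 1) * y₀) (hy₀ : y₀ % 4 = 1)
    (h11 : ¬ ((11 : ℤ) ∣ c ∧ (11 : ℤ) ∣ x + d)) :
    quartic x ⟨c, d⟩ = gaussIPow (1 + 2 * (x / 4 + y / 4)) *
      quartic ⟨x + d, -c⟩ ((11 : ℤ) : GaussianInt) * quartic y ⟨c, d⟩ := by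
  have h4 : (4 : ZMod 4) = 0 := by decide
  obtain ⟨b, hb⟩ : ∃ b, c = 4 * b + 1 := ⟨c / 4, by omega⟩
  have hy2 : Even y := by rw [hy, pow_succ]; exact ⟨2 ^ r * y₀, by ring⟩
  obtain ⟨y₁, hy₁⟩ := hy2
  obtain ⟨q, hq⟩ : ∃ q : ℤ, (p : ℤ) = 8 * q + 1 := ⟨p / 8, by omega⟩
  have hd : ∃ δ, d = 4 * δ := by
    have h1 : Even d := by
      rw [← Int.not_odd_iff_even]
      rintro ⟨k, hk⟩
      have : 8 * q + 1 = (4 * b + 1) ^ 2 + (2 * k + 1) ^ 2 := by rw [← hb, ← hk, ← hcd, hq]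
      have : 8 * q + 1 = 2 * (8 * b ^ 2 + 4 * b + 2 * k ^ 2 + 2 * k + 1) := by linarith
      omega
    obtain ⟨e, he⟩ := h1
    have h2 : Even e := by
      rw [← Int.not_odd_iff_even]
      rintro ⟨k, hk⟩
      have : 8 * q + 1 = (4 * b + 1) ^ 2 + (2 * (2 * k + 1)) ^ 2 := by
        rw [← hb, ← hk, ← two_mul] at *; rw [← he, ← hcd, hq]
      have : 8 * q = 8 * (2 * b ^ 2 + b + 2 * k ^ 2 + 2 * k) + 4 := by linarith
      omega
    obtain ⟨k, hk⟩ := h2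
    exact ⟨k, by omega⟩
  obtain ⟨δ, hδ⟩ := hd
  have hxo : Odd x := by
    rw [← Int.not_even_iff_odd]
    rintro ⟨k, hk⟩
    have : 8 * q + 1 = 2 * (2 * k ^ 2 + 22 * y₁ ^ 2) := by rw [← hq, hxy, hk, hy₁]; ring
    omega
  have hYd : ∃ Y, y = 4 * Y := by
    have h2 : Even y₁ := by
      rw [← Int.not_odd_iff_even]
      rintro ⟨k, hk⟩
      obtain ⟨l, hl⟩ := hxo
      have : 8 * q + 1 = 4 * (l ^ 2 + l) + 1 + 44 * (4 * (k ^ 2 + k) + 1) := by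
        rw [← hq, hxy, hl, hy₁, hk]; ring
      have h3 := Int.even_mul_succ_self l
      have h5 : l * (l + 1) = l ^ 2 + l := by ring
      rw [h5] at h3
      obtain ⟨s, hs⟩ := h3
      omega
    obtain ⟨k, hk⟩ := h2
    exact ⟨k, by omega⟩
  obtain ⟨Y, hY⟩ := hYd
  obtain ⟨ν, hν, j, hj⟩ : ∃ ν : ℤ, (ν = 1 ∨ ν = -1) ∧ ∃ j, ν * x = 4 * j + 1 := by
    obtain ⟨l, hl⟩ := hxo
    rcases Int.even_or_odd l with ⟨s, hs⟩ | ⟨s, hs⟩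
    · exact ⟨1, Or.inl rfl, s, by omega⟩
    · exact ⟨-1, Or.inr rfl, -s - 1, by omega⟩
  have hν2 : ν * ν = 1 := by rcases hν with rfl | rfl <;> norm_num
  have hνn : (ν * (x + d)) % 4 = 1 := by
    have : ν * (x + d) = 4 * (j + ν * δ) + 1 := by rw [mul_add, hj, hδ]; ring
    omega
  obtain ⟨G, m, a, K, hn, hcg, hK, F, w, hF, hw, hKz⟩ :=
    quartic_symbol_of_even_zmod hp (by omega) hcd hxy hc hy hy₀ h11 hν hj hν hνn
  rw [hK]
  congr 2
  apply gaussIPow_congr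
  apply (ZMod.intCast_eq_intCast_iff _ _ 4).1
  have hx' : x = ν * (4 * j + 1) := by rw [← hj, ← mul_assoc, hν2, one_mul]
  have hb' : b = 4 * (G * a) + G + a := by
    rw [hb] at hcg
    linarith
  have hδ' : δ = ν * (2 * ((2 * G ^ 2 + G) * (4 * m + 1)) + m - j) := by
    rw [hδ, hx'] at hn
    linarith
  have hD : c * d / 2 = (4 * b + 1) * (2 * δ) := by
    have : c * d = 2 * ((4 * b + 1) * (2 * δ)) := by rw [hb, hδ]; ring
    omega
  -- The equation c² + d² = x² + 11y² divided by 8; it determines b modulo 4.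
  have hbj : (b - j) * (1 + 2 * (b + j)) = 2 * (11 * Y ^ 2 - δ ^ 2) := by
    have : c ^ 2 + d ^ 2 = x ^ 2 + 11 * y ^ 2 := by rw [← hcd, hxy]
    rw [hb, hδ, hx', hY] at this
    linarith [show (ν * (4 * j + 1)) ^ 2 = (4 * j + 1) ^ 2 by
      linear_combination (4 * j + 1) ^ 2 * hν2]
  have hP : ((p : ℤ) - 1) / 2 = 4 * q := by omega
  have hY4 : y / 4 = Y := by omega
  have hzν : (ν : ZMod 4) = 1 ∨ (ν : ZMod 4) = -1 := by
    rcases hν with rfl | rfl <;> simp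
  have hE : 2 * (((x - 1) / 2 : ℤ) : ZMod 4) = 1 - ν := by
    rcases hν with rfl | rfl
    · have : (x - 1) / 2 = 2 * j := by omega
      rw [this]; push_cast; linear_combination (j : ZMod 4) * h4
    · have : (x - 1) / 2 = -2 * j - 1 := by omega
      rw [this]; push_cast; linear_combination -((j : ZMod 4) + 1) * h4
  have hxq : 1 + 2 * ((x / 4 : ℤ) : ZMod 4) = ν + 2 * j := by
    rcases hν with rfl | rfl
    · have : x / 4 = j := by omega
      rw [this]; push_cast; ring
    · have : x / 4 = -j - 1 := by omega
      rw [this]; push_cast; linear_combination -(j : ZMod 4) * h4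
  have zbj : (b : ZMod 4) = j + 2 * Y + 2 * δ := by
    have h := congrArg (Int.cast : ℤ → ZMod 4) hbj
    push_cast at h
    have key : ∀ b j Y δ : ZMod 4, (b - j) * (1 + 2 * (b + j)) = 2 * (11 * Y ^ 2 - δ ^ 2) →
      b = j + 2 * Y + 2 * δ := by decide
    exact key _ _ _ _ h
  have zδ : 2 * (δ : ZMod 4) = 2 * (m - j) := by
    rw [hδ']
    push_cast
    rcases hzν with h | h
    · rw [h]; linear_combination ((2 * G ^ 2 + G) * (4 * m + 1)) * h4
    · rw [h]; linear_combination (-(2 * G ^ 2 + G) * (4 * m + 1) - m + j) * h4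
  have zD : (4 * (b : ZMod 4) + 1) * (2 * δ) = ν * (2 * (m - j)) := by
    rw [← zδ]
    rcases hzν with h | h
    · rw [h]; linear_combination (2 * b * δ) * h4
    · rw [h]; linear_combination (2 * b * δ + δ) * h4
  rw [hKz, hY4, zmod_four_exponent_of_one hzν hE hF (by rw [hP]; push_cast; rw [h4, zero_mul]) rfl
    rfl rfl rfl (by rw [hD]; push_cast; exact zD) rfl hw (by rw [hb']; push_cast; rw [h4]; ring)
    zbj zδ]
  push_cast
  linear_combination -hxq

theorem quartic_symbol_of_even_of_five {p : ℕ} (hp : p.Prime) (hp8 : p % 8 = 5) {c d x y y₀ : ℤ}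
    {r : ℕ} (hcd : (p : ℤ) = c ^ 2 + d ^ 2) (hxy : (p : ℤ) = x ^ 2 + 11 * y ^ 2)
    (hc : c % 4 = 1) (hy : y = 2 ^ (r + 1) * y₀) (hy₀ : y₀ % 4 = 1)
    (h11 : ¬ ((11 : ℤ) ∣ c ∧ (11 : ℤ) ∣ x + d)) :
    quartic x ⟨c, d⟩ = gaussIPow (1 + 2 * (((p : ℤ) - 5) / 8)) *
      quartic ⟨x + d, -c⟩ ((11 : ℤ) : GaussianInt) * quartic y ⟨c, d⟩ := by
  have h4 : (4 : ZMod 4) = 0 := by decide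
  obtain ⟨b, hb⟩ : ∃ b, c = 4 * b + 1 := ⟨c / 4, by omega⟩
  obtain ⟨q, hq⟩ : ∃ q : ℤ, (p : ℤ) = 8 * q + 5 := ⟨p / 8, by omega⟩
  have hd : ∃ δ, d = 4 * δ + 2 := by
    have h1 : Even d := by
      rw [← Int.not_odd_iff_even]
      rintro ⟨k, hk⟩
      have : 8 * q + 5 = (4 * b + 1) ^ 2 + (2 * k + 1) ^ 2 := by rw [← hb, ← hk, ← hcd, hq]
      have : 8 * q + 5 = 2 * (8 * b ^ 2 + 4 * b + 2 * k ^ 2 + 2 * k + 1) := by linarith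
      omega
    obtain ⟨e, he⟩ := h1
    rcases Int.even_or_odd e with ⟨k, hk⟩ | ⟨k, hk⟩
    · have : 8 * q + 5 = 8 * (2 * b ^ 2 + b + 2 * k ^ 2) + 1 := by
        rw [← hq, hcd, hb, he, hk]; ring
      omega
    · exact ⟨k, by omega⟩
  obtain ⟨δ, hδ⟩ := hd
  have hxo : Odd x := by
    rw [← Int.not_even_iff_odd]
    rintro ⟨k, hk⟩
    have : 8 * q + 5 = 2 * (2 * k ^ 2 + 22 * (2 ^ r * y₀) ^ 2) := by
      rw [← hq, hxy, hk, hy]; ring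
    omega
  -- For r ≥ 1 one has 4 ∣ y, and then p ≡ x² ≡ 1 mod 8.
  have hr : r = 0 := by
    rcases r with _ | r
    · rfl
    obtain ⟨l, hl⟩ := hxo
    have : 8 * q + 5 = 4 * (l * (l + 1)) + 1 + 176 * (2 ^ r * y₀) ^ 2 := by
      rw [← hq, hxy, hl, hy]; ring
    obtain ⟨s, hs⟩ := Int.even_mul_succ_self l
    omega
  subst hr
  obtain ⟨z, hz⟩ : ∃ z, y₀ = 4 * z + 1 := ⟨y₀ / 4, by omega⟩
  have hyz : y = 8 * z + 2 := by rw [hy, hz]; ring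
  obtain ⟨τ, hτ, j, hj⟩ : ∃ τ : ℤ, (τ = 1 ∨ τ = -1) ∧ ∃ j, τ * x = 4 * j + 1 := by
    obtain ⟨l, hl⟩ := hxo
    rcases Int.even_or_odd l with ⟨s, hs⟩ | ⟨s, hs⟩
    · exact ⟨1, Or.inl rfl, s, by omega⟩
    · exact ⟨-1, Or.inr rfl, -s - 1, by omega⟩
  -- As d ≡ 2 mod 4, x and x + d lie in opposite classes modulo 4.
  obtain ⟨ν, hντ⟩ : ∃ ν, ν = -τ := ⟨_, rfl⟩
  have hν : ν = 1 ∨ ν = -1 := by omega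
  have hτν : τ = -ν := by omega
  subst hτν
  have hν2 : ν * ν = 1 := by rcases hν with rfl | rfl <;> norm_num
  have hνn : (ν * (x + d)) % 4 = 1 := by
    rcases hν with rfl | rfl <;> omega
  obtain ⟨G, m, a, K, hn, hcg, hK, F, w, hF, hw, hKz⟩ :=
    quartic_symbol_of_even_zmod hp (by omega) hcd hxy hc hy hy₀ h11 hτ hj hν hνn
  rw [hK]
  congr 2
  apply gaussIPow_congr
  apply (ZMod.intCast_eq_intCast_iff _ _ 4).1
  have hx' : x = -ν * (4 * j + 1) := by rw [← hj]; linear_combination -x * hν2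
  have hb' : b = 4 * (G * a) + G + a := by
    rw [hb] at hcg
    linarith
  have hδ' : 2 * δ + 1 = ν * (4 * ((2 * G ^ 2 + G) * (4 * m + 1)) + 2 * (m + j) + 1) := by
    rw [hδ, hx'] at hn
    linarith
  have hD : c * d / 2 = (4 * b + 1) * (2 * δ + 1) := by
    have : c * d = 2 * ((4 * b + 1) * (2 * δ + 1)) := by rw [hb, hδ]; ring
    omega
  have hx2 : x ^ 2 = (4 * j + 1) ^ 2 := by
    rw [hx']; linear_combination (4 * j + 1) ^ 2 * hν2
  have hbj : (b - j) * (1 + 2 * (b + j)) =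
      5 + 44 * (2 * z ^ 2 + z) - 2 * (δ * (δ + 1)) := by
    have : c ^ 2 + d ^ 2 = x ^ 2 + 11 * y ^ 2 := by rw [← hcd, hxy]
    rw [hb, hδ, hyz, hx2] at this
    linarith
  have hP : ((p : ℤ) - 1) / 2 = 4 * q + 2 := by omega
  have hzν : (ν : ZMod 4) = 1 ∨ (ν : ZMod 4) = -1 := by
    rcases hν with rfl | rfl <;> simp
  have hE : 2 * (((x - 1) / 2 : ℤ) : ZMod 4) = 1 + ν := by
    rcases hν with rfl | rfl
    · have : (x - 1) / 2 = -2 * j - 1 := by omega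
      rw [this]; push_cast; linear_combination -((j : ZMod 4) + 1) * h4
    · have : (x - 1) / 2 = 2 * j := by omega
      rw [this]; push_cast; linear_combination (j : ZMod 4) * h4
  have hpq : ((p : ℤ) - 5) / 8 = 2 * j ^ 2 + j + 5 + 44 * (2 * z ^ 2 + z) := by
    have : (p : ℤ) - 5 = 8 * (2 * j ^ 2 + j + 5 + 44 * (2 * z ^ 2 + z)) := by
      rw [hxy, hx2, hyz]; ring
    omega
  have zbj : (b : ZMod 4) = j - 1 := by
    have h := congrArg (Int.cast : ℤ → ZMod 4) hbj
    push_cast at h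
    have key : ∀ b j z δ : ZMod 4, (b - j) * (1 + 2 * (b + j)) =
        5 + 44 * (2 * z ^ 2 + z) - 2 * (δ * (δ + 1)) → b = j - 1 := by decide
    exact key _ _ _ _ h
  have zD : (4 * (b : ZMod 4) + 1) * (2 * δ + 1) = ν * (2 * (m + j) + 1) := by
    have h := congrArg (Int.cast : ℤ → ZMod 4) hδ'
    push_cast at h
    rw [h, h4]
    ring
  rw [hKz, hpq, Nat.cast_zero, zmod_four_exponent_of_five hzν hE hF
    (by rw [hP]; push_cast; rw [h4]; ring) rfl
    rfl rfl rfl (by rw [hD]; push_cast; exact zD) rfl hw (by rw [hb']; push_cast; rw [h4]; ring)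
    zbj]
  push_cast
  linear_combination (-2 - (j : ZMod 4) ^ 2 - 22 * (2 * z ^ 2 + z)) * h4

/-- The rational factor 2 has symbol 1; coprimality to 11 holds because -1 is not a square modulo
11. It restores the shape treated by `quartic_eleven_cases`. -/
theorem quartic_two_mul_eleven {n c : ℤ} (h11 : ¬ ((11 : ℤ) ∣ c ∧ (11 : ℤ) ∣ n)) :
    quartic ⟨2 * n, 2 * c⟩ ((11 : ℤ) : GaussianInt) =
      quartic ⟨n, c⟩ ((11 : ℤ) : GaussianInt) := by
  have ho : Odd (11 : ℤ) := by decide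
  have h1 : IsCoprime (11 : ℤ) (n ^ 2 + c ^ 2) := by
    refine int_prime_eleven.irreducible.coprime_iff_not_dvd.2 fun h => h11 ?_
    have key : ∀ n c : ZMod 11, n ^ 2 + c ^ 2 = 0 → c = 0 ∧ n = 0 := by decide
    have e11 : (11 : ℤ) = ((11 : ℕ) : ℤ) := rfl
    rw [e11, ← ZMod.intCast_zmod_eq_zero_iff_dvd] at h ⊢
    rw [← ZMod.intCast_zmod_eq_zero_iff_dvd]
    push_cast at h
    exact key _ _ h
  have h2 : IsCoprime ((11 : ℤ) : GaussianInt) ⟨n, c⟩ :=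
    isCoprime_intCast_of_norm (by rw [gaussian_norm_eq]; exact h1)
  have h3 : IsCoprime ((2 : ℤ) : GaussianInt) ((11 : ℤ) : GaussianInt) :=
    isCoprime_intCast_gaussian ⟨-5, 1, by norm_num⟩
  have h4 : (⟨2 * n, 2 * c⟩ : GaussianInt) = ((2 : ℤ) : GaussianInt) * ⟨n, c⟩ := by
    ext <;> simp
  rw [h4, quartic_mul_left (odd_norm_intCast ho) h3 h2.symm, quartic_intCast_intCast ho h3, one_mul]

/-! ### From symbols to powers in 𝔽_p. -/

/-- Since (d/c)² = -1, i ↦ d/c defines a ring map to 𝔽_p that kills c + di, and it carries the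
symbol of b to b^((p-1)/4). -/
theorem pow_eq_of_quartic_eq {p : ℕ} [Fact p.Prime] (hp4 : p % 4 = 1) {c d x y e E : ℤ} {s : ℕ}
    (hcd : (p : ℤ) = c ^ 2 + d ^ 2) (hc : (c : ZMod p) ≠ 0)
    (h : quartic x ⟨c, d⟩ = gaussIPow (2 * E) * (-e * gaussI ^ s) * quartic y ⟨c, d⟩) :
    (x : ZMod p) ^ ((p - 1) / 4) =
      (-1) ^ E * (-e * ((d : ZMod p) / c) ^ s) * (y : ZMod p) ^ ((p - 1) / 4) := by
  have hp : p.Prime := Fact.out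
  have hcd' : (c : ZMod p) ^ 2 + (d : ZMod p) ^ 2 = 0 := by
    have := congrArg (Int.cast : ℤ → ZMod p) hcd
    push_cast at this
    rw [← this, ZMod.natCast_self]
  let f : GaussianInt →+* ZMod p := Zsqrtd.lift ⟨(d : ZMod p) / c, by
    field_simp
    push_cast
    linear_combination hcd'⟩
  have hf : ∀ a b : ℤ, f ⟨a, b⟩ = a + b * ((d : ZMod p) / c) := fun a b => rfl
  have hfI : f gaussI = (d : ZMod p) / c := by
    rw [gaussI, hf]; push_cast; ring
  have hfπ : f ⟨c, d⟩ = 0 := by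
    rw [hf]; field_simp; rw [hcd', mul_zero]
  have hn : (⟨c, d⟩ : GaussianInt).norm = p := by rw [gaussian_norm_eq, hcd]
  have hπ : Prime (⟨c, d⟩ : GaussianInt) := prime_of_norm_prime hp hn
  have ho : Odd (⟨c, d⟩ : GaussianInt).norm := by
    rw [hn, Int.odd_iff]; omega
  have hq : ∀ b : ℤ, f (quartic b ⟨c, d⟩) = (b : ZMod p) ^ ((p - 1) / 4) := by
    intro b
    obtain ⟨k, hk⟩ := dvd_pow_sub_quarticPrime (b : GaussianInt) hπ ho
    have := congrArg f hk
    rw [map_mul, hfπ, zero_mul, map_sub, map_pow, map_intCast, hn, Int.natAbs_natCast,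
      sub_eq_zero] at this
    rw [quartic_prime hπ, this]
  have hE : f (gaussIPow (2 * E)) = (-1) ^ E := by
    rcases Int.even_or_odd E with h | h
    · rw [h.neg_one_zpow]
      obtain ⟨k, hk⟩ := h
      rw [gaussIPow_congr (k := 0) (Int.modEq_zero_iff_dvd.2 ⟨k, by omega⟩), gaussIPow_zero,
        map_one]
    · rw [h.neg_one_zpow]
      obtain ⟨k, hk⟩ := h
      rw [gaussIPow_congr (k := 2) (Int.modEq_iff_dvd.2 ⟨-k, by omega⟩), gaussIPow_two,
        map_neg, map_one]
  rw [← hq, h, map_mul, map_mul, map_mul, hE, hq, map_neg, map_intCast, map_pow, hfI]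

theorem quartic_eleven_cases {a b x e : ℤ} {s : ℕ} (hx : (11 : ℤ) ∣ x ^ 2 - 4 * (a ^ 2 + b ^ 2))
    (h11 : ¬ ((11 : ℤ) ∣ b ∧ (11 : ℤ) ∣ x + 2 * a)) (he : e = 1 ∨ e = -1)
    (h : (s = 0 ∧ (x ≡ e * (4 * a) [ZMOD 11] ∨ x ≡ e * (9 * a) [ZMOD 11])) ∨
      (s = 1 ∧ (x ≡ e * (4 * b) [ZMOD 11] ∨ x ≡ e * (9 * b) [ZMOD 11]))) :
    quartic ⟨x + 2 * a, 2 * b⟩ ((11 : ℤ) : GaussianInt) = -e * gaussI ^ s := by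
  rcases h with ⟨rfl, h⟩ | ⟨rfl, h⟩
  · rw [pow_zero, mul_one]
    exact quartic_eleven_re hx h11 he (h.imp (fun h => h.symm.dvd) fun h => h.symm.dvd)
  · rw [pow_one]
    exact quartic_eleven_im hx h11 he (h.imp (fun h => h.symm.dvd) fun h => h.symm.dvd)

theorem neg_one_pow_quarter {p : ℕ} [Fact p.Prime] (hp4 : p % 4 = 1) :
    (p % 8 = 1 → (-1 : ZMod p) ^ ((p - 1) / 4) = 1) ∧
      (p % 8 = 5 → (-1 : ZMod p) ^ ((p - 1) / 4) = -1) := by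
  refine ⟨fun h => Even.neg_one_pow ?_, fun h => Odd.neg_one_pow ?_⟩
  · rw [Nat.even_iff]; omega
  · rw [Nat.odd_iff]; omega

theorem modEq_neg_cases {s : ℕ} {a b x e : ℤ}
    (h : (s = 0 ∧ (x ≡ e * (4 * a) [ZMOD 11] ∨ x ≡ e * (9 * a) [ZMOD 11])) ∨
      (s = 1 ∧ (x ≡ e * (4 * b) [ZMOD 11] ∨ x ≡ e * (9 * b) [ZMOD 11]))) :
    (s = 0 ∧ (-x ≡ -e * (4 * a) [ZMOD 11] ∨ -x ≡ -e * (9 * a) [ZMOD 11])) ∨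
      (s = 1 ∧ (-x ≡ -e * (4 * b) [ZMOD 11] ∨ -x ≡ -e * (9 * b) [ZMOD 11])) := by
  simp only [neg_mul]
  exact h.imp (And.imp_right (Or.imp Int.ModEq.neg Int.ModEq.neg))
    (And.imp_right (Or.imp Int.ModEq.neg Int.ModEq.neg))

/-- Replacing (x, e) by (-x, -e) changes the sign of e and multiplies the left side by
(-1)^((p-1)/4). For p ≡ 5 mod 8 these cancel; for p ≡ 1 mod 8 the parity of the exponent must
change. -/
theorem eq_of_neg_pow_eq {p : ℕ} [Fact p.Prime] (hp4 : p % 4 = 1) {x e E E' : ℤ} {z w : ZMod p}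
    (h1 : p % 8 = 1 → Odd (E' - E)) (h5 : p % 8 = 5 → E' = E)
    (h : ((-x : ℤ) : ZMod p) ^ ((p - 1) / 4) = (-1) ^ E' * (-((-e : ℤ) : ZMod p) * z) * w) :
    (x : ZMod p) ^ ((p - 1) / 4) = (-1) ^ E * (-(e : ZMod p) * z) * w := by
  have hn : (-1 : ZMod p) ≠ 0 := neg_ne_zero.2 one_ne_zero
  obtain ⟨k1, k5⟩ := neg_one_pow_quarter hp4
  rw [Int.cast_neg, neg_pow] at h
  have h8 : p % 8 = 1 ∨ p % 8 = 5 := by omega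
  rcases h8 with h8 | h8
  · have e1 : (-1 : ZMod p) ^ E' = -(-1) ^ E := by
      rw [← add_sub_cancel E E', zpow_add₀ hn, (h1 h8).neg_one_zpow, mul_neg_one]
    rw [k1 h8, one_mul, e1] at h
    rw [h]; push_cast; ring
  · rw [k5 h8, h5 h8] at h
    push_cast at h
    linear_combination -h

theorem intCast_zmod_ne_zero {p : ℕ} [Fact p.Prime] {m k a b : ℤ}
    (h : m * (p : ℤ) = a ^ 2 + k * b ^ 2) (hm : ¬ (p : ℤ) ∣ m) (hk : ¬ (p : ℤ) ∣ k) :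
    (a : ZMod p) ≠ 0 := by
  have hp : Prime (p : ℤ) := Nat.prime_iff_prime_int.1 Fact.out
  rw [Ne, ZMod.intCast_zmod_eq_zero_iff_dvd]
  rintro ⟨u, hu⟩
  have h1 : (p : ℤ) ∣ k * b ^ 2 := ⟨m - p * u ^ 2, by rw [hu] at h; linear_combination -h⟩
  obtain ⟨v, hv⟩ := hp.dvd_of_dvd_pow ((hp.dvd_or_dvd h1).resolve_left hk)
  refine hm ⟨u ^ 2 + k * v ^ 2, mul_right_cancel₀ hp.ne_zero ?_⟩
  rw [h, hu, hv]
  ring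

theorem pow_eq_of_odd {p : ℕ} [Fact p.Prime] (hp4 : p % 4 = 1) {c d x y e E : ℤ} {s : ℕ}
    (hcd : (p : ℤ) = c ^ 2 + d ^ 2) (hc0 : (c : ZMod p) ≠ 0)
    (hxy : 4 * (p : ℤ) = x ^ 2 + 11 * y ^ 2) (hc : c % 4 = 1) (hx : Odd x) (hy : y % 4 = 1)
    (he : e = 1 ∨ e = -1)
    (hs : (s = 0 ∧ (x ≡ e * (4 * c) [ZMOD 11] ∨ x ≡ e * (9 * c) [ZMOD 11])) ∨
      (s = 1 ∧ (x ≡ e * (4 * d) [ZMOD 11] ∨ x ≡ e * (9 * d) [ZMOD 11])))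
    (hE1 : p % 8 = 1 → E = 1 + x / 4) (hE5 : p % 8 = 5 → E = (x ^ 2 - 1) / 8) :
    (x : ZMod p) ^ ((p - 1) / 4) =
      (-1) ^ E * (-e * ((d : ZMod p) / c) ^ s) * (y : ZMod p) ^ ((p - 1) / 4) := by
  have hp : p.Prime := Fact.out
  have key : ∀ x e E : ℤ, 4 * (p : ℤ) = x ^ 2 + 11 * y ^ 2 → Odd x → (e = 1 ∨ e = -1) →
      ((s = 0 ∧ (x ≡ e * (4 * c) [ZMOD 11] ∨ x ≡ e * (9 * c) [ZMOD 11])) ∨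
      (s = 1 ∧ (x ≡ e * (4 * d) [ZMOD 11] ∨ x ≡ e * (9 * d) [ZMOD 11]))) →
      (p % 8 = 1 → E = 1 + x / 4) → (p % 8 = 5 → E = (x ^ 2 - 1) / 8) →
      ¬ ((11 : ℤ) ∣ d ∧ (11 : ℤ) ∣ x + 2 * c) →
      (x : ZMod p) ^ ((p - 1) / 4) =
        (-1) ^ E * (-e * ((d : ZMod p) / c) ^ s) * (y : ZMod p) ^ ((p - 1) / 4) := by
    intro x e E hxy hx he hs hE1 hE5 h11
    apply pow_eq_of_quartic_eq hp4 hcd hc0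
    rw [quartic_symbol_of_odd hp hp4 hcd hxy hc hx hy h11,
      quartic_eleven_cases ⟨-y ^ 2, by linear_combination -hxy + 4 * hcd⟩ h11 he hs]
    congr 2
    apply gaussIPow_congr
    obtain ⟨b, hb⟩ : ∃ b, c = 4 * b + 1 := ⟨c / 4, by omega⟩
    have hd : ∃ k, d = 2 * k := by
      rcases Int.even_or_odd d with ⟨k, hk⟩ | ⟨k, hk⟩
      · exact ⟨k, by omega⟩
      · have : (p : ℤ) = 2 * (8 * b ^ 2 + 4 * b + 2 * k ^ 2 + 2 * k + 1) := by
          rw [hcd, hb, hk]; ring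
        omega
    obtain ⟨k, hk⟩ := hd
    have hpk : (p : ℤ) = 8 * (2 * b ^ 2 + b) + 4 * k ^ 2 + 1 := by rw [hcd, hb, hk]; ring
    have hdk : d / 2 = k := by omega
    rw [hdk]
    have h8 : p % 8 = 1 ∨ p % 8 = 5 := by omega
    obtain ⟨q, hq⟩ : ∃ q, x ^ 2 - 1 = 8 * q ∧ ((q - (x + 1) / 2 - 1 - x / 4) % 2 = 0) := by
      obtain ⟨l, hl⟩ := hx
      rcases Int.even_or_odd l with ⟨m, hm⟩ | ⟨m, hm⟩
      · refine ⟨2 * m ^ 2 + m, by rw [hl, hm]; ring, ?_⟩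
        have h1 : (x + 1) / 2 = 2 * m + 1 := by omega
        have h2 : x / 4 = m := by omega
        rw [h1, h2]; omega
      · refine ⟨2 * m ^ 2 + 3 * m + 1, by rw [hl, hm]; ring, ?_⟩
        have h1 : (x + 1) / 2 = 2 * m + 2 := by omega
        have h2 : x / 4 = m := by omega
        rw [h1, h2]; omega
    have hq8 : (x ^ 2 - 1) / 8 = q := by omega
    rw [hq8] at hE5 ⊢
    obtain ⟨l, hl⟩ := hx
    have hl2 : (x - 1) / 2 = l := by omega
    rw [hl2, Int.modEq_iff_dvd]
    rcases h8 with h8 | h8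
    · have hke : Even k := by
        rw [← Int.not_odd_iff_even]
        rintro ⟨j, rfl⟩
        have : (p : ℤ) = 8 * (2 * b ^ 2 + b + 2 * j ^ 2 + 2 * j) + 5 := by rw [hpk]; ring
        omega
      obtain ⟨j, rfl⟩ := hke
      rw [hE1 h8]
      have : l * (j + j) = 2 * (l * j) := by ring
      rw [this]
      omega
    · have hko : Odd k := by
        rw [← Int.not_even_iff_odd]
        rintro ⟨j, rfl⟩
        have : (p : ℤ) = 8 * (2 * b ^ 2 + b + 2 * j ^ 2) + 1 := by rw [hpk]; ring
        omega
      obtain ⟨j, rfl⟩ := hko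
      rw [hE5 h8]
      have : l * (2 * j + 1) = 2 * (l * j) + l := by ring
      rw [this]
      omega
  -- In the excluded case -x is admissible, for otherwise 11 would divide both c and d. For odd x,
  -- ⌊-x/4⌋ = -⌊x/4⌋ - 1, which supplies the change of parity.
  by_cases h11 : (11 : ℤ) ∣ d ∧ (11 : ℤ) ∣ x + 2 * c
  · refine eq_of_neg_pow_eq hp4 (E' := if p % 8 = 1 then 1 + -x / 4 else (x ^ 2 - 1) / 8) ?_ ?_
      (key (-x) (-e) _ (by rw [hxy]; ring) hx.neg (by omega) (modEq_neg_cases hs) ?_ ?_ ?_)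
    · intro h8
      rw [if_pos h8, hE1 h8, Int.odd_iff]
      obtain ⟨l, hl⟩ := hx
      omega
    · intro h8
      rw [if_neg (by omega), hE5 h8]
    · intro h8
      rw [if_pos h8]
    · intro h8
      rw [if_neg (by omega), neg_sq]
    · rintro ⟨-, h⟩
      have hcop := isCoprime_of_prime_eq_sq_add_sq hp (k := 1) (c := c) (d := d)
        (by rw [hcd]; ring)
      exact int_prime_eleven.not_isUnit (hcop.isUnit_of_dvd' (by omega) h11.1)
  · exact key x e E hxy hx he hs hE1 hE5 h11

theorem pow_eq_of_even {p : ℕ} [Fact p.Prime] (hp4 : p % 4 = 1) {c d x y y₀ e E : ℤ} {r s : ℕ}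
    (hcd : (p : ℤ) = c ^ 2 + d ^ 2) (hc0 : (c : ZMod p) ≠ 0)
    (hxy : (p : ℤ) = x ^ 2 + 11 * y ^ 2) (hc : c % 4 = 1) (hx : Odd x)
    (hy : y = 2 ^ (r + 1) * y₀) (hy₀ : y₀ % 4 = 1) (he : e = 1 ∨ e = -1)
    (hs : (s = 0 ∧ (2 * x ≡ e * (4 * c) [ZMOD 11] ∨ 2 * x ≡ e * (9 * c) [ZMOD 11])) ∨
      (s = 1 ∧ (2 * x ≡ e * (4 * d) [ZMOD 11] ∨ 2 * x ≡ e * (9 * d) [ZMOD 11])))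
    (hE1 : p % 8 = 1 → E = x / 4 + y / 4) (hE5 : p % 8 = 5 → E = ((p : ℤ) - 5) / 8) :
    (x : ZMod p) ^ ((p - 1) / 4) =
      (-1) ^ E * (-e * ((d : ZMod p) / c) ^ s) * (y : ZMod p) ^ ((p - 1) / 4) := by
  have hp : p.Prime := Fact.out
  have key : ∀ x e E : ℤ, (p : ℤ) = x ^ 2 + 11 * y ^ 2 → (e = 1 ∨ e = -1) →
      ((s = 0 ∧ (2 * x ≡ e * (4 * c) [ZMOD 11] ∨ 2 * x ≡ e * (9 * c) [ZMOD 11])) ∨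
      (s = 1 ∧ (2 * x ≡ e * (4 * d) [ZMOD 11] ∨ 2 * x ≡ e * (9 * d) [ZMOD 11]))) →
      (p % 8 = 1 → E = x / 4 + y / 4) → (p % 8 = 5 → E = ((p : ℤ) - 5) / 8) →
      ¬ ((11 : ℤ) ∣ c ∧ (11 : ℤ) ∣ x + d) →
      (x : ZMod p) ^ ((p - 1) / 4) =
        (-1) ^ E * (-e * ((d : ZMod p) / c) ^ s) * (y : ZMod p) ^ ((p - 1) / 4) := by
    intro x e E hxy he hs hE1 hE5 h11
    apply pow_eq_of_quartic_eq hp4 hcd hc0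
    have h8 : p % 8 = 1 ∨ p % 8 = 5 := by omega
    have hsym : quartic x ⟨c, d⟩ = gaussIPow (1 + 2 * E) *
        quartic ⟨x + d, -c⟩ ((11 : ℤ) : GaussianInt) * quartic y ⟨c, d⟩ := by
      rcases h8 with h8 | h8
      · rw [hE1 h8]
        exact quartic_symbol_of_even_of_one hp h8 hcd hxy hc hy hy₀ h11
      · rw [hE5 h8]
        exact quartic_symbol_of_even_of_five hp h8 hcd hxy hc hy hy₀ h11
    rw [hsym]
    congr 1
    have h11' : ¬ ((11 : ℤ) ∣ -c ∧ (11 : ℤ) ∣ x + d) := by rwa [dvd_neg]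
    -- The argument is now 2x + 2d - 2ci, so the laws modulo 11 apply with (a, b) = (d, -c). The
    -- extra factor i undoes this exchange of c and d.
    rw [← quartic_two_mul_eleven h11', mul_add, add_comm, gaussIPow_add, gaussIPow_one, mul_assoc]
    congr 1
    have hX : (11 : ℤ) ∣ (2 * x) ^ 2 - 4 * (d ^ 2 + (-c) ^ 2) :=
      ⟨-4 * y ^ 2, by linear_combination -4 * hxy + 4 * hcd⟩
    have hX11 : ¬ ((11 : ℤ) ∣ -c ∧ (11 : ℤ) ∣ 2 * x + 2 * d) := by omega
    rcases hs with ⟨rfl, hs'⟩ | ⟨rfl, hs'⟩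
    · rw [quartic_eleven_cases (s := 1) (e := -e) hX hX11 (by omega)
        (Or.inr ⟨rfl, by simpa only [neg_mul, mul_neg, neg_neg] using hs'⟩)]
      push_cast
      linear_combination (e : GaussianInt) * gaussI_mul_self
    · rw [quartic_eleven_cases (s := 0) hX hX11 he (Or.inl ⟨rfl, hs'⟩)]
      ring
  by_cases h11 : (11 : ℤ) ∣ c ∧ (11 : ℤ) ∣ x + d
  · refine eq_of_neg_pow_eq hp4 (E' := if p % 8 = 1 then -x / 4 + y / 4 else ((p : ℤ) - 5) / 8)
      ?_ ?_ (key (-x) (-e) _ (by rw [hxy]; ring) (by omega) ?_ ?_ ?_ ?_)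
    · intro h8
      rw [if_pos h8, hE1 h8, Int.odd_iff]
      obtain ⟨l, hl⟩ := hx
      omega
    · intro h8
      rw [if_neg (by omega), hE5 h8]
    · rw [mul_neg]
      exact modEq_neg_cases hs
    · intro h8
      rw [if_pos h8]
    · intro h8
      rw [if_neg (by omega)]
    · rintro ⟨-, h⟩
      have hcop := isCoprime_of_prime_eq_sq_add_sq hp (k := 1) (c := c) (d := d)
        (by rw [hcd]; ring)
      exact int_prime_eleven.not_isUnit (hcop.isUnit_of_dvd' h11.1 (by omega))
  · exact key x e E hxy he hs hE1 hE5 h11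

/-! ### Powers of -11 and the final assembly. -/

/-- (p-1)/4 is 2[p/8] for p ≡ 1 mod 8 and 2[p/8] + 1 for p ≡ 5 mod 8; the odd exponent leaves a
factor x/y. -/
theorem neg_eleven_pow_of_pow_eq {p : ℕ} [Fact p.Prime] {x y S : ZMod p}
    (hx : x ≠ 0) (hy : y ≠ 0) (h : x ^ 2 = -11 * y ^ 2)
    (hS : x ^ ((p - 1) / 4) = S * y ^ ((p - 1) / 4)) :
    (p % 8 = 1 → (-11) ^ (p / 8) = S) ∧ (p % 8 = 5 → (-11) ^ (p / 8) = S * (y / x)) := by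
  have h1 : (x / y) ^ 2 = -11 := by
    rw [div_pow, h, mul_div_cancel_right₀ _ (pow_ne_zero 2 hy)]
  have h2 : (x / y) ^ ((p - 1) / 4) = S := by
    rw [div_pow, hS, mul_div_cancel_right₀ _ (pow_ne_zero _ hy)]
  rw [← h1, ← pow_mul]
  constructor
  · intro h8
    rw [← h2]
    congr 1
    omega
  · intro h8
    have h3 : (p - 1) / 4 = 2 * (p / 8) + 1 := by omega
    rw [← h2, h3, pow_succ, mul_assoc, div_mul_div_comm, mul_comm x y,
      div_self (mul_ne_zero hy hx), mul_one]

set_option maxRecDepth 100000 in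
theorem exists_sign_modEq_eleven {c d x : ℤ} (h : (11 : ℤ) ∣ x ^ 2 - 4 * (c ^ 2 + d ^ 2)) :
    ∃ ε : ℤ, (ε = 1 ∨ ε = -1) ∧
      ((x ≡ ε * (4 * c) [ZMOD 11] ∨ x ≡ ε * (9 * c) [ZMOD 11]) ∨
        (x ≡ ε * (4 * d) [ZMOD 11] ∨ x ≡ ε * (9 * d) [ZMOD 11])) := by
  have key : ∀ c d x : ZMod 11, x ^ 2 = 4 * (c ^ 2 + d ^ 2) →
      ((x = 4 * c ∨ x = 9 * c) ∨ x = 4 * d ∨ x = 9 * d) ∨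
        ((x = -(4 * c) ∨ x = -(9 * c)) ∨ x = -(4 * d) ∨ x = -(9 * d)) := by decide
  have hz : (x : ZMod 11) ^ 2 = 4 * ((c : ZMod 11) ^ 2 + (d : ZMod 11) ^ 2) := by
    have := (ZMod.intCast_zmod_eq_zero_iff_dvd _ 11).2 h
    push_cast at this
    exact sub_eq_zero.1 this
  have e : ∀ a b : ℤ, a ≡ b [ZMOD 11] ↔ (a : ZMod 11) = b := fun a b =>
    (ZMod.intCast_eq_intCast_iff a b 11).symm
  rcases key _ _ _ hz with h | h
  · refine ⟨1, Or.inl rfl, ?_⟩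
    simp only [e]
    push_cast
    simpa only [one_mul] using h
  · refine ⟨-1, Or.inr rfl, ?_⟩
    simp only [e]
    push_cast
    simpa only [neg_mul, one_mul] using h

/-- Congruences modulo 4 in p = X² + 11Y² force Y even and X odd; modulo 8, p ≡ 1 forces 4 ∣ Y. -/
theorem exists_half_of_even {p t : ℕ} (hp4 : p % 4 = 1) {x y y₀ : ℤ}
    (hxy : 4 * (p : ℤ) = x ^ 2 + 11 * y ^ 2) (hx : 2 ∣ x) (hy : y = 2 ^ t * y₀)
    (hy₀ : y₀ % 4 = 1) :
    ∃ (X Y : ℤ) (r : ℕ), x = 2 * X ∧ y = 2 * Y ∧ (p : ℤ) = X ^ 2 + 11 * Y ^ 2 ∧ Odd X ∧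
      Y = 2 ^ (r + 1) * y₀ ∧ (p % 8 = 1 → 4 ∣ Y) := by
  obtain ⟨X, rfl⟩ := hx
  obtain ⟨q, hq⟩ : ∃ q : ℤ, (p : ℤ) = 4 * q + 1 := ⟨p / 4, by omega⟩
  have hye : Even y := by
    rw [← Int.not_odd_iff_even]
    rintro ⟨k, hk⟩
    have : 4 * (p : ℤ) = 4 * (X ^ 2 + 11 * (k ^ 2 + k)) + 11 := by rw [hxy, hk]; ring
    omega
  obtain ⟨Y, hY⟩ := hye
  have hpXY : (p : ℤ) = X ^ 2 + 11 * Y ^ 2 := by rw [hY] at hxy; linarith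
  have hYe : ∃ Z, Y = 2 * Z := by
    rcases Int.even_or_odd' Y with ⟨k, hk | hk⟩
    · exact ⟨k, hk⟩
    · rcases Int.even_or_odd' X with ⟨l, hl | hl⟩
      · have : 4 * q + 1 = 4 * (l ^ 2 + 11 * (k ^ 2 + k) + 2) + 3 := by
          rw [← hq, hpXY, hk, hl]; ring
        omega
      · have : 4 * q + 1 = 4 * (l ^ 2 + l + 11 * (k ^ 2 + k) + 3) := by
          rw [← hq, hpXY, hk, hl]; ring
        omega
  obtain ⟨Z, hZ⟩ := hYe
  obtain ⟨l, hl⟩ : Odd X := by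
    rw [← Int.not_even_iff_odd]
    rintro ⟨l, hl⟩
    have : 4 * q + 1 = 4 * (l ^ 2 + 11 * Z ^ 2) := by rw [← hq, hpXY, hZ, hl]; ring
    omega
  have ht : ∃ r, t = r + 2 := by
    rcases t with _ | _ | r
    · rw [pow_zero, one_mul] at hy; omega
    · rw [zero_add, pow_one] at hy; omega
    · exact ⟨r, rfl⟩
  obtain ⟨r, rfl⟩ := ht
  refine ⟨X, Y, r, rfl, by omega, hpXY, ⟨l, hl⟩, ?_, ?_⟩
  · have : y = 2 * (2 ^ (r + 1) * y₀) := by rw [hy]; ring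
    omega
  · intro h8
    rcases Int.even_or_odd' Z with ⟨k, hk | hk⟩
    · exact ⟨k, by omega⟩
    · obtain ⟨s, hs⟩ := Int.even_mul_succ_self l
      have : (p : ℤ) = 4 * (l * (l + 1)) + 1 + 44 * (4 * (k ^ 2 + k) + 1) := by
        rw [hpXY, hZ, hk, hl]; ring
      omega

/-- Integer division `x / 4`, `x / 8` is the floor (the divisor is positive); `y / 8`,
`(x ^ 2 - 1) / 8` and `(p - 5) / 8` are exact where they are used. Fractions such as
`d / c` and `y / x` are taken in the field `ZMod p`; the denominators are nonzero there by the
first conjunct. The integer `ε` is the sign `±` of the case: `ε = 1` for the upper signs and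
`ε = -1` for the lower signs. The second conjunct says that the cases are exhaustive. -/
theorem theorem3p5 (p : ℕ) [Fact p.Prime] (hp4 : p % 4 = 1) (hleg : legendreSym p (-11) = 1)
    (c d x y d₀ y₀ : ℤ) (r t : ℕ)
    (hcd : (p : ℤ) = c ^ 2 + d ^ 2) (hxy : 4 * (p : ℤ) = x ^ 2 + 11 * y ^ 2)
    (hc : c ≡ 1 [ZMOD 4])
    (hd : d = 2 ^ r * d₀) (hd₀ : ¬ 2 ∣ d₀)
    (hy : y = 2 ^ t * y₀) (hy₀ : y₀ ≡ 1 [ZMOD 4])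
    (hgcd : Int.gcd c (x + 2 * d) = 1 ∨ Int.gcd d₀ (x + 2 * c) = 1) :
    ((c : ZMod p) ≠ 0 ∧ (x : ZMod p) ≠ 0) ∧
    (∃ ε : ℤ, (ε = 1 ∨ ε = -1) ∧
      ((x ≡ ε * (4 * c) [ZMOD 11] ∨ x ≡ ε * (9 * c) [ZMOD 11]) ∨
        (x ≡ ε * (4 * d) [ZMOD 11] ∨ x ≡ ε * (9 * d) [ZMOD 11]))) ∧
    (p % 8 = 1 → ¬ 2 ∣ x → ∀ ε : ℤ, ε = 1 ∨ ε = -1 →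
      ((x ≡ ε * (4 * c) [ZMOD 11] ∨ x ≡ ε * (9 * c) [ZMOD 11]) →
        (-11 : ZMod p) ^ (p / 8) = (ε : ZMod p) * (-1 : ZMod p) ^ (x / 4)) ∧
      ((x ≡ ε * (4 * d) [ZMOD 11] ∨ x ≡ ε * (9 * d) [ZMOD 11]) →
        (-11 : ZMod p) ^ (p / 8) =
          (ε : ZMod p) * (-1 : ZMod p) ^ (x / 4) * ((d : ZMod p) / (c : ZMod p)))) ∧
    (p % 8 = 1 → 2 ∣ x → 8 ∣ y ∧ ∀ ε : ℤ, ε = 1 ∨ ε = -1 →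
      ((x ≡ ε * (4 * c) [ZMOD 11] ∨ x ≡ ε * (9 * c) [ZMOD 11]) →
        (-11 : ZMod p) ^ (p / 8) = -(ε : ZMod p) * (-1 : ZMod p) ^ (x / 8 + y / 8)) ∧
      ((x ≡ ε * (4 * d) [ZMOD 11] ∨ x ≡ ε * (9 * d) [ZMOD 11]) →
        (-11 : ZMod p) ^ (p / 8) =
          -(ε : ZMod p) * (-1 : ZMod p) ^ (x / 8 + y / 8) * ((d : ZMod p) / (c : ZMod p)))) ∧
    (p % 8 = 5 → ¬ 2 ∣ x → ∀ ε : ℤ, ε = 1 ∨ ε = -1 →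
      ((x ≡ ε * (4 * c) [ZMOD 11] ∨ x ≡ ε * (9 * c) [ZMOD 11]) →
        (-11 : ZMod p) ^ (p / 8) =
          -(ε : ZMod p) * (-1 : ZMod p) ^ ((x ^ 2 - 1) / 8) * ((y : ZMod p) / (x : ZMod p))) ∧
      ((x ≡ ε * (4 * d) [ZMOD 11] ∨ x ≡ ε * (9 * d) [ZMOD 11]) →
        (-11 : ZMod p) ^ (p / 8) =
          -(ε : ZMod p) * (-1 : ZMod p) ^ ((x ^ 2 - 1) / 8) *
            (((d : ZMod p) * (y : ZMod p)) / ((c : ZMod p) * (x : ZMod p))))) ∧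
    (p % 8 = 5 → 2 ∣ x → ∀ ε : ℤ, ε = 1 ∨ ε = -1 →
      ((x ≡ ε * (4 * c) [ZMOD 11] ∨ x ≡ ε * (9 * c) [ZMOD 11]) →
        (-11 : ZMod p) ^ (p / 8) =
          -(ε : ZMod p) * (-1 : ZMod p) ^ ((p - 5) / 8) * ((y : ZMod p) / (x : ZMod p))) ∧
      ((x ≡ ε * (4 * d) [ZMOD 11] ∨ x ≡ ε * (9 * d) [ZMOD 11]) →
        (-11 : ZMod p) ^ (p / 8) =
          -(ε : ZMod p) * (-1 : ZMod p) ^ ((p - 5) / 8) *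
            (((d : ZMod p) * (y : ZMod p)) / ((c : ZMod p) * (x : ZMod p))))) := by
  have hp : p.Prime := Fact.out
  have hpi := Nat.prime_iff_prime_int.1 hp
  have hp2 := hp.two_le
  have hp11 : ¬ (p : ℤ) ∣ 11 := by
    intro h
    have h1 : p ∣ 11 := by exact_mod_cast h
    rcases (Nat.dvd_prime (by norm_num)).1 h1 with rfl | rfl <;> omega
  have hp4' : ¬ (p : ℤ) ∣ 4 := by
    intro h
    have h1 : p ∣ 2 ^ 2 := by exact_mod_cast h
    have h2 := Nat.le_of_dvd (by norm_num) (hp.dvd_of_dvd_pow h1)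
    omega
  have hp1 : ¬ (p : ℤ) ∣ 1 := fun h => hpi.not_isUnit (isUnit_of_dvd_one h)
  have hc0 : (c : ZMod p) ≠ 0 :=
    intCast_zmod_ne_zero (m := 1) (k := 1) (b := d) (by rw [hcd]; ring) hp1 hp1
  have hx0 : (x : ZMod p) ≠ 0 := intCast_zmod_ne_zero hxy hp4' hp11
  have hzxy : (x : ZMod p) ^ 2 = -11 * (y : ZMod p) ^ 2 := by
    have := congrArg (Int.cast : ℤ → ZMod p) hxy
    push_cast at this
    rw [ZMod.natCast_self] at this
    linear_combination -this
  have hy0 : (y : ZMod p) ≠ 0 := by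
    intro h
    rw [h] at hzxy
    exact hx0 (pow_eq_zero_iff two_ne_zero |>.1 (by rw [hzxy]; ring))
  have hc4 : c % 4 = 1 := hc
  have hy₀4 : y₀ % 4 = 1 := hy₀
  have odd_case : ∀ E : ℤ, ¬ 2 ∣ x → (p % 8 = 1 → E = 1 + x / 4) →
      (p % 8 = 5 → E = (x ^ 2 - 1) / 8) → ∀ ε : ℤ, ε = 1 ∨ ε = -1 → ∀ s : ℕ,
      ((s = 0 ∧ (x ≡ ε * (4 * c) [ZMOD 11] ∨ x ≡ ε * (9 * c) [ZMOD 11])) ∨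
        (s = 1 ∧ (x ≡ ε * (4 * d) [ZMOD 11] ∨ x ≡ ε * (9 * d) [ZMOD 11]))) →
      (p % 8 = 1 → (-11 : ZMod p) ^ (p / 8) = (-1) ^ E * (-ε * ((d : ZMod p) / c) ^ s)) ∧
      (p % 8 = 5 → (-11 : ZMod p) ^ (p / 8) =
        (-1) ^ E * (-ε * ((d : ZMod p) / c) ^ s) * ((y : ZMod p) / x)) := by
    intro E hx2 hE1 hE5 ε hε s hs
    have hxo : Odd x := by rw [Int.odd_iff]; omega
    have ht : t = 0 := by
      rcases t with _ | t
      · rfl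
      obtain ⟨l, hl⟩ := hxo
      have : 4 * (p : ℤ) = 4 * (l ^ 2 + l + 11 * (2 ^ t * y₀) ^ 2) + 1 := by
        rw [hxy, hl, hy]; ring
      omega
    have hy4 : y % 4 = 1 := by rw [hy, ht, pow_zero, one_mul, hy₀4]
    exact neg_eleven_pow_of_pow_eq hx0 hy0 hzxy
      (pow_eq_of_odd hp4 hcd hc0 hxy hc4 hxo hy4 hε hs hE1 hE5)
  have even_case : ∀ E : ℤ, 2 ∣ x → (p % 8 = 1 → E = x / 8 + y / 8) →
      (p % 8 = 5 → E = ((p - 5) / 8 : ℕ)) → ∀ ε : ℤ, ε = 1 ∨ ε = -1 → ∀ s : ℕ,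
      ((s = 0 ∧ (x ≡ ε * (4 * c) [ZMOD 11] ∨ x ≡ ε * (9 * c) [ZMOD 11])) ∨
        (s = 1 ∧ (x ≡ ε * (4 * d) [ZMOD 11] ∨ x ≡ ε * (9 * d) [ZMOD 11]))) →
      (p % 8 = 1 → (-11 : ZMod p) ^ (p / 8) = (-1) ^ E * (-ε * ((d : ZMod p) / c) ^ s)) ∧
      (p % 8 = 5 → (-11 : ZMod p) ^ (p / 8) =
        (-1) ^ E * (-ε * ((d : ZMod p) / c) ^ s) * ((y : ZMod p) / x)) := by
    intro E hx2 hE1 hE5 ε hε s hs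
    obtain ⟨X, Y, r, hX, hY, hpXY, hXo, hYr, -⟩ := exists_half_of_even hp4 hxy hx2 hy hy₀4
    have h2 : (2 : ZMod p) ≠ 0 := by
      intro h
      rw [hX] at hx0
      push_cast at hx0
      rw [h, zero_mul] at hx0
      exact hx0 rfl
    -- Halving matches the floors: [x/8] = [X/4] and [y/8] = [Y/4].
    have key := pow_eq_of_even (E := E) hp4 hcd hc0 hpXY hc4 hXo hYr hy₀4 hε (by rwa [← hX])
      (fun h8 => by rw [hE1 h8]; omega) (fun h8 => by rw [hE5 h8]; omega)
    have hx' : (x : ZMod p) = 2 * X := by rw [hX]; push_cast; rfl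
    have hy' : (y : ZMod p) = 2 * Y := by rw [hY]; push_cast; rfl
    refine neg_eleven_pow_of_pow_eq hx0 hy0 hzxy ?_
    rw [hx', hy', mul_pow, mul_pow, key]
    ring
  have hdiv : (d : ZMod p) * y / (c * x) = d / c * (y / x) := (div_mul_div_comm _ _ _ _).symm
  have hn : (-1 : ZMod p) ≠ 0 := neg_ne_zero.2 one_ne_zero
  refine ⟨⟨hc0, hx0⟩, exists_sign_modEq_eleven ⟨-y ^ 2, by linear_combination -hxy + 4 * hcd⟩,
    fun h8 hx2 ε hε => ?_, fun h8 hx2 => ⟨?_, fun ε hε => ?_⟩, fun h8 hx2 ε hε => ?_,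
    fun h8 hx2 ε hε => ?_⟩
  -- The extra 1 in the exponent turns -ε into ε.
  · have key := odd_case (1 + x / 4) hx2 (fun _ => rfl) (by omega) ε hε
    refine ⟨fun h => ?_, fun h => ?_⟩
    · rw [(key 0 (Or.inl ⟨rfl, h⟩)).1 h8, zpow_add₀ hn]; ring
    · rw [(key 1 (Or.inr ⟨rfl, h⟩)).1 h8, zpow_add₀ hn]; ring
  · obtain ⟨X, Y, r, -, hY, -, -, -, h⟩ := exists_half_of_even hp4 hxy hx2 hy hy₀4
    have := h h8
    omega
  · have key := even_case (x / 8 + y / 8) hx2 (fun _ => rfl) (by omega) ε hε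
    refine ⟨fun h => ?_, fun h => ?_⟩
    · rw [(key 0 (Or.inl ⟨rfl, h⟩)).1 h8]; ring
    · rw [(key 1 (Or.inr ⟨rfl, h⟩)).1 h8]; ring
  · have key := odd_case ((x ^ 2 - 1) / 8) hx2 (by omega) (fun _ => rfl) ε hε
    refine ⟨fun h => ?_, fun h => ?_⟩
    · rw [(key 0 (Or.inl ⟨rfl, h⟩)).2 h8]; ring
    · rw [(key 1 (Or.inr ⟨rfl, h⟩)).2 h8, hdiv]; ring
  · have key := even_case ((p - 5) / 8 : ℕ) hx2 (by omega) (fun _ => rfl) ε hε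
    refine ⟨fun h => ?_, fun h => ?_⟩
    · rw [(key 0 (Or.inl ⟨rfl, h⟩)).2 h8, zpow_natCast]; ring
    · rw [(key 1 (Or.inr ⟨rfl, h⟩)).2 h8, hdiv, zpow_natCast]; ring
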